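/- **Setting.** Let $\ell,p,n$ be positive integers with $p\mid \ell$, let $\zeta\in\mathbb C$ be a primitive $\ell$-th root of unity, and let $\hbar,k\in\mathbb C$ with $\hbar\neq 0$, and $c_m\in\mathbb C$ for $0<m<\ell$, $p\mid m$. Put $P(u)=\sum_{0<m<\ell,\ p\mid m}c_mu^m$. Let $t_i$ be the diagonal $n\times n$ matrix with entry $\zeta$ at place $i$ and $1$ elsewhere, and let $W=G(\ell,p,n)$ be the group of monomial matrices whose nonzero entries are $\ell$-th roots of unity with product an $(\ell/p)$-th root of unity. The rational Cherednik algebra $\mathsf H_p$ is the $\mathbb C$-algebra generated by $W$ and $x_1,\dots,x_n,y_1,\dots,y_n$, where the $x_i$ span the reflection representation of $W$ and the $y_i$ are the dual basis ($wv=w(v)w$ for $w\in W$ and $v$ in the span of the $x_i$ or of the $y_i$), with the relations $[x_i,x_j]=[y_i,y_j]=0$, $$[x_i,y_i]=\hbar+k\sum_{j\ne i}\sum_{r=0}^{\ell-1}t_i^rt_j^{-r}(i,j)+P(t_i)-P(\zeta^{-1}t_i),\qquad [x_i,y_j]=-k\sum_{r=0}^{\ell-1}\zeta^{-r}t_i^rt_j^{-r}(i,j)\quad(i\neq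 j).$$ Let $A\subset W$ be the subgroup of diagonal matrices (generated by the $t_i^p$ and $t_it_{i+1}^{-1}$) and $e'=|A|^{-1}\sum_{a\in A}a$. The *partially spherical subalgebra* is $e'\mathsf H_pe'$, a ring with unit $e'$. Let $\sigma,\tau,u_i\in\mathsf H_p$ be defined by $x_1=\sigma\,(n,\dots,1)$, $y_n=\tau\,(1,\dots,n)$, where $(1,\dots,n)$ is the permutation $i\mapsto i+1$, $n\mapsto 1$ and $(n,\dots,1)$ is its inverse, and $u_i=x_iy_i+P(\zeta^{-1}t_i)-\hbar-k\sum_{j<i}\sum_{r=0}^{\ell-1} t_i^rt_j^{-r}(i,j)$. *Galois orders.* Let $\Gamma=\mathbb C[U_1,\dots,U_n]$ and $K=\mathbb C(U_1,\dots,U_n)$. Let $\mu_i$ be the automorphism $U_j\mapsto U_j+\delta_{ij}\hbar$ of $\Gamma$, let $T=\langle \mu_1^{\pm \ell},\dots,\mu_n^{\pm\ell},(\mu_1\cdots\mu_n)^{\pm\ell/p}\rangle$, let $S_n$ permute the variables, and let $\mathscr K=K\star(T\rtimes S_n)$ be the skew group ring, with $(a\mu)(b\nu)=a\,\mu(b)\,\mu\nu$,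 acting on $K$ by $(\sum a_\mu\mu)(f)=\sum a_\mu\,\mu(f)$. A subring $\mathscr U\subseteq\mathscr K$ containing $\Gamma$ is a *Galois $\Gamma$-ring* in $\mathscr K$ if $\mathscr UK=\mathscr K=K\mathscr U$. It is a *Galois $\Gamma$-order* if moreover for every finite-dimensional left (respectively right) $K$-subspace $V\subseteq\mathscr K$ the left (respectively right) $\Gamma$-module $V\cap\mathscr U$ is finitely generated, and it is *principal* if also $\mathscr U(\Gamma)\subseteq\Gamma$. **Proposition.** (a) $\mathsf H_p$ has a representation on $$\mathscr P=\mathbb C[U_1,\dots,U_n;T_1^p,\dots,T_n^p,T_1T_2^{-1},\dots,T_{n-1}T_n^{-1}]/\langle T_i^\ell-1\rangle$$ in which $u_i$ acts as multiplication by $U_i$, each $t_1^{a_1}\cdots t_n^{a_n}\in A$ acts as multiplication by $T_1^{a_1}\cdots T_n^{a_n}$, and $$(i,i+1)\cdot f=f^{(i,i+1)}+k\ell\,\frac{f^{(i,i+1)}-f}{U_{i+1}-U_i}\,\pi_{i,i+1},\qquad \pi_{i,i+1}=\frac1\ell\sum_{r=0}^{\ell-1}T_i^rT_{i+1}^{-r},$$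 $$\sigma\cdot f=(U_1-P(\zeta^{-1}T_1)+\hbar)\,f(U_2,\dots,U_{n+1};T_2,\dots,T_{n+1}),\qquad \tau\cdot f=f(U_0,\dots,U_{n-1};T_0,\dots,T_{n-1}),$$ where $U_{n+1}=U_1+\hbar$, $T_{n+1}=\zeta^{-1}T_1$, $U_0=U_n-\hbar$, $T_0=\zeta T_n$, and $f^{(i,i+1)}$ is $f$ with $U_i,U_{i+1}$ exchanged and $T_i,T_{i+1}$ exchanged. (b) Identify $\Gamma$ with $e'\mathscr P$ by $f\mapsto f\cdot(e'\cdot 1)$. There is an injective ring homomorphism $\iota\colon e'\mathsf H_pe'\to\mathscr K$ such that, for all $h\in e'\mathsf H_pe'$ and $f\in\Gamma$, the element $\iota(h)(f)$ of $K$ lies in $\Gamma$ and corresponds to the action of $h$ on $f\in\Gamma\cong e'\mathscr P$. (c) The image of $\iota$, and so the partially spherical subalgebra $e'\mathsf H_pe'$, is a principal Galois $\mathbb C[U_1,\dots,U_n]$-order in $\mathbb C(U_1,\dots,U_n)\star(T\rtimes S_n)$. -/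

import Mathlib

noncomputable section

namespace PartiallySpherical

open MvPolynomial

/-! ### Parameters and the group `G(ℓ,p,n)` -/

/-- The parameters of the rational Cherednik algebra of `G(ℓ,p,n)` over `ℂ`: positive integers
`ℓ, p, n` with `p ∣ ℓ`, a primitive `ℓ`-th root of unity `ζ`, and numbers `hbar`, `k`
(the parameter of all reflections `t_i^r t_j^{-r} (i,j)`) and `c m`
(the parameter of the reflections `t_i^m`, for `0 < m < ℓ` with `p ∣ m`;
the other values of `c` are never used). -/
structure Datum where
  /-- the order of the roots of unity -/
  ℓ : ℕ
  /-- the index -/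
  p : ℕ
  /-- the rank -/
  n : ℕ
  ell_ne : NeZero ℓ
  n_ne : NeZero n
  p_dvd : p ∣ ℓ
  /-- the primitive root of unity -/
  ζ : rootsOfUnity ℓ ℂ
  prim : IsPrimitiveRoot ζ ℓ
  /-- the deformation parameter -/
  hbar : ℂ
  /-- the parameter of the reflections `t_i^r t_j^{-r} (i,j)` -/
  k : ℂ
  /-- the parameters of the reflections `t_i^m` -/
  c : ℕ → ℂ

attribute [instance] Datum.ell_ne Datum.n_ne

variable (D : Datum)

/-- The group `μ_ℓ` of `ℓ`-th roots of unity in `ℂ`. -/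
abbrev Mu : Type := rootsOfUnity D.ℓ ℂ

/-- A root of unity as a complex number. -/
def toC (z : Mu D) : ℂ := ((z : ℂˣ) : ℂ)

/-- The group `G(ℓ,1,n)`: the pair `(a, w)` stands for the monomial matrix
`diag(a_1, …, a_n) · P_w`, where `P_w` is the permutation matrix with `P_w e_j = e_{w j}`. -/
abbrev Monomial : Type := (Fin D.n → Mu D) ⋊[mulAutArrow] Equiv.Perm (Fin D.n)

/-- The subgroup `G(ℓ,p,n)` of `G(ℓ,1,n)`: the product of the nonzero entries is an
`ℓ/p`-th root of unity. -/
def reflectionGroup : Subgroup (Monomial D) where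
  carrier := {w | (∏ i, w.left i) ^ (D.ℓ / D.p) = 1}
  one_mem' := by simp
  mul_mem' := by
    intro v w hv hw
    simp only [Set.mem_ofPred_eq, SemidirectProduct.mul_left, Pi.mul_apply,
      Finset.prod_mul_distrib, mul_pow] at hv hw ⊢
    rw [hv, one_mul, ← hw]
    congr 1
    exact Equiv.prod_comp (v.right⁻¹) w.left
  inv_mem' := by
    intro w hw
    simp only [Set.mem_ofPred_eq, SemidirectProduct.inv_left] at hw ⊢
    have h : (∏ i, (mulAutArrow w.right⁻¹ w.left⁻¹ : Fin D.n → Mu D) i)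
        = (∏ i, w.left i)⁻¹ := by
      rw [← Finset.prod_inv_distrib]
      exact Equiv.prod_comp (w.right⁻¹⁻¹) (fun i => (w.left i)⁻¹)
    rw [h, inv_pow, hw, inv_one]

/-- The group `A` of diagonal matrices in `G(ℓ,p,n)`. -/
def diagonalGroup : Subgroup (Fin D.n → Mu D) where
  carrier := {a | (∏ i, a i) ^ (D.ℓ / D.p) = 1}
  one_mem' := by simp
  mul_mem' := by
    intro a b ha hb
    simp only [Set.mem_ofPred_eq, Pi.mul_apply, Finset.prod_mul_distrib, mul_pow] at ha hb ⊢
    rw [ha, hb, one_mul]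
  inv_mem' := by
    intro a ha
    simp only [Set.mem_ofPred_eq, Pi.inv_apply, Finset.prod_inv_distrib, inv_pow] at ha ⊢
    rw [ha, inv_one]

instance : Fintype (Mu D) := Fintype.ofFinite _

instance : Fintype (diagonalGroup D) := Fintype.ofFinite _

/-- The inclusion of `A` into `G(ℓ,p,n)`. -/
def diag : diagonalGroup D →* reflectionGroup D where
  toFun a := ⟨⟨a.1, 1⟩, a.2⟩
  map_one' := rfl
  map_mul' a b := by
    apply Subtype.ext
    ext1
    · show a.1 * b.1 = a.1 * mulAutArrow 1 b.1
      rw [map_one]; rfl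
    · show (1 : Equiv.Perm (Fin D.n)) = 1 * 1
      rw [one_mul]

/-- The inclusion of `S_n` into `G(ℓ,p,n)` by permutation matrices. -/
def perm : Equiv.Perm (Fin D.n) →* reflectionGroup D where
  toFun w := ⟨⟨1, w⟩, by simp [reflectionGroup]⟩
  map_one' := rfl
  map_mul' v w := by
    apply Subtype.ext
    ext1
    · show (1 : Fin D.n → Mu D) = 1 * mulAutArrow v 1
      rw [map_one, one_mul]
    · rfl

/-- The diagonal matrix `t_i^r t_j^{-r}`, written in terms of `z = ζ^r`: it has entry `z` at `i`
and `z⁻¹` at `j` (and it is the identity if `i = j`). -/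
def tRatio (i j : Fin D.n) (z : Mu D) : diagonalGroup D :=
  ⟨Pi.mulSingle i z * Pi.mulSingle j z⁻¹, by
    simp [diagonalGroup, Finset.prod_mul_distrib, Finset.prod_pi_mulSingle']⟩

/-- The diagonal matrix `t_i^{pq}`, where `t_i` has entry `ζ` at `i` and `1` elsewhere. -/
def tPow (i : Fin D.n) (q : ℕ) : diagonalGroup D :=
  ⟨Pi.mulSingle i (D.ζ ^ (D.p * q)), by
    have h : D.p * q * (D.ℓ / D.p) = D.ℓ * q := by
      rw [mul_right_comm, Nat.mul_div_cancel' D.p_dvd]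
    simp [diagonalGroup, Finset.prod_pi_mulSingle', ← pow_mul, h]
    rw [pow_mul, D.prim.pow_eq_one, one_pow]⟩

/-- The reflection `t_i^r t_j^{-r} (i,j)`, written in terms of `z = ζ^r`. -/
def refl (i j : Fin D.n) (z : Mu D) : reflectionGroup D :=
  diag D (tRatio D i j z) * perm D (Equiv.swap i j)

/-! ### The rational Cherednik algebra -/

/-- Generators of the rational Cherednik algebra: the group `G(ℓ,p,n)`, a basis `x_i` of its
reflection representation, and the dual basis `y_i`. -/
inductive Gen : Type
  | g : reflectionGroup D → Gen
  | x : Fin D.n → Gen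
  | y : Fin D.n → Gen

/-- The generator `w` of the free algebra. -/
abbrev fg (w : reflectionGroup D) : FreeAlgebra ℂ (Gen D) := FreeAlgebra.ι ℂ (Gen.g w)
/-- The generator `x_i` of the free algebra. -/
abbrev fx (i : Fin D.n) : FreeAlgebra ℂ (Gen D) := FreeAlgebra.ι ℂ (Gen.x i)
/-- The generator `y_i` of the free algebra. -/
abbrev fy (i : Fin D.n) : FreeAlgebra ℂ (Gen D) := FreeAlgebra.ι ℂ (Gen.y i)

/-- The element `P(v t_i)` of the free algebra, where `P(u) = ∑_{0 < m < ℓ, p ∣ m} c_m u^m`. -/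
def fPoly (i : Fin D.n) (v : ℂ) : FreeAlgebra ℂ (Gen D) :=
  ∑ q ∈ Finset.Ico 1 (D.ℓ / D.p),
    (D.c (D.p * q) * v ^ (D.p * q)) • fg D (diag D (tPow D i q))

/-- The defining relations of the rational Cherednik algebra: those of `T(V) ⋊ W`, with
`V` spanned by the `x_i` and the `y_i`, and the commutation relations. -/
inductive Rel : FreeAlgebra ℂ (Gen D) → FreeAlgebra ℂ (Gen D) → Prop
  | one : Rel (fg D 1) 1
  | mul (v w : reflectionGroup D) : Rel (fg D v * fg D w) (fg D (v * w))
  | gx (w : reflectionGroup D) (i : Fin D.n) :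
      Rel (fg D w * fx D i)
        (toC D (w.1.left (w.1.right i)) • (fx D (w.1.right i) * fg D w))
  | gy (w : reflectionGroup D) (i : Fin D.n) :
      Rel (fg D w * fy D i)
        ((toC D (w.1.left (w.1.right i)))⁻¹ • (fy D (w.1.right i) * fg D w))
  | xx (i j : Fin D.n) : Rel (fx D i * fx D j) (fx D j * fx D i)
  | yy (i j : Fin D.n) : Rel (fy D i * fy D j) (fy D j * fy D i)
  | xy_same (i : Fin D.n) :
      Rel (fx D i * fy D i - fy D i * fx D i)
        (algebraMap ℂ _ D.hbar
          + D.k • ∑ j ∈ Finset.univ.erase i, ∑ z : Mu D, fg D (refl D i j z)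
          + fPoly D i 1 - fPoly D i (toC D D.ζ)⁻¹)
  | xy_ne (i j : Fin D.n) (h : i ≠ j) :
      Rel (fx D i * fy D j - fy D j * fx D i)
        (-(D.k • ∑ z : Mu D, (toC D z)⁻¹ • fg D (refl D i j z)))

/-- The rational Cherednik algebra `H_p` of `G(ℓ,p,n)`. -/
abbrev H : Type := RingQuot (Rel D)

/-- The image in `H_p` of an element of `G(ℓ,p,n)`. -/
def hg (w : reflectionGroup D) : H D := RingQuot.mkAlgHom ℂ (Rel D) (fg D w)
/-- The generator `x_i` of `H_p`. -/
def hx (i : Fin D.n) : H D := RingQuot.mkAlgHom ℂ (Rel D) (fx D i)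
/-- The generator `y_i` of `H_p`. -/
def hy (i : Fin D.n) : H D := RingQuot.mkAlgHom ℂ (Rel D) (fy D i)

/-- The first index. -/
def first : Fin D.n := ⟨0, Nat.pos_of_ne_zero D.n_ne.out⟩
/-- The last index. -/
def last : Fin D.n := ⟨D.n - 1, Nat.sub_lt (Nat.pos_of_ne_zero D.n_ne.out) one_pos⟩

/-- The element `σ`, characterised by `x_1 = σ · (n, …, 1)`, where `(n, …, 1)` is the inverse of
the cyclic permutation `i ↦ i + 1`. -/
def hsigma : H D := hx D (first D) * hg D (perm D (finRotate D.n))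

/-- The element `τ`, characterised by `y_n = τ · (1, …, n)`. -/
def htau : H D := hy D (last D) * hg D (perm D (finRotate D.n)⁻¹)

/-- The Dunkl–Opdam element
`u_i = x_i y_i + P(ζ⁻¹ t_i) - hbar - k ∑_{j < i} ∑_r t_i^r t_j^{-r} (i,j)`. -/
def hu (i : Fin D.n) : H D :=
  hx D i * hy D i + RingQuot.mkAlgHom ℂ (Rel D) (fPoly D i (toC D D.ζ)⁻¹)
    - algebraMap ℂ _ D.hbar
    - D.k • ∑ j ∈ Finset.univ.filter (· < i), ∑ z : Mu D, hg D (refl D i j z)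

/-- The idempotent `e' = |A|⁻¹ ∑_{a ∈ A} a`. -/
def ePrime : H D :=
  (Fintype.card (diagonalGroup D) : ℂ)⁻¹ • ∑ a : diagonalGroup D, hg D (diag D a)

theorem hg_mul (v w : reflectionGroup D) : hg D v * hg D w = hg D (v * w) := by
  simpa [hg] using RingQuot.mkAlgHom_rel ℂ (Rel.mul v w)

theorem ePrime_idem : IsIdempotentElem (ePrime D) := by
  have key : ∀ a : diagonalGroup D,
      hg D (diag D a) * ∑ b : diagonalGroup D, hg D (diag D b)
        = ∑ b : diagonalGroup D, hg D (diag D b) := by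
    intro a
    rw [Finset.mul_sum]
    simp only [hg_mul, ← map_mul]
    exact Fintype.sum_equiv (Equiv.mulLeft a) _ _ (fun _ => rfl)
  have hN : (Fintype.card (diagonalGroup D) : ℂ) ≠ 0 := by
    exact_mod_cast Fintype.card_ne_zero
  unfold IsIdempotentElem ePrime
  rw [smul_mul_smul_comm, Finset.sum_mul]
  simp only [key, Finset.sum_const, Finset.card_univ]
  rw [← Nat.cast_smul_eq_nsmul ℂ, smul_smul, mul_assoc, inv_mul_cancel₀ hN, mul_one]

/-- The partially spherical subalgebra `e' H_p e'`, a ring with unit `e'`. -/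
abbrev Psph : Type := (ePrime_idem D).Corner

/-! ### The polynomial representation -/

/-- The polynomial ring `ℂ[U_1, …, U_n]`. -/
abbrev PolyU : Type := MvPolynomial (Fin D.n) ℂ

/-- The ring
`ℂ[U_1, …, U_n; T_1^p, …, T_n^p, T_1 T_2⁻¹, …, T_{n-1} T_n⁻¹] / (T_i^ℓ - 1)`:
it has the `ℂ[U_1, …, U_n]`-basis of monomials `T^a = ∏ T_i^{α_i}`, for
`a = ∏ t_i^{α_i}` in `A`, and `single a f` is `f T^a`. -/
abbrev PolyRep : Type := MonoidAlgebra (PolyU D) (diagonalGroup D)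

/-- A polynomial in the `U_i` as an element of the larger ring. -/
def inU : PolyU D →+* PolyRep D := MonoidAlgebra.singleOneRingHom

/-- The monomial `T^a`. -/
def monT (a : diagonalGroup D) : PolyRep D := MonoidAlgebra.single a 1

/-- The operation of `S_n` on `A` with `t_i ↦ t_{w i}`. -/
def permA (w : Equiv.Perm (Fin D.n)) : diagonalGroup D →* diagonalGroup D where
  toFun a := ⟨fun i => a.1 (w⁻¹ i), by
    have h : ∏ i, a.1 (w⁻¹ i) = ∏ i, a.1 i := Equiv.prod_comp w⁻¹ a.1
    have ha : (∏ i, a.1 i) ^ (D.ℓ / D.p) = 1 := a.2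
    show (∏ i, a.1 (w⁻¹ i)) ^ (D.ℓ / D.p) = 1
    rw [h, ha]⟩
  map_one' := rfl
  map_mul' _ _ := rfl

/-- Substitution `f(U; T) ↦ f(u; t)`, where `t` gives the images of the monomials `T^a`. -/
def subst (u : Fin D.n → PolyU D) (t : diagonalGroup D →* PolyRep D) : PolyRep D →+* PolyRep D :=
  MonoidAlgebra.liftNCRingHom ((inU D).comp (MvPolynomial.aeval u : PolyU D →ₐ[ℂ] PolyU D).toRingHom)
    t (fun _ _ => Commute.all _ _)

/-- The substitution of monomials `T^a ↦ χ(a) T^{w a}`. -/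
def twistT (w : Equiv.Perm (Fin D.n)) (χ : diagonalGroup D →* ℂ) :
    diagonalGroup D →* PolyRep D where
  toFun a := inU D (C (χ a)) * monT D (permA D w a)
  map_one' := by simp [monT, MonoidAlgebra.one_def]
  map_mul' a b := by
    have h : monT D (permA D w a * permA D w b)
        = monT D (permA D w a) * monT D (permA D w b) := by
      simp [monT, MonoidAlgebra.single_mul_single]
    rw [map_mul, map_mul, map_mul, map_mul, h]
    ring

/-- The character `a ↦ a_i` of `A`. -/
def coordChar (i : Fin D.n) : diagonalGroup D →* ℂ where
  toFun a := toC D (a.1 i)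
  map_one' := by simp [toC]
  map_mul' a b := by simp [toC]

/-- The character `a ↦ a_i⁻¹` of `A`. -/
def coordCharInv (i : Fin D.n) : diagonalGroup D →* ℂ where
  toFun a := (toC D (a.1 i))⁻¹
  map_one' := by simp [toC]
  map_mul' a b := by simp [toC, mul_comm]

/-- `f ↦ f^{(i,j)}`: exchange `U_i` with `U_j` and `T_i` with `T_j`. -/
def exchange (i j : Fin D.n) : PolyRep D →+* PolyRep D :=
  subst D (fun m => X (Equiv.swap i j m)) (twistT D (Equiv.swap i j) 1)

/-- `f(U; T) ↦ f(U_2, …, U_{n+1}; T_2, …, T_{n+1})` with `U_{n+1} = U_1 + hbar` and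
`T_{n+1} = ζ⁻¹ T_1`; for the monomials this is `T^a ↦ a_n⁻¹ T^{a'}` with `a'` the cyclic
shift of `a`. -/
def shiftUp : PolyRep D →+* PolyRep D :=
  subst D (fun i => X (finRotate D.n i) + if i = last D then C D.hbar else 0)
    (twistT D (finRotate D.n) (coordCharInv D (last D)))

/-- `f(U; T) ↦ f(U_0, …, U_{n-1}; T_0, …, T_{n-1})` with `U_0 = U_n - hbar` and
`T_0 = ζ T_n`. -/
def shiftDown : PolyRep D →+* PolyRep D :=
  subst D (fun i => X ((finRotate D.n)⁻¹ i) - if i = first D then C D.hbar else 0)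
    (twistT D (finRotate D.n)⁻¹ (coordChar D (first D)))

/-- The element `π_{i,j} = ℓ⁻¹ ∑_r T_i^r T_j^{-r}`. -/
def piT (i j : Fin D.n) : PolyRep D :=
  inU D (C (D.ℓ : ℂ)⁻¹) * ∑ z : Mu D, monT D (tRatio D i j z)

/-- The element `P(v T_i)`, where `P(u) = ∑_{0 < m < ℓ, p ∣ m} c_m u^m`. -/
def polyT (i : Fin D.n) (v : ℂ) : PolyRep D :=
  ∑ q ∈ Finset.Ico 1 (D.ℓ / D.p),
    inU D (C (D.c (D.p * q) * v ^ (D.p * q))) * monT D (tPow D i q)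

/-- `ρ` is the polynomial representation of `H_p`, given on `u_i`, on `A`, on the simple
transpositions, on `σ` and on `τ` by the usual formulas. In the formula for the transposition
`(i,i+1)`, which reads
`f^{(i,i+1)} + k ℓ (f^{(i,i+1)} - f) / (U_{i+1} - U_i) · π_{i,i+1}`,
the denominator (a non-zero-divisor) is cleared. -/
structure IsPolynomialRep (ρ : H D →ₐ[ℂ] Module.End ℂ (PolyRep D)) : Prop where
  u : ∀ (i : Fin D.n) (f : PolyRep D), ρ (hu D i) f = inU D (X i) * f
  t : ∀ (a : diagonalGroup D) (f : PolyRep D), ρ (hg D (diag D a)) f = monT D a * f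
  s : ∀ (i j : Fin D.n), (j : ℕ) = i + 1 → ∀ f : PolyRep D,
    inU D (X j - X i) * ρ (hg D (perm D (Equiv.swap i j))) f
      = inU D (X j - X i) * exchange D i j f
        + inU D (C (D.k * D.ℓ)) * (exchange D i j f - f) * piT D i j
  sigma : ∀ f : PolyRep D, ρ (hsigma D) f
    = (inU D (X (first D)) - polyT D (first D) (toC D D.ζ)⁻¹ + inU D (C D.hbar)) * shiftUp D f
  tau : ∀ f : PolyRep D, ρ (htau D) f = shiftDown D f

/-- The identification `ℂ[U_1, …, U_n] ≅ e' · PolyRep`, `f ↦ f E'` with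
`E' = |A|⁻¹ ∑_{a ∈ A} T^a`. -/
def embed (f : PolyU D) : PolyRep D :=
  inU D f * (inU D (C (Fintype.card (diagonalGroup D) : ℂ)⁻¹) * ∑ a : diagonalGroup D, monT D a)

/-! ### Galois rings and orders in skew group rings -/

section Galois

/-- The embedding `a ↦ a · 1` of the field `K` into the skew monoid ring `K ⋆ M`, in which
`(a v) (b w) = (a · v(b)) (v w)`. -/
def coef {K M : Type*} [Field K] [Group M] [MulSemiringAction M K] (a : K) :
    SkewMonoidAlgebra K M := SkewMonoidAlgebra.single 1 a

/-- Evaluation: `∑ a_w w` acts on `K` by `f ↦ ∑ a_w w(f)`. -/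
def evalAt {K M : Type*} [Field K] [Group M] [MulSemiringAction M K]
    (X : SkewMonoidAlgebra K M) (f : K) : K := X.sum fun w a => a * (w • f)

/-- A subring `U` of `K ⋆ M` is a Galois `Γ`-ring in `K ⋆ M`: it contains `Γ`, and
`U K = K ⋆ M = K U`. -/
structure IsGaloisRing (Γ : Type*) {K M : Type*} [CommRing Γ] [Field K] [Algebra Γ K] [Group M]
    [MulSemiringAction M K] (U : Subring (SkewMonoidAlgebra K M)) : Prop where
  base_mem : ∀ γ : Γ, coef (algebraMap Γ K γ) ∈ U
  mul_field : AddSubgroup.closure {z : SkewMonoidAlgebra K M | ∃ u ∈ U, ∃ a : K, z = u * coef a} = ⊤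
  field_mul : AddSubgroup.closure {z : SkewMonoidAlgebra K M | ∃ u ∈ U, ∃ a : K, z = coef a * u} = ⊤

/-- The left `R`-span of a finite family, for `R` given by a map `i` from `R`. -/
def leftSpan {R S : Type*} [Ring S] (i : R → S) {r : ℕ} (w : Fin r → S) : Set S :=
  {z | ∃ a : Fin r → R, z = ∑ j, i (a j) * w j}

/-- The right `R`-span of a finite family, for `R` given by a map `i` from `R`. -/
def rightSpan {R S : Type*} [Ring S] (i : R → S) {r : ℕ} (w : Fin r → S) : Set S :=
  {z | ∃ a : Fin r → R, z = ∑ j, w j * i (a j)}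

/-- A Galois `Γ`-ring `U` is a Galois `Γ`-order: for each finite-dimensional left (right)
`K`-subspace `W` of `K ⋆ M`, the left (right) `Γ`-module `W ∩ U` is finitely generated. -/
structure IsGaloisOrder (Γ : Type*) {K M : Type*} [CommRing Γ] [Field K] [Algebra Γ K] [Group M]
    [MulSemiringAction M K] (U : Subring (SkewMonoidAlgebra K M)) : Prop
    extends IsGaloisRing Γ U where
  left_fg : ∀ (r : ℕ) (w : Fin r → SkewMonoidAlgebra K M),
    ∃ (m : ℕ) (v : Fin m → SkewMonoidAlgebra K M),
      leftSpan (fun a : K => coef a) w ∩ U = leftSpan (fun γ : Γ => coef (algebraMap Γ K γ)) v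
  right_fg : ∀ (r : ℕ) (w : Fin r → SkewMonoidAlgebra K M),
    ∃ (m : ℕ) (v : Fin m → SkewMonoidAlgebra K M),
      rightSpan (fun a : K => coef a) w ∩ U = rightSpan (fun γ : Γ => coef (algebraMap Γ K γ)) v

/-- A Galois `Γ`-order is principal if it maps `Γ` to itself under evaluation on `K`. -/
structure IsPrincipalGaloisOrder (Γ : Type*) {K M : Type*} [CommRing Γ] [Field K] [Algebra Γ K]
    [Group M] [MulSemiringAction M K] (U : Subring (SkewMonoidAlgebra K M)) : Prop
    extends IsGaloisOrder Γ U where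
  eval_mem : ∀ u ∈ U, ∀ γ : Γ, ∃ γ' : Γ, evalAt u (algebraMap Γ K γ) = algebraMap Γ K γ'

end Galois

/-! ### The skew group ring `ℂ(U_1, …, U_n) ⋆ (T ⋊ S_n)` -/

/-- The translation `U_j ↦ U_j + v_j` of `ℂ[U_1, …, U_n]`. -/
def translate (v : Fin D.n → ℂ) : PolyU D ≃ₐ[ℂ] PolyU D :=
  AlgEquiv.ofAlgHom (aeval fun j => X j + C (v j)) (aeval fun j => X j - C (v j))
    (by ext j; simp) (by ext j; simp)

/-- The automorphism `μ_i`, with `U_j ↦ U_j + δ_{ij} hbar`. -/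
def muAut (i : Fin D.n) : PolyU D ≃ₐ[ℂ] PolyU D := translate D (Pi.single i D.hbar)

/-- The automorphism `μ_1 ⋯ μ_n`, with `U_j ↦ U_j + hbar` for all `j`. -/
def muAll : PolyU D ≃ₐ[ℂ] PolyU D := translate D fun _ => D.hbar

/-- The lattice `T` of translations generated by the `μ_i^ℓ` and `(μ_1 ⋯ μ_n)^{ℓ/p}`. -/
def latticeT : Subgroup (PolyU D ≃ₐ[ℂ] PolyU D) :=
  Subgroup.closure (insert (muAll D ^ (D.ℓ / D.p)) (Set.range fun i => muAut D i ^ D.ℓ))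

/-- The group `S_n` of permutations of the variables, `U_j ↦ U_{w j}`. -/
def symmU : Subgroup (PolyU D ≃ₐ[ℂ] PolyU D) :=
  Subgroup.closure (Set.range fun w : Equiv.Perm (Fin D.n) => renameEquiv ℂ w)

/-- The group `T ⋊ S_n` of automorphisms of `ℂ[U_1, …, U_n]`. -/
def affineGroup : Subgroup (PolyU D ≃ₐ[ℂ] PolyU D) := latticeT D ⊔ symmU D

/-- The field `ℂ(U_1, …, U_n)`. -/
abbrev FieldU : Type := FractionRing (PolyU D)

/-- The automorphisms in `T ⋊ S_n`, extended to `ℂ(U_1, …, U_n)`. -/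
instance : MulSemiringAction (affineGroup D) (FieldU D) :=
  IsFractionRing.mulSemiringAction (affineGroup D) (PolyU D) (FieldU D)

/-- The skew group ring `ℂ(U_1, …, U_n) ⋆ (T ⋊ S_n)`. -/
abbrev SkewU : Type := SkewMonoidAlgebra (FieldU D) (affineGroup D)

end PartiallySpherical

end

noncomputable section

namespace PartiallySpherical

open MvPolynomial

section

/-! ### Permutations: descents, the Coxeter presentation, and equivariant families -/

section Permutations

variable {n : ℕ}

/-! The algebra is realised by operators on the group algebra of `A` over K = ℂ(U_1, …, U_n)
(`RatRep`). Pairs (v, w) with v an integer vector and w a permutation act there by U_j ↦ U_{wj} +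
hbar v_{wj}, T_j ↦ ζ^{-v_{wj}} T_{wj}, and all operators in play are sums of products of
multiplications with such pairs.

Representation. The transposition s = (i, i+1) acts by s + r(s - 1) with r_{ij} = kℓ π_{ij} / (U_j -
U_i). Antisymmetry of r makes this an involution, and the classical Yang–Baxter equation
(`rMat_yangBaxter`: partial fractions, together with T_i = T_j on the image of π_{ij}) gives the
braid relation, so the Coxeter presentation yields an action of S_n. Put x_1 = σ c⁻¹ and y_1 = c τ
for the cycle c, and define the other x_i, y_i by conjugation. Both elements commute with the
stabiliser of the first index, so S_n permutes the two families and every relation needs checking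
for one choice of indices only. For [x_i, y_i], the products στ and τσ are multiplications, and the
degenerate affine Hecke relation `permOp_ratU` propagates them to all i. For [x_i, y_j] the point is
the computation `sigma_tau_commutator`. Polynomials are preserved because U_j - U_i divides
f^{(i,j)} - f.

Embedding. The summand e' · `RatRep` is a copy of K, cut out by the trivial character of `A`. A pair
(v, w) contributes to e' h e' only if it fixes this character, that is, if ∏ a_i^{-v_i} = 1 on `A`;
these v form exactly the lattice T (`mem_affineGroup_iff`). Hence e' h e' acts on K as an element of
the skew group ring. By independence of characters that element is determined by its action on Γ, so
the assignment is a ring homomorphism.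

Injectivity. The monomials x^α y^β w span the algebra (`mem_span_pbw`). Filter operators by the
total degree of their coefficients. As r has degree -1, the leading term of x^α y^β w is a nonzero
scalar times U^α T^a · (α - β, w), where a is the diagonal part of the group element and w its
permutation. For hbar ≠ 0 distinct pairs act on Γ by distinct automorphisms, so these leading terms
are independent and the representation is faithful (`ratRho_injective`).

Galois order. By `isPrincipalGaloisOrder_of` it suffices that the image contains Γ, preserves Γ, and
contains a nonzero multiple of each group element: preserving Γ bounds denominators on any finite
support, and Γ is Noetherian. The multiples of group elements come from σ, τ and the intertwiners of
the transpositions (`hasLift`). -/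

theorem rearrangement_swap_lt (w : Equiv.Perm (Fin n)) {i j : Fin n} (hij : (j : ℕ) = i + 1)
    (hw : w j < w i) :
    ∑ a : Fin n, (n - (a : ℕ)) * ((w * Equiv.swap i j) a : ℕ) < ∑ a : Fin n, (n - (a : ℕ)) * (w a : ℕ) := by
  have hne : i ≠ j := by
    rintro rfl; omega
  have hj : j ∈ Finset.univ.erase i := by simp [hne.symm]
  rw [← Finset.add_sum_erase _ _ (Finset.mem_univ i), ← Finset.add_sum_erase _ _ hj,
    ← Finset.add_sum_erase (a := i) _ (fun a : Fin n => (n - (a : ℕ)) * (w a : ℕ))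
      (Finset.mem_univ i), ← Finset.add_sum_erase _ (fun a : Fin n => (n - (a : ℕ)) * (w a : ℕ)) hj,
    ← add_assoc, ← add_assoc]
  have h1 : ∑ a ∈ (Finset.univ.erase i).erase j, (n - (a : ℕ)) * ((w * Equiv.swap i j) a : ℕ)
      = ∑ a ∈ (Finset.univ.erase i).erase j, (n - (a : ℕ)) * (w a : ℕ) := by
    refine Finset.sum_congr rfl fun a ha => ?_
    simp only [Finset.mem_erase, Finset.mem_univ, and_true] at ha
    rw [Equiv.Perm.mul_apply, Equiv.swap_apply_of_ne_of_ne ha.2 ha.1]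
  rw [h1]
  refine Nat.add_lt_add_right ?_ _
  simp only [Equiv.Perm.mul_apply, Equiv.swap_apply_left, Equiv.swap_apply_right]
  -- Since i < n, the two weights are c + 1 and c, so the sum drops by exactly w i - w j.
  obtain ⟨c, hc⟩ : ∃ c, n - (i : ℕ) = c + 1 := ⟨n - i - 1, by have := j.2; omega⟩
  have hc' : n - (j : ℕ) = c := by omega
  rw [hc, hc']
  have : (w j : ℕ) < w i := hw
  nlinarith

/-- Without descents w would be strictly increasing, and the identity is the only order automorphism
of `Fin n`. -/
theorem exists_descent {w : Equiv.Perm (Fin n)} (hw : w ≠ 1) :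
    ∃ i j : Fin n, (j : ℕ) = i + 1 ∧ w j < w i := by
  by_contra! h
  apply hw
  have hmono : StrictMono w := by
    cases n with
    | zero => exact fun a => a.elim0
    | succ m =>
      rw [Fin.strictMono_iff_lt_succ]
      intro i
      refine lt_of_le_of_ne (h i.castSucc i.succ (by simp)) fun he => ?_
      exact (Fin.castSucc_lt_succ (i := i)).ne (w.injective he)
  have h1 : hmono.orderIsoOfSurjective w w.surjective = OrderIso.refl _ := Subsingleton.elim _ _
  ext i
  exact congrArg Fin.val (DFunLike.congr_fun h1 i)

/-- Induction on a permutation through its descents. -/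
theorem perm_descent_induction {p : Equiv.Perm (Fin n) → Prop} (one : p 1)
    (step : ∀ (w : Equiv.Perm (Fin n)) (i j : Fin n), (j : ℕ) = i + 1 → w j < w i →
      p (w * Equiv.swap i j) → p w) (w : Equiv.Perm (Fin n)) : p w := by
  induction hN : ∑ a : Fin n, (n - (a : ℕ)) * (w a : ℕ) using Nat.strong_induction_on generalizing w with
  | _ N ih =>
    by_cases hw : w = 1
    · exact hw ▸ one
    · obtain ⟨i, j, hij, hd⟩ := exists_descent hw
      exact step w i j hij hd (ih _ (hN ▸ rearrangement_swap_lt w hij hd) _ rfl)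

variable {M : Type*} [Monoid M]

/-- `m` is the value at `w` of some word obtained by removing descents of `w` one by one. -/
inductive DescentWord (s : Fin n → Fin n → M) : Equiv.Perm (Fin n) → M → Prop
  | one : DescentWord s 1 1
  | step (w : Equiv.Perm (Fin n)) (i j : Fin n) (hij : (j : ℕ) = i + 1) (hw : w j < w i) (m : M)
      (h : DescentWord s (w * Equiv.swap i j) m) : DescentWord s w (m * s i j)

theorem DescentWord.exists (s : Fin n → Fin n → M) (w : Equiv.Perm (Fin n)) :
    ∃ m, DescentWord s w m :=
  perm_descent_induction (p := fun w => ∃ m, DescentWord s w m) ⟨1, .one⟩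
    (fun w i j hij hw ⟨m, hm⟩ => ⟨_, .step w i j hij hw m hm⟩) w

/-- A diamond argument. Two choices of first descent are joined by a common smaller permutation:
commuting descents are removed in either order, and adjacent ones are completed to the two reduced
words of the longest element of S_3. Only the commutation and braid relations enter; the quadratic
relation does not. -/
theorem DescentWord.unique {s : Fin n → Fin n → M}
    (comm : ∀ i j k l : Fin n, (j : ℕ) = i + 1 → (l : ℕ) = k + 1 → (j : ℕ) < k →
      s i j * s k l = s k l * s i j)
    (braid : ∀ i j k : Fin n, (j : ℕ) = i + 1 → (k : ℕ) = j + 1 →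
      s i j * s j k * s i j = s j k * s i j * s j k) (w : Equiv.Perm (Fin n)) :
    ∀ m m', DescentWord s w m → DescentWord s w m' → m = m' := by
  induction hN : ∑ a : Fin n, (n - (a : ℕ)) * (w a : ℕ) using Nat.strong_induction_on generalizing w with
  | _ N ih =>
    have IH : ∀ i j : Fin n, (j : ℕ) = i + 1 → w j < w i → ∀ m m',
        DescentWord s (w * Equiv.swap i j) m → DescentWord s (w * Equiv.swap i j) m' → m = m' :=
      fun i j hij hd => ih _ (hN ▸ rearrangement_swap_lt w hij hd) _ rfl
    -- Disjoint descents: both are removed to reach `m₀`, and each of the two words factors through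
    -- it.
    have far : ∀ i j k l : Fin n, (j : ℕ) = i + 1 → (l : ℕ) = k + 1 → (j : ℕ) < k →
        w j < w i → w l < w k → ∀ m m', DescentWord s (w * Equiv.swap i j) m →
        DescentWord s (w * Equiv.swap k l) m' → m * s i j = m' * s k l := by
      intro i j k l hij hkl hjk hd hd' m m' hm hm'
      have h1 : k ≠ i := by rintro rfl; omega
      have h2 : k ≠ j := by rintro rfl; omega
      have h3 : l ≠ i := by rintro rfl; omega
      have h4 : l ≠ j := by rintro rfl; omega
      have hcomm : Equiv.swap k l * Equiv.swap i j = Equiv.swap i j * Equiv.swap k l := by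
        refine (Equiv.Perm.Disjoint.commute ?_).eq
        intro x
        by_cases hx : x = k ∨ x = l
        · right
          rcases hx with rfl | rfl
          · exact Equiv.swap_apply_of_ne_of_ne h1 h2
          · exact Equiv.swap_apply_of_ne_of_ne h3 h4
        · left
          push Not at hx
          exact Equiv.swap_apply_of_ne_of_ne hx.1 hx.2
      obtain ⟨m₀, hm₀⟩ := DescentWord.exists s (w * Equiv.swap i j * Equiv.swap k l)
      have e1 : m = m₀ * s k l := IH i j hij hd _ _ hm
        (.step _ k l hkl (by
          simpa [Equiv.swap_apply_of_ne_of_ne h1 h2, Equiv.swap_apply_of_ne_of_ne h3 h4] using hd')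
          _ hm₀)
      have e2 : m' = m₀ * s i j := IH k l hkl hd' _ _ hm'
        (.step _ i j hij (by
          simpa [Equiv.swap_apply_of_ne_of_ne h1.symm h3.symm,
            Equiv.swap_apply_of_ne_of_ne h2.symm h4.symm] using hd) _ (by
          rwa [mul_assoc, hcomm, ← mul_assoc]))
      rw [e1, e2, mul_assoc, mul_assoc, comm i j k l hij hkl hjk]
    -- Overlapping descents: w is decreasing on i, j, k, so three descents can be removed along
    -- either side of the braid relation.
    have near : ∀ i j k : Fin n, (j : ℕ) = i + 1 → (k : ℕ) = j + 1 →
        w j < w i → w k < w j → ∀ m m', DescentWord s (w * Equiv.swap i j) m →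
        DescentWord s (w * Equiv.swap j k) m' → m * s i j = m' * s j k := by
      intro i j k hij hjk hd hd' m m' hm hm'
      have h1 : i ≠ j := by rintro rfl; omega
      have h2 : j ≠ k := by rintro rfl; omega
      have h3 : i ≠ k := by rintro rfl; omega
      have hbr : Equiv.swap j k * Equiv.swap i j * Equiv.swap j k
          = Equiv.swap i j * Equiv.swap j k * Equiv.swap i j := by
        rw [Equiv.swap_mul_swap_mul_swap h1 h3, Equiv.swap_comm i j, Equiv.swap_comm j k,
          Equiv.swap_mul_swap_mul_swap h2.symm h3.symm, Equiv.swap_comm]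
      obtain ⟨m₀, hm₀⟩ := DescentWord.exists s
        (w * Equiv.swap i j * Equiv.swap j k * Equiv.swap i j)
      have a1 : DescentWord s (w * Equiv.swap i j * Equiv.swap j k) (m₀ * s i j) :=
        .step _ i j hij (by
          simpa [Equiv.swap_apply_of_ne_of_ne h1 h3, Equiv.swap_apply_of_ne_of_ne h3.symm h2.symm]
            using hd') _ hm₀
      have a2 : DescentWord s (w * Equiv.swap j k * Equiv.swap i j) (m₀ * s j k) :=
        .step _ j k hjk (by
          simpa [Equiv.swap_apply_of_ne_of_ne h1 h3, Equiv.swap_apply_of_ne_of_ne h3.symm h2.symm]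
            using hd) _ (by
          rw [mul_assoc, mul_assoc, ← mul_assoc (Equiv.swap j k), hbr]
          simpa [mul_assoc] using hm₀)
      have e1 : m = m₀ * s i j * s j k := IH i j hij hd _ _ hm
        (.step _ j k hjk (by
          simpa [Equiv.swap_apply_of_ne_of_ne h3.symm h2.symm] using hd'.trans hd) _ a1)
      have e2 : m' = m₀ * s j k * s i j := IH j k hjk hd' _ _ hm'
        (.step _ i j hij (by
          simpa [Equiv.swap_apply_of_ne_of_ne h1 h3] using hd'.trans hd) _ a2)
      rw [e1, e2]
      simpa [mul_assoc] using congrArg (m₀ * ·) (braid i j k hij hjk)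
    intro m m' hm hm'
    cases hm with
    | one =>
      cases hm' with
      | one => rfl
      | step _ k l hkl hd' _ _ => simp only [Equiv.Perm.one_apply, Fin.lt_def] at hd'; omega
    | step _ i j hij hd m₁ h₁ =>
      cases hm' with
      | one => simp only [Equiv.Perm.one_apply, Fin.lt_def] at hd; omega
      | step _ k l hkl hd' m₂ h₂ =>
        rcases lt_trichotomy (i : ℕ) k with hik | hik | hik
        · rcases (show (j : ℕ) < k ∨ (j : ℕ) = k by omega) with h | h
          · exact far i j k l hij hkl h hd hd' _ _ h₁ h₂
          · obtain rfl : j = k := Fin.ext h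
            exact near i j l hij hkl hd hd' _ _ h₁ h₂
        · obtain rfl : i = k := Fin.ext hik
          obtain rfl : j = l := Fin.ext (by omega)
          rw [IH i j hij hd _ _ h₁ h₂]
        · rcases (show (l : ℕ) < i ∨ (l : ℕ) = i by omega) with h | h
          · exact (far k l i j hkl hij h hd' hd _ _ h₂ h₁).symm
          · obtain rfl : l = i := Fin.ext h
            exact (near k l j hkl hij hd' hd _ _ h₂ h₁).symm

/-- The Coxeter presentation of the symmetric group. -/
theorem exists_monoidHom_of_coxeter (s : Fin n → Fin n → M)
    (sq : ∀ i j : Fin n, (j : ℕ) = i + 1 → s i j * s i j = 1)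
    (comm : ∀ i j k l : Fin n, (j : ℕ) = i + 1 → (l : ℕ) = k + 1 → (j : ℕ) < k →
      s i j * s k l = s k l * s i j)
    (braid : ∀ i j k : Fin n, (j : ℕ) = i + 1 → (k : ℕ) = j + 1 →
      s i j * s j k * s i j = s j k * s i j * s j k) :
    ∃ S : Equiv.Perm (Fin n) →* M, ∀ i j : Fin n, (j : ℕ) = i + 1 →
      S (Equiv.swap i j) = s i j := by
  choose f hf using DescentWord.exists s
  have uniq := DescentWord.unique comm braid
  have one : f 1 = 1 := uniq 1 _ _ (hf 1) .one
  have down : ∀ (w : Equiv.Perm (Fin n)) (i j : Fin n), (j : ℕ) = i + 1 → w j < w i →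
      f w = f (w * Equiv.swap i j) * s i j :=
    fun w i j hij hd => uniq w _ _ (hf w) (.step w i j hij hd _ (hf _))
  -- An ascent of w is a descent of w (i j), so `down` applies to the product; at a descent of w the
  -- quadratic relation is needed.
  have step : ∀ (w : Equiv.Perm (Fin n)) (i j : Fin n), (j : ℕ) = i + 1 →
      f (w * Equiv.swap i j) = f w * s i j := by
    intro w i j hij
    rcases lt_trichotomy (w i) (w j) with h | h | h
    · rw [down (w * Equiv.swap i j) i j hij (by simpa using h), mul_assoc, Equiv.swap_mul_self,
        mul_one]
    · have := w.injective h; subst this; omega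
    · rw [down w i j hij h, mul_assoc, sq i j hij, mul_one]
  have mul : ∀ v w, f (v * w) = f v * f w := by
    intro v w
    induction w using perm_descent_induction with
    | one => rw [one, mul_one, mul_one]
    | step w i j hij hd ih =>
      have h := step (v * (w * Equiv.swap i j)) i j hij
      rw [ih, mul_assoc, mul_assoc, mul_assoc, Equiv.swap_mul_self, mul_one] at h
      rw [h, down w i j hij hd]
  refine ⟨⟨⟨f, one⟩, mul⟩, fun i j hij => ?_⟩
  show f (Equiv.swap i j) = _
  rw [← one_mul (Equiv.swap i j), step 1 i j hij, one, one_mul]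

/-- A property of group elements that holds for the adjacent transpositions, and is preserved by
products, holds for all permutations. -/
theorem perm_adjacent_induction {p : Equiv.Perm (Fin n) → Prop} (one : p 1)
    (swap : ∀ i j : Fin n, (j : ℕ) = i + 1 → p (Equiv.swap i j))
    (mul : ∀ v w, p v → p w → p (v * w)) (w : Equiv.Perm (Fin n)) : p w := by
  induction w using perm_descent_induction with
  | one => exact one
  | step w i j hij _ ih =>
    have := mul _ _ ih (swap i j hij)
    rwa [mul_assoc, Equiv.swap_mul_self, mul_one] at this

/-- A permutation that fixes `0` is a product of adjacent transpositions that fix `0`. -/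
theorem perm_stabilizer_induction {o : Fin n} (ho : (o : ℕ) = 0) {p : Equiv.Perm (Fin n) → Prop}
    (one : p 1) (swap : ∀ i j : Fin n, 0 < (i : ℕ) → (j : ℕ) = i + 1 → p (Equiv.swap i j))
    (mul : ∀ v w, v o = o → w o = o → p v → p w → p (v * w)) (w : Equiv.Perm (Fin n))
    (hw : w o = o) : p w := by
  induction w using perm_descent_induction with
  | one => exact one
  | step w i j hij hd ih =>
    -- A descent at the first position is impossible, since the value there is already 0.
    have hi : 0 < (i : ℕ) := by
      by_contra! h
      obtain rfl : i = o := Fin.ext (by omega)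
      rw [hw, Fin.lt_def] at hd; omega
    have hs : Equiv.swap i j o = o :=
      Equiv.swap_apply_of_ne_of_ne (by rintro rfl; omega) (by rintro rfl; omega)
    have := mul _ _ (by simp [hs, hw]) hs (ih (by simp [hs, hw])) (swap i j hi hij)
    rwa [mul_assoc, Equiv.swap_mul_self, mul_one] at this

end Permutations

end

section

/-! ### Conjugates of an element that commutes with a point stabiliser -/

section EquivariantFamily

variable {n : ℕ} {R : Type*} [Monoid R] (S : Equiv.Perm (Fin n) →* R)

/-- The translates of `z` by the transpositions `(o, i)`. -/
def family (o : Fin n) (z : R) (i : Fin n) : R := S (Equiv.swap o i) * z * S (Equiv.swap o i)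

variable {S}

theorem commute_of_fixes {o : Fin n} (ho : (o : ℕ) = 0) {z : R}
    (hz : ∀ i j : Fin n, 0 < (i : ℕ) → (j : ℕ) = i + 1 →
      S (Equiv.swap i j) * z = z * S (Equiv.swap i j))
    {w : Equiv.Perm (Fin n)} (hw : w o = o) : S w * z = z * S w := by
  refine perm_stabilizer_induction ho (p := fun w => S w * z = z * S w) (by simp) hz ?_ w hw
  intro v w _ _ hv hw
  rw [map_mul, mul_assoc, hw, ← mul_assoc, hv, mul_assoc]

theorem map_mul_map_inv (w : Equiv.Perm (Fin n)) : S w * S w⁻¹ = 1 := by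
  rw [← map_mul, mul_inv_cancel, map_one]

theorem map_inv_mul_map (w : Equiv.Perm (Fin n)) : S w⁻¹ * S w = 1 := by
  rw [← map_mul, inv_mul_cancel, map_one]

theorem map_swap_mul_self (i j : Fin n) : S (Equiv.swap i j) * S (Equiv.swap i j) = 1 := by
  rw [← map_mul, Equiv.swap_mul_self, map_one]

theorem family_self (o : Fin n) (z : R) : family S o z o = z := by
  rw [family, Equiv.swap_self, ← Equiv.Perm.one_def, map_one, one_mul, mul_one]

/-- The permutation (o, w i) w (o, i) fixes o, hence commutes with z; cancelling the outer
transpositions gives the equivariance. -/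
theorem map_mul_family {o : Fin n} {z : R}
    (hz : ∀ w : Equiv.Perm (Fin n), w o = o → S w * z = z * S w)
    (w : Equiv.Perm (Fin n)) (i : Fin n) :
    S w * family S o z i = family S o z (w i) * S w := by
  have h := hz (Equiv.swap o (w i) * w * Equiv.swap o i) (by simp)
  rw [map_mul, map_mul] at h
  have h' := congrArg (fun t => S (Equiv.swap o (w i)) * t * S (Equiv.swap o i)) h
  simp only [mul_assoc] at h'
  rw [map_swap_mul_self, mul_one, ← mul_assoc (S (Equiv.swap o (w i))) (S (Equiv.swap o (w i))),
    map_swap_mul_self, one_mul] at h'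
  simp only [family, mul_assoc, h']

theorem family_eq {o : Fin n} {z : R}
    (hz : ∀ w : Equiv.Perm (Fin n), w o = o → S w * z = z * S w)
    {w : Equiv.Perm (Fin n)} {i : Fin n} (hw : w o = i) :
    family S o z i = S w * z * S w⁻¹ := by
  have h := map_mul_family hz w o
  rw [family_self, hw] at h
  rw [h, mul_assoc, map_mul_map_inv, mul_one]

theorem perm_mul_swap (c : Equiv.Perm (Fin n)) (i j : Fin n) :
    c * Equiv.swap i j = Equiv.swap (c i) (c j) * c := by
  rw [Equiv.swap_apply_apply]; simp

theorem exists_perm_pair {o o' i j : Fin n} (h : o ≠ o') (hij : i ≠ j) :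
    ∃ w : Equiv.Perm (Fin n), w o = i ∧ w o' = j := by
  refine ⟨Equiv.swap (Equiv.swap o i o') j * Equiv.swap o i, ?_, by simp⟩
  rw [Equiv.Perm.mul_apply, Equiv.swap_apply_left, Equiv.swap_apply_of_ne_of_ne _ hij]
  intro h'
  apply h
  apply (Equiv.swap o i).injective
  rw [← h', Equiv.swap_apply_left]

/-- Any two distinct indices are the images of o and o' under one permutation, so a single
commutation suffices. -/
theorem family_commute {o o' : Fin n} (ho' : o ≠ o') {z : R}
    (hz : ∀ w : Equiv.Perm (Fin n), w o = o → S w * z = z * S w)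
    (h : z * family S o z o' = family S o z o' * z) (i j : Fin n) :
    family S o z i * family S o z j = family S o z j * family S o z i := by
  by_cases hij : i = j
  · rw [hij]
  obtain ⟨w, hi, hj⟩ := exists_perm_pair ho' hij
  have e := map_mul_family hz w
  have h1 : S w * (family S o z o * family S o z o') =
      family S o z i * family S o z j * S w := by
    rw [← mul_assoc, e, mul_assoc, e, ← mul_assoc, hi, hj]
  have h2 : S w * (family S o z o' * family S o z o) =
      family S o z j * family S o z i * S w := by
    rw [← mul_assoc, e, mul_assoc, e, ← mul_assoc, hi, hj]
  rw [family_self] at h1 h2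
  rw [h, h2] at h1
  have := congrArg (· * S w⁻¹) h1
  simpa [mul_assoc, map_mul_map_inv] using this.symm

/-- The relations between `S_n` and two elements `σ` and `τ`, in terms of which
`x_1 = σ c⁻¹` and `y_1 = c τ` for the cycle `c = (1, …, n)`. -/
structure CyclicRelations (S : Equiv.Perm (Fin n) →* R) (c : Equiv.Perm (Fin n)) (σ τ : R) :
    Prop where
  cycle : ∀ i j : Fin n, (j : ℕ) = i + 1 → c i = j
  cycle_last : ∀ o l : Fin n, (o : ℕ) = 0 → (l : ℕ) + 1 = n → c l = o
  sigma : ∀ i j k : Fin n, (j : ℕ) = i + 1 → (k : ℕ) = j + 1 →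
    S (Equiv.swap j k) * σ = σ * S (Equiv.swap i j)
  tau : ∀ i j k : Fin n, (j : ℕ) = i + 1 → (k : ℕ) = j + 1 →
    τ * S (Equiv.swap j k) = S (Equiv.swap i j) * τ
  sigma_sq : ∀ o o' k l : Fin n, (o : ℕ) = 0 → (o' : ℕ) = 1 → (l : ℕ) = k + 1 → (l : ℕ) + 1 = n →
    S (Equiv.swap o o') * (σ * σ) = σ * σ * S (Equiv.swap k l)
  tau_sq : ∀ o o' k l : Fin n, (o : ℕ) = 0 → (o' : ℕ) = 1 → (l : ℕ) = k + 1 → (l : ℕ) + 1 = n →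
    τ * τ * S (Equiv.swap o o') = S (Equiv.swap k l) * (τ * τ)

namespace CyclicRelations

variable {c : Equiv.Perm (Fin n)} {σ τ : R} (h : CyclicRelations S c σ τ)
include h

/-- Both σ and c move each adjacent transposition one place to the right, so σ c⁻¹ commutes with the
adjacent transpositions away from the first index, and these generate its stabiliser. -/
theorem commute_x {o : Fin n} (ho : (o : ℕ) = 0) (w : Equiv.Perm (Fin n)) (hw : w o = o) :
    S w * (σ * S c⁻¹) = σ * S c⁻¹ * S w := by
  refine commute_of_fixes ho (fun j k hj hjk => ?_) hw
  obtain ⟨i, hi⟩ : ∃ i : Fin n, (j : ℕ) = i + 1 := ⟨⟨j - 1, by omega⟩, by simp; omega⟩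
  have e : Equiv.swap i j * c⁻¹ = c⁻¹ * Equiv.swap j k := by
    have := perm_mul_swap c i j
    rw [h.cycle i j hi, h.cycle j k hjk] at this
    rw [mul_inv_eq_iff_eq_mul, mul_assoc, ← this]; simp
  rw [← mul_assoc, h.sigma i j k hi hjk, mul_assoc, ← map_mul, e, map_mul, mul_assoc]

theorem commute_y {o : Fin n} (ho : (o : ℕ) = 0) (w : Equiv.Perm (Fin n)) (hw : w o = o) :
    S w * (S c * τ) = S c * τ * S w := by
  refine commute_of_fixes ho (fun j k hj hjk => ?_) hw
  obtain ⟨i, hi⟩ : ∃ i : Fin n, (j : ℕ) = i + 1 := ⟨⟨j - 1, by omega⟩, by simp; omega⟩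
  have e := perm_mul_swap c i j
  rw [h.cycle i j hi, h.cycle j k hjk] at e
  rw [mul_assoc, h.tau i j k hi hjk, ← mul_assoc, ← mul_assoc, ← map_mul, ← map_mul, e]

/-- The product of the first two conjugates is σ² c⁻². Conjugating by (o, o') interchanges the two
factors, while σ² turns (o, o') into the last transposition and c⁻² turns it back, so the product is
unchanged. -/
theorem x_commute {o : Fin n} (ho : (o : ℕ) = 0) (i j : Fin n) :
    family S o (σ * S c⁻¹) i * family S o (σ * S c⁻¹) j
      = family S o (σ * S c⁻¹) j * family S o (σ * S c⁻¹) i := by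
  by_cases hij : i = j
  · rw [hij]
  have hn : 2 ≤ n := by
    by_contra! hn
    exact hij (Fin.ext (by omega))
  set o' : Fin n := ⟨1, by omega⟩ with ho'
  set k : Fin n := ⟨n - 2, by omega⟩ with hk
  set l : Fin n := ⟨n - 1, by omega⟩ with hl
  have hlk : (l : ℕ) = k + 1 := by simp [hk, hl]; omega
  have hln : (l : ℕ) + 1 = n := by simp [hl]; omega
  have hoo : (o' : ℕ) = o + 1 := by simp [ho', ho]
  have hx := fun w hw => commute_x h ho w hw
  refine family_commute (o' := o') (fun e => by rw [e] at ho; simp [ho'] at ho) hx ?_ i j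
  set z := σ * S c⁻¹
  have e1 : z * family S o z o' = σ * σ * S (c⁻¹ * c⁻¹) := by
    rw [family_eq hx (h.cycle o o' hoo), ← mul_assoc, ← mul_assoc]
    simp only [z, mul_assoc, ← map_mul]
    rw [inv_mul_cancel, map_one, one_mul]
  have e2 : c⁻¹ * c⁻¹ * Equiv.swap o o' = Equiv.swap k l * (c⁻¹ * c⁻¹) := by
    have a1 := perm_mul_swap c k l
    have a2 := perm_mul_swap c l o
    rw [h.cycle k l hlk, h.cycle_last o l ho hln] at a1
    rw [h.cycle_last o l ho hln, h.cycle o o' hoo] at a2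
    rw [← mul_inv_rev, inv_mul_eq_iff_eq_mul, ← mul_assoc, eq_mul_inv_iff_mul_eq, ← mul_assoc,
      ← a2, mul_assoc, ← a1, mul_assoc]
  have e3 : S (Equiv.swap o o') * (z * family S o z o') * S (Equiv.swap o o')
      = family S o z o' * z := by
    rw [family]
    simp only [mul_assoc, map_swap_mul_self, mul_one]
  rw [← e3, e1, ← mul_assoc, h.sigma_sq o o' k l ho rfl hlk hln, mul_assoc _ _ (S (Equiv.swap o o')),
    ← map_mul, e2, mul_assoc (σ * σ), ← map_mul, ← mul_assoc (Equiv.swap k l),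
    Equiv.swap_mul_self, one_mul]

theorem y_commute {o : Fin n} (ho : (o : ℕ) = 0) (i j : Fin n) :
    family S o (S c * τ) i * family S o (S c * τ) j
      = family S o (S c * τ) j * family S o (S c * τ) i := by
  by_cases hij : i = j
  · rw [hij]
  have hn : 2 ≤ n := by
    by_contra! hn
    exact hij (Fin.ext (by omega))
  set o' : Fin n := ⟨1, by omega⟩ with ho'
  set k : Fin n := ⟨n - 2, by omega⟩ with hk
  set l : Fin n := ⟨n - 1, by omega⟩ with hl
  have hlk : (l : ℕ) = k + 1 := by simp [hk, hl]; omega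
  have hln : (l : ℕ) + 1 = n := by simp [hl]; omega
  have hoo : (o' : ℕ) = o + 1 := by simp [ho', ho]
  have hy := fun w hw => commute_y h ho w hw
  refine family_commute (o' := o') (fun e => by rw [e] at ho; simp [ho'] at ho) hy ?_ i j
  set z := S c * τ
  have e1 : family S o z o' * z = S (c * c) * (τ * τ) := by
    rw [family_eq hy (h.cycle o o' hoo)]
    simp only [z, mul_assoc]
    rw [← mul_assoc (S c⁻¹), map_inv_mul_map, one_mul, map_mul, mul_assoc]
  have e2 : Equiv.swap o o' * (c * c) = c * c * Equiv.swap k l := by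
    have a1 := perm_mul_swap c k l
    have a2 := perm_mul_swap c l o
    rw [h.cycle k l hlk, h.cycle_last o l ho hln] at a1
    rw [h.cycle_last o l ho hln, h.cycle o o' hoo] at a2
    rw [mul_assoc, a1, ← mul_assoc, ← mul_assoc, a2]
  have e3 : S (Equiv.swap o o') * (family S o z o' * z) * S (Equiv.swap o o')
      = z * family S o z o' := by
    rw [family]
    simp only [← mul_assoc, map_swap_mul_self, one_mul]
  rw [← e3, e1, ← mul_assoc, ← map_mul, e2, mul_assoc, h.tau_sq o o' k l ho rfl hlk hln,
    ← mul_assoc, ← map_mul, mul_assoc, Equiv.swap_mul_self, mul_one]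

/-- Here y_l = τ c, because c⁻¹ carries the first index to the last. The permutation (o, l) c⁻¹
fixes o, so it commutes with y_o = c τ; this removes the cycles and leaves one transposition on the
right. With `y_last_mul_x`, the commutator [x_o, y_l] becomes a difference of expressions in σ, τ
and adjacent transpositions, times (o, l). -/
theorem x_mul_y_last {o k l : Fin n} (ho : (o : ℕ) = 0)
    (hlk : (l : ℕ) = k + 1) (hln : (l : ℕ) + 1 = n) :
    σ * S c⁻¹ * family S o (S c * τ) l
      = σ * S (Equiv.swap k l) * τ * S (Equiv.swap o l) := by
  have hcl := h.cycle_last o l ho hln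
  have hckl := h.cycle k l hlk
  have hyl : family S o (S c * τ) l = τ * S c := by
    rw [family_eq (w := c⁻¹) (fun w hw => commute_y h ho w hw)
      (by rw [Equiv.Perm.inv_eq_iff_eq]; exact hcl.symm)]
    rw [← mul_assoc, map_inv_mul_map, one_mul, inv_inv]
  have a := commute_y h ho (Equiv.swap o l * c⁻¹) (by
    rw [Equiv.Perm.mul_apply, show c⁻¹ o = l by
      rw [Equiv.Perm.inv_eq_iff_eq]; exact hcl.symm, Equiv.swap_apply_right])
  have hc1 := perm_mul_swap c k l
  rw [hckl, hcl] at hc1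
  have b : S c⁻¹ * τ = S (Equiv.swap k l) * τ * S (Equiv.swap o l * c⁻¹) := by
    have a' := congrArg (fun t => S (Equiv.swap k l) * S c⁻¹ * t) a
    simp only [← mul_assoc, ← map_mul] at a'
    rw [show Equiv.swap k l * c⁻¹ * Equiv.swap o l * c⁻¹ * c = c⁻¹ by
      rw [inv_mul_cancel_right, mul_assoc, Equiv.swap_comm o l, eq_comm, ← mul_right_inj c,
        ← mul_assoc, hc1]; simp,
      show Equiv.swap k l * c⁻¹ * c = Equiv.swap k l by simp] at a'
    exact a'
  rw [hyl, mul_assoc, ← mul_assoc (S c⁻¹), b, mul_assoc, ← map_mul]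
  simp [mul_assoc]

/-- As for `x_mul_y_last`, now with (o, o') c, which fixes o and so commutes with x_o = σ c⁻¹. -/
theorem y_last_mul_x {o l o' : Fin n} (ho : (o : ℕ) = 0) (ho' : (o' : ℕ) = 1)
    (hln : (l : ℕ) + 1 = n) :
    family S o (S c * τ) l * (σ * S c⁻¹)
      = τ * S (Equiv.swap o o') * σ * S (Equiv.swap o l) := by
  have hcl := h.cycle_last o l ho hln
  have hco := h.cycle o o' (by omega)
  have hyl : family S o (S c * τ) l = τ * S c := by
    rw [family_eq (w := c⁻¹) (fun w hw => commute_y h ho w hw)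
      (by rw [Equiv.Perm.inv_eq_iff_eq]; exact hcl.symm)]
    rw [← mul_assoc, map_inv_mul_map, one_mul, inv_inv]
  have a := commute_x h ho (Equiv.swap o o' * c) (by
    rw [Equiv.Perm.mul_apply, hco, Equiv.swap_apply_right])
  have hc1 := perm_mul_swap c o l
  rw [hco, hcl, Equiv.swap_comm o' o] at hc1
  have b : S (Equiv.swap o o') * (S c * (σ * S c⁻¹)) = σ * S (Equiv.swap o l) := by
    rw [← mul_assoc, ← map_mul, a, mul_assoc, ← map_mul, ← hc1]; simp
  rw [hyl, mul_assoc, mul_assoc, mul_assoc, ← b, ← mul_assoc (S (Equiv.swap o o')) (S _),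
    map_swap_mul_self, one_mul]

end CyclicRelations

end EquivariantFamily

end

section

variable (D : Datum)

/-! ### The polynomial representation over `ℂ(U_1, …, U_n)` -/

theorem toC_one : toC D 1 = 1 := rfl

theorem toC_mul (z z' : Mu D) : toC D (z * z') = toC D z * toC D z' := by simp [toC]

theorem toC_ne_zero (z : Mu D) : toC D z ≠ 0 := by simp [toC]

theorem toC_inv (z : Mu D) : toC D z⁻¹ = (toC D z)⁻¹ := by simp [toC]

theorem toC_pow (z : Mu D) (m : ℕ) : toC D (z ^ m) = toC D z ^ m := by simp [toC]

theorem toC_zpow (z : Mu D) (m : ℤ) : toC D (z ^ m) = toC D z ^ m := by simp [toC]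

theorem ell_ne_zero : (D.ℓ : ℂ) ≠ 0 := Nat.cast_ne_zero.2 D.ell_ne.out

theorem toC_eq_one {z : Mu D} (h : toC D z = 1) : z = 1 := by
  apply Subtype.ext
  apply Units.ext
  exact h

/-- The character `a ↦ ∏ a_i^{-v_i}` of `A`. -/
def latticeChar (v : Fin D.n → ℤ) : diagonalGroup D →* ℂ where
  toFun a := ∏ i, toC D (a.1 i ^ (-v i))
  map_one' := by simp [toC]
  map_mul' a b := by
    rw [← Finset.prod_mul_distrib]
    exact Finset.prod_congr rfl fun i _ => by
      rw [← toC_mul, ← mul_zpow]; rfl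

theorem latticeChar_apply (v : Fin D.n → ℤ) (a : diagonalGroup D) :
    latticeChar D v a = ∏ i, toC D (a.1 i ^ (-v i)) := rfl

theorem latticeChar_zero (a : diagonalGroup D) : latticeChar D 0 a = 1 := by
  simp [latticeChar_apply, toC]

theorem latticeChar_add (v v' : Fin D.n → ℤ) (a : diagonalGroup D) :
    latticeChar D (v + v') a = latticeChar D v a * latticeChar D v' a := by
  rw [latticeChar_apply, latticeChar_apply, latticeChar_apply, ← Finset.prod_mul_distrib]
  exact Finset.prod_congr rfl fun i _ => by
    rw [← toC_mul, ← zpow_add, Pi.add_apply, neg_add]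

theorem latticeChar_single (i : Fin D.n) (m : ℤ) (a : diagonalGroup D) :
    latticeChar D (Pi.single i m) a = toC D (a.1 i ^ (-m)) := by
  rw [latticeChar_apply, Finset.prod_eq_single i]
  · simp
  · intro j _ hj; simp [Pi.single_eq_of_ne hj, toC]
  · simp

theorem latticeChar_permA (v : Fin D.n → ℤ) (w : Equiv.Perm (Fin D.n)) (a : diagonalGroup D) :
    latticeChar D (fun i => v (w⁻¹ i)) (permA D w a) = latticeChar D v a := by
  rw [latticeChar_apply, latticeChar_apply]
  exact Equiv.prod_comp w⁻¹ (fun i => toC D (a.1 i ^ (-v i)))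

theorem permA_mul (v w : Equiv.Perm (Fin D.n)) (a : diagonalGroup D) :
    permA D (v * w) a = permA D v (permA D w a) := by
  apply Subtype.ext
  funext i
  show a.1 ((v * w)⁻¹ i) = a.1 (w⁻¹ (v⁻¹ i))
  rw [mul_inv_rev]; rfl

theorem permA_one (a : diagonalGroup D) : permA D 1 a = a := rfl

theorem permA_tRatio (w : Equiv.Perm (Fin D.n)) (i j : Fin D.n) (z : Mu D) :
    permA D w (tRatio D i j z) = tRatio D (w i) (w j) z := by
  apply Subtype.ext
  funext m
  simp only [permA, tRatio, MonoidHom.coe_mk, OneHom.coe_mk, Pi.mul_apply, Pi.mulSingle_apply,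
    Equiv.Perm.inv_eq_iff_eq]

theorem permA_tPow (w : Equiv.Perm (Fin D.n)) (i : Fin D.n) (q : ℕ) :
    permA D w (tPow D i q) = tPow D (w i) q := by
  apply Subtype.ext
  funext m
  simp only [permA, tPow, MonoidHom.coe_mk, OneHom.coe_mk, Pi.mulSingle_apply,
    Equiv.Perm.inv_eq_iff_eq]

/-- The automorphism `U_j ↦ U_{w j} + hbar v_{w j}` of `ℂ[U_1, …, U_n]`. -/
def latticeAut (v : Fin D.n → ℤ) (w : Equiv.Perm (Fin D.n)) : PolyU D ≃ₐ[ℂ] PolyU D :=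
  translate D (fun j => D.hbar * v j) * renameEquiv ℂ w

theorem latticeAut_X (v : Fin D.n → ℤ) (w : Equiv.Perm (Fin D.n)) (j : Fin D.n) :
    latticeAut D v w (X j) = X (w j) + C (D.hbar * v (w j)) := by
  simp [latticeAut, translate, AlgEquiv.mul_apply]

theorem latticeAut_mul (v v' : Fin D.n → ℤ) (w w' : Equiv.Perm (Fin D.n)) :
    latticeAut D v w * latticeAut D v' w'
      = latticeAut D (v + fun i => v' (w⁻¹ i)) (w * w') := by
  apply AlgEquiv.coe_toAlgHom_injective
  ext1 j
  show (latticeAut D v w) (latticeAut D v' w' (X j)) = latticeAut D _ _ (X j)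
  rw [latticeAut_X, latticeAut_X, map_add, latticeAut_X, ← algebraMap_eq, AlgEquiv.commutes,
    add_assoc, Equiv.Perm.mul_apply, ← map_add]
  simp [mul_add]

theorem latticeAut_zero_one : latticeAut D 0 1 = 1 := by
  apply AlgEquiv.coe_toAlgHom_injective
  ext1 j
  show latticeAut D 0 1 (X j) = X j
  rw [latticeAut_X]; simp

/-- The field `ℂ(U_1, …, U_n)` as a module for automorphisms of `ℂ[U_1, …, U_n]`. -/
def fieldAut : (PolyU D ≃ₐ[ℂ] PolyU D) →* (FieldU D ≃+* FieldU D) :=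
  (IsFractionRing.ringEquivOfRingEquivHom (PolyU D) (FieldU D)).comp
    (MulSemiringAction.toRingEquiv (PolyU D ≃ₐ[ℂ] PolyU D) (PolyU D))

theorem fieldAut_algebraMap (φ : PolyU D ≃ₐ[ℂ] PolyU D) (f : PolyU D) :
    fieldAut D φ (algebraMap _ _ f) = algebraMap _ _ (φ f) :=
  IsFractionRing.ringEquivOfRingEquiv_algebraMap _ _

theorem fieldAut_mul_apply (φ ψ : PolyU D ≃ₐ[ℂ] PolyU D) (f : FieldU D) :
    fieldAut D (φ * ψ) f = fieldAut D φ (fieldAut D ψ f) := by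
  rw [map_mul]; rfl

theorem fieldAut_one_apply (f : FieldU D) : fieldAut D 1 f = f := by
  rw [map_one]; rfl

theorem fieldAut_smul (w : affineGroup D) (f : FieldU D) : w • f = fieldAut D w.1 f := rfl

end

/-! ### The group algebra of `A` over the function field, and the r-matrix -/

section

variable (D : Datum)

/-- The polynomial representation with coefficients extended to `ℂ(U_1, …, U_n)`. -/
def RatRep : Type := MonoidAlgebra (FieldU D) (diagonalGroup D)

instance : CommRing (RatRep D) :=
  inferInstanceAs (CommRing (MonoidAlgebra (FieldU D) (diagonalGroup D)))

instance : Algebra ℂ (RatRep D) :=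
  inferInstanceAs (Algebra ℂ (MonoidAlgebra (FieldU D) (diagonalGroup D)))

/-- The inclusion of coefficients. -/
def ofField : FieldU D →+* RatRep D :=
  (MonoidAlgebra.singleOneRingHom : FieldU D →+* MonoidAlgebra (FieldU D) (diagonalGroup D))

/-- The monomial `T^a`. -/
def ratT : diagonalGroup D →* RatRep D :=
  (MonoidAlgebra.of (FieldU D) (diagonalGroup D) :)

theorem single_eq_ofField_mul_ratT (a : diagonalGroup D) (q : FieldU D) :
    (show RatRep D from MonoidAlgebra.single a q) = ofField D q * ratT D a := by
  have h : (MonoidAlgebra.single a q : MonoidAlgebra (FieldU D) (diagonalGroup D))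
      = MonoidAlgebra.single 1 q * MonoidAlgebra.single a 1 := by
    simp [MonoidAlgebra.single_mul_single]
  exact h

theorem algebraMap_ratRep (c : ℂ) : algebraMap ℂ (RatRep D) c = ofField D (algebraMap ℂ _ c) := rfl

theorem ratRep_induction {p : RatRep D → Prop} (zero : p 0)
    (add : ∀ f g, p f → p g → p (f + g))
    (mul : ∀ q a, p (ofField D q * ratT D a)) (f : RatRep D) : p f := by
  refine MonoidAlgebra.induction_linear (R := FieldU D) (M := diagonalGroup D) (motive := p) f
    zero add fun a q => ?_
  have h := mul q a
  rwa [← single_eq_ofField_mul_ratT] at h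

/-- The automorphism `U_j ↦ U_{w j} + hbar v_{w j}`, `T_j ↦ ζ^{-v_{w j}} T_{w j}`. -/
def ratAut (v : Fin D.n → ℤ) (w : Equiv.Perm (Fin D.n)) : RatRep D →+* RatRep D :=
  (MonoidAlgebra.liftNCRingHom
    ((ofField D).comp (fieldAut D (latticeAut D v w)).toRingHom)
    ((((algebraMap ℂ (RatRep D)) : ℂ →* RatRep D).comp (latticeChar D v) * ratT D).comp
      (permA D w))
    (fun _ _ => Commute.all _ _) : MonoidAlgebra (FieldU D) (diagonalGroup D) →+* RatRep D)

variable {D}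

theorem ratAut_ofField (v : Fin D.n → ℤ) (w : Equiv.Perm (Fin D.n)) (q : FieldU D) :
    ratAut D v w (ofField D q) = ofField D (fieldAut D (latticeAut D v w) q) := by
  show ratAut D v w (MonoidAlgebra.single 1 q) = _
  rw [ratAut]
  erw [MonoidAlgebra.liftNC_single]
  rw [map_one, mul_one]
  rfl

theorem ratAut_ratT (v : Fin D.n → ℤ) (w : Equiv.Perm (Fin D.n)) (a : diagonalGroup D) :
    ratAut D v w (ratT D a)
      = algebraMap ℂ _ (latticeChar D v (permA D w a)) * ratT D (permA D w a) := by
  show ratAut D v w (MonoidAlgebra.single a 1) = _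
  rw [ratAut]
  erw [MonoidAlgebra.liftNC_single]
  have h1 : ((ofField D).comp (fieldAut D (latticeAut D v w)).toRingHom) 1 = 1 := map_one _
  exact (congrArg (· * _) h1).trans (one_mul _)

theorem fieldAut_algebraMap_complex (φ : PolyU D ≃ₐ[ℂ] PolyU D) (c : ℂ) :
    fieldAut D φ (algebraMap ℂ _ c) = algebraMap ℂ _ c := by
  rw [IsScalarTower.algebraMap_apply ℂ (PolyU D) (FieldU D), fieldAut_algebraMap,
    AlgEquiv.commutes]

theorem ratAut_algebraMap (v : Fin D.n → ℤ) (w : Equiv.Perm (Fin D.n)) (c : ℂ) :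
    ratAut D v w (algebraMap ℂ _ c) = algebraMap ℂ _ c := by
  rw [algebraMap_ratRep, ratAut_ofField, fieldAut_algebraMap_complex]

/-- Pairs compose as in ℤ^n ⋊ S_n. On the T^a this holds because `latticeChar` is additive in v and
compatible with permutations. -/
theorem ratAut_ratAut (v v' : Fin D.n → ℤ) (w w' : Equiv.Perm (Fin D.n)) (f : RatRep D) :
    ratAut D v w (ratAut D v' w' f) = ratAut D (v + fun i => v' (w⁻¹ i)) (w * w') f := by
  induction f using ratRep_induction with
  | zero => simp only [map_zero]
  | add f g hf hg => simp only [map_add, hf, hg]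
  | mul q a =>
    simp only [map_mul, ratAut_ofField, ratAut_ratT, ratAut_algebraMap]
    rw [← latticeAut_mul, permA_mul, latticeChar_add, latticeChar_permA, fieldAut_mul_apply,
      map_mul]
    ring

theorem ratAut_zero_one (f : RatRep D) : ratAut D 0 1 f = f := by
  induction f using ratRep_induction with
  | zero => simp only [map_zero]
  | add f g hf hg => simp only [map_add, hf, hg]
  | mul q a =>
    simp only [map_mul, ratAut_ofField, ratAut_ratT, permA_one, latticeChar_zero, map_one (algebraMap ℂ (RatRep D)),
      one_mul, latticeAut_zero_one, fieldAut_one_apply]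

variable (D)

/-- The operator `ratAut D v w`. -/
def latOp (v : Fin D.n → ℤ) (w : Equiv.Perm (Fin D.n)) : Module.End ℂ (RatRep D) where
  toFun := ratAut D v w
  map_add' := map_add _
  map_smul' c f := by
    rw [Algebra.smul_def, map_mul, ratAut_algebraMap, ← Algebra.smul_def]; rfl

/-- The operator of multiplication. -/
abbrev mulOp (b : RatRep D) : Module.End ℂ (RatRep D) := LinearMap.mulLeft ℂ b

/-- The variable `U_i`. -/
def ratU (i : Fin D.n) : RatRep D := ofField D (algebraMap (PolyU D) _ (X i))

/-- The element `π_{i,j}`. -/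
def ratPi (i j : Fin D.n) : RatRep D :=
  algebraMap ℂ _ (D.ℓ : ℂ)⁻¹ * ∑ z : Mu D, ratT D (tRatio D i j z)

/-- The element `P(u T_i)`. -/
def ratPoly (i : Fin D.n) (u : ℂ) : RatRep D :=
  ∑ q ∈ Finset.Ico 1 (D.ℓ / D.p),
    algebraMap ℂ _ (D.c (D.p * q) * u ^ (D.p * q)) * ratT D (tPow D i q)

/-- The difference `U_j - U_i` in the field. -/
def fieldDiff (i j : Fin D.n) : FieldU D := algebraMap (PolyU D) _ (X j - X i)

/-- The classical `r`-matrix `k ℓ π_{i,j} / (U_j - U_i)`. -/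
def rMat (i j : Fin D.n) : RatRep D :=
  ofField D (algebraMap ℂ _ (D.k * D.ℓ) * (fieldDiff D i j)⁻¹) * ratPi D i j

variable {D}

theorem latOp_apply (v : Fin D.n → ℤ) (w : Equiv.Perm (Fin D.n)) (f : RatRep D) :
    latOp D v w f = ratAut D v w f := rfl

theorem tRatio_mul_left (i j : Fin D.n) (z z' : Mu D) :
    tRatio D i j z * tRatio D i j z' = tRatio D i j (z * z') := by
  apply Subtype.ext
  simp only [tRatio, Subgroup.coe_mul, mul_inv, Pi.mulSingle_mul]
  rw [mul_mul_mul_comm]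

theorem tRatio_symm (i j : Fin D.n) (z : Mu D) : tRatio D i j z⁻¹ = tRatio D j i z := by
  apply Subtype.ext
  simp only [tRatio, inv_inv, mul_comm]

theorem tRatio_trans (i j m : Fin D.n) (z : Mu D) :
    tRatio D i j z * tRatio D j m z = tRatio D i m z := by
  apply Subtype.ext
  funext x
  simp only [tRatio, Subgroup.coe_mul, Pi.mulSingle_inv, Pi.mul_apply, Pi.inv_apply]
  simp [mul_assoc]

theorem tRatio_apply (i j m : Fin D.n) (z : Mu D) :
    (tRatio D i j z).1 m = (Pi.mulSingle i z : Fin D.n → Mu D) m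
      * (Pi.mulSingle j z⁻¹ : Fin D.n → Mu D) m := rfl

theorem tRatio_mul_tPow (i j : Fin D.n) (q : ℕ) :
    tRatio D i j (D.ζ ^ (D.p * q)) * tPow D j q = tPow D i q := by
  apply Subtype.ext
  funext x
  simp only [tRatio, tPow, Subgroup.coe_mul, Pi.mulSingle_inv, Pi.mul_apply, Pi.inv_apply]
  simp

/-- π_{ij} is the average over the cyclic group of the T_i^r T_j^{-r}, so it absorbs them: on its
image T_i and T_j agree. -/
theorem ratPi_mul_ratT (i j : Fin D.n) (z : Mu D) :
    ratPi D i j * ratT D (tRatio D i j z) = ratPi D i j := by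
  rw [ratPi, mul_assoc, Finset.sum_mul]
  congr 1
  simp only [← map_mul, tRatio_mul_left]
  exact Fintype.sum_equiv (Equiv.mulRight z) _ _ fun _ => rfl

theorem ratPi_symm (i j : Fin D.n) : ratPi D i j = ratPi D j i := by
  rw [ratPi, ratPi]
  congr 1
  exact Fintype.sum_equiv (Equiv.inv _) _ _ fun z => by
    rw [Equiv.inv_apply, tRatio_symm]

/-- Behind π_{ij} the index j may be replaced by i. This turns all products of two projectors in the
Yang–Baxter equation into the same one. -/
theorem ratPi_mul_ratPi (i j m : Fin D.n) :
    ratPi D i j * ratPi D j m = ratPi D i j * ratPi D i m := by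
  have h : ratPi D i j * ∑ z : Mu D, ratT D (tRatio D j m z)
      = ratPi D i j * ∑ z : Mu D, ratT D (tRatio D i m z) := by
    rw [Finset.mul_sum, Finset.mul_sum]
    refine Finset.sum_congr rfl fun z _ => ?_
    rw [← tRatio_trans i j m, map_mul, ← mul_assoc, ratPi_mul_ratT]
  rw [ratPi.eq_1 D j m, ratPi.eq_1 D i m, mul_left_comm, h, mul_left_comm]

theorem ratPi_mul_ratPoly (i j : Fin D.n) (u : ℂ) :
    ratPi D i j * ratPoly D i u = ratPi D i j * ratPoly D j u := by
  rw [ratPoly, ratPoly, Finset.mul_sum, Finset.mul_sum]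
  refine Finset.sum_congr rfl fun q _ => ?_
  rw [← tRatio_mul_tPow i j, map_mul (ratT D), mul_left_comm, ← mul_assoc (ratPi D i j),
    ratPi_mul_ratT, mul_left_comm]

theorem fieldDiff_ne {i j : Fin D.n} (h : i ≠ j) : fieldDiff D i j ≠ 0 := by
  rw [fieldDiff, Ne, FaithfulSMul.algebraMap_eq_zero_iff, sub_eq_zero]
  exact fun e => h (X_injective e).symm

theorem rMat_symm (i j : Fin D.n) : rMat D j i = -rMat D i j := by
  have h : (fieldDiff D j i)⁻¹ = -(fieldDiff D i j)⁻¹ := by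
    rw [fieldDiff, fieldDiff, neg_inv, ← map_neg, neg_sub]
  rw [rMat, rMat, h, ratPi_symm, mul_neg, map_neg, neg_mul]

/-- The classical Yang–Baxter equation. -/
theorem rMat_yangBaxter {i j m : Fin D.n} (hij : i ≠ j) (hjm : j ≠ m) (him : i ≠ m) :
    rMat D i j * rMat D j m = rMat D i m * (rMat D i j + rMat D j m) := by
  have h1 : ratPi D i m * ratPi D i j = ratPi D i j * ratPi D j m := by
    rw [mul_comm, ratPi_mul_ratPi]
  have h2 : ratPi D i m * ratPi D j m = ratPi D i j * ratPi D j m := by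
    rw [← h1, ratPi_symm j m, ratPi_mul_ratPi]
  -- Partial fractions: 1/(ab) = (1/a + 1/b)/(a + b), with a + b the difference of the outer
  -- variables.
  have h3 : (fieldDiff D i j)⁻¹ * (fieldDiff D j m)⁻¹
      = (fieldDiff D i m)⁻¹ * (fieldDiff D i j)⁻¹ + (fieldDiff D i m)⁻¹ * (fieldDiff D j m)⁻¹ := by
    have e : fieldDiff D i m = fieldDiff D i j + fieldDiff D j m := by
      simp only [fieldDiff, ← map_add]; congr 1; ring
    have := fieldDiff_ne hij
    have := fieldDiff_ne hjm
    have h0 := fieldDiff_ne him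
    rw [e] at h0 ⊢
    field_simp
    ring
  have h4 := congrArg (ofField D) h3
  simp only [map_add, map_mul] at h4
  simp only [rMat, map_mul]
  linear_combination (ofField D (algebraMap ℂ _ D.k) * ofField D (algebraMap ℂ _ (D.ℓ : ℂ))) ^ 2 *
    (ratPi D i j * ratPi D j m) * h4
    - (ofField D (algebraMap ℂ _ D.k) * ofField D (algebraMap ℂ _ (D.ℓ : ℂ))) ^ 2 *
      (ofField D (fieldDiff D i m)⁻¹ * ofField D (fieldDiff D i j)⁻¹) * h1
    - (ofField D (algebraMap ℂ _ D.k) * ofField D (algebraMap ℂ _ (D.ℓ : ℂ))) ^ 2 *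
      (ofField D (fieldDiff D i m)⁻¹ * ofField D (fieldDiff D j m)⁻¹) * h2

theorem ratAut_ratU (v : Fin D.n → ℤ) (w : Equiv.Perm (Fin D.n)) (i : Fin D.n) :
    ratAut D v w (ratU D i) = ratU D (w i) + algebraMap ℂ _ (D.hbar * v (w i)) := by
  rw [ratU, ratAut_ofField, fieldAut_algebraMap, latticeAut_X, map_add, map_add]
  rfl

theorem latticeChar_tPow (v : Fin D.n → ℤ) (i : Fin D.n) (q : ℕ) :
    latticeChar D v (tPow D i q) = (toC D D.ζ ^ (-v i)) ^ (D.p * q) := by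
  rw [latticeChar_apply, Finset.prod_eq_single i]
  · simp only [tPow, Pi.mulSingle_eq_same]
    rw [toC_zpow, toC_pow, ← zpow_natCast, ← zpow_natCast, ← zpow_mul, ← zpow_mul, mul_comm]
  · intro j _ hj; simp [tPow, Pi.mulSingle_eq_of_ne hj, toC]
  · simp

theorem ratAut_ratPoly (v : Fin D.n → ℤ) (w : Equiv.Perm (Fin D.n)) (i : Fin D.n) (u : ℂ) :
    ratAut D v w (ratPoly D i u) = ratPoly D (w i) (u * toC D D.ζ ^ (-v (w i))) := by
  rw [ratPoly, map_sum, ratPoly]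
  refine Finset.sum_congr rfl fun q _ => ?_
  rw [map_mul, ratAut_algebraMap, ratAut_ratT, permA_tPow, latticeChar_tPow, ← mul_assoc, ← map_mul,
    mul_pow, mul_assoc]

/-- The contributions of the entries z at i and z⁻¹ at j cancel. Hence a translation with equal
components at two indices leaves the corresponding π, and then r, untwisted. -/
theorem latticeChar_tRatio_of_eq {v : Fin D.n → ℤ} {i j : Fin D.n} (h : v i = v j) (z : Mu D) :
    latticeChar D v (tRatio D i j z) = 1 := by
  by_cases hij : i = j
  · subst hij
    have : tRatio D i i z = 1 := by
      apply Subtype.ext; funext m; simp [tRatio_apply, ← Pi.mul_apply, ← Pi.mulSingle_mul]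
    rw [this, map_one]
  have h1 : ∀ m, toC D ((tRatio D i j z).1 m ^ (-v m))
      = (Pi.mulSingle i (toC D (z ^ (-v i))) : Fin D.n → ℂ) m
        * (Pi.mulSingle j (toC D (z ^ (v i))) : Fin D.n → ℂ) m := by
    intro m
    rw [tRatio_apply]
    by_cases hm : m = i
    · subst hm; simp [hij]
    · by_cases hm' : m = j
      · subst hm'; simp [Pi.mulSingle_eq_of_ne hm, h]
      · simp [Pi.mulSingle_eq_of_ne hm, Pi.mulSingle_eq_of_ne hm', toC_one]
  rw [latticeChar_apply, Finset.prod_congr rfl fun m _ => h1 m, Finset.prod_mul_distrib,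
    Finset.prod_pi_mulSingle', Finset.prod_pi_mulSingle']
  simp only [Finset.mem_univ, if_true]
  rw [← toC_mul, ← zpow_add]; simp [toC_one]

theorem ratAut_ratPi {v : Fin D.n → ℤ} {w : Equiv.Perm (Fin D.n)} {i j : Fin D.n}
    (h : v (w i) = v (w j)) : ratAut D v w (ratPi D i j) = ratPi D (w i) (w j) := by
  rw [ratPi, map_mul, map_sum, ratAut_algebraMap, ratPi]
  congr 1
  refine Finset.sum_congr rfl fun z _ => ?_
  rw [ratAut_ratT, permA_tRatio, latticeChar_tRatio_of_eq h, map_one, one_mul]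

theorem ratAut_rMat {v : Fin D.n → ℤ} {w : Equiv.Perm (Fin D.n)} {i j : Fin D.n}
    (h : v (w i) = v (w j)) : ratAut D v w (rMat D i j) = rMat D (w i) (w j) := by
  rw [rMat, map_mul, ratAut_ofField, map_mul, fieldAut_algebraMap_complex, map_inv₀, ratAut_ratPi h,
    fieldDiff, fieldAut_algebraMap, map_sub, latticeAut_X, latticeAut_X, h, add_sub_add_right_eq_sub]
  rfl

end

section

variable (D : Datum)

/-! ### The operators of `S_n`, `A`, `σ` and `τ` -/

/-- The Demazure–Lusztig operator `f ↦ f^{(i,j)} + k ℓ (f^{(i,j)} - f) / (U_j - U_i) π_{i,j}`. -/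
def demazure (i j : Fin D.n) : Module.End ℂ (RatRep D) :=
  latOp D 0 (Equiv.swap i j) + mulOp D (rMat D i j) * (latOp D 0 (Equiv.swap i j) - 1)

variable {D}

theorem demazure_apply (i j : Fin D.n) (f : RatRep D) :
    demazure D i j f = ratAut D 0 (Equiv.swap i j) f
      + rMat D i j * (ratAut D 0 (Equiv.swap i j) f - f) := rfl

/-- The composition law with the translation part tested at w i, which avoids inverse permutations
when indices are compared. -/
theorem ratAut_comp {v v' v'' : Fin D.n → ℤ} {w w' w'' : Equiv.Perm (Fin D.n)}
    (hv : ∀ i, v'' (w i) = v (w i) + v' i) (hw : w'' = w * w') (f : RatRep D) :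
    ratAut D v w (ratAut D v' w' f) = ratAut D v'' w'' f := by
  have : v'' = v + fun i => v' (w⁻¹ i) := by
    funext i
    simpa using hv (w⁻¹ i)
  rw [ratAut_ratAut, this, hw]

theorem mulOp_mul (a b : RatRep D) : mulOp D (a * b) = mulOp D a * mulOp D b :=
  LinearMap.ext fun f => mul_assoc a b f

theorem ratAut_perm_perm (v w : Equiv.Perm (Fin D.n)) (f : RatRep D) :
    ratAut D 0 v (ratAut D 0 w f) = ratAut D 0 (v * w) f := by
  exact ratAut_comp (by simp) rfl f

theorem ratAut_perm_rMat (w : Equiv.Perm (Fin D.n)) (i j : Fin D.n) :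
    ratAut D 0 w (rMat D i j) = rMat D (w i) (w j) :=
  ratAut_rMat rfl

/-- The swap changes r into -r, so (s + r(s - 1))² collapses to s² = 1. -/
theorem demazure_sq (i j : Fin D.n) : demazure D i j * demazure D i j = 1 := by
  refine LinearMap.ext fun f => ?_
  rw [Module.End.mul_apply, Module.End.one_apply]
  simp only [demazure_apply, map_add, map_mul, map_sub, ratAut_perm_perm, Equiv.swap_mul_self,
    ratAut_zero_one, ratAut_perm_rMat, Equiv.swap_apply_left, Equiv.swap_apply_right]
  rw [rMat_symm]
  ring

theorem demazure_comm {i j m l : Fin D.n} (h1 : m ≠ i) (h2 : m ≠ j) (h3 : l ≠ i) (h4 : l ≠ j) :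
    demazure D i j * demazure D m l = demazure D m l * demazure D i j := by
  have hcomm : Equiv.swap m l * Equiv.swap i j = Equiv.swap i j * Equiv.swap m l := by
    rw [perm_mul_swap, Equiv.swap_apply_of_ne_of_ne h1.symm h3.symm,
      Equiv.swap_apply_of_ne_of_ne h2.symm h4.symm]
  refine LinearMap.ext fun f => ?_
  rw [Module.End.mul_apply, Module.End.mul_apply]
  simp only [demazure_apply, map_add, map_mul, map_sub, ratAut_perm_perm, ratAut_perm_rMat, hcomm,
    Equiv.swap_apply_of_ne_of_ne h1 h2, Equiv.swap_apply_of_ne_of_ne h3 h4,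
    Equiv.swap_apply_of_ne_of_ne h1.symm h3.symm, Equiv.swap_apply_of_ne_of_ne h2.symm h4.symm]
  ring

theorem swap_braid {n : ℕ} {i j m : Fin n} (hij : i ≠ j) (hjm : j ≠ m) (him : i ≠ m) :
    Equiv.swap i j * Equiv.swap j m * Equiv.swap i j
      = Equiv.swap j m * Equiv.swap i j * Equiv.swap j m := by
  rw [Equiv.swap_mul_swap_mul_swap hij him, Equiv.swap_comm i j, Equiv.swap_comm j m,
    Equiv.swap_mul_swap_mul_swap hjm.symm him.symm, Equiv.swap_comm]

/-- After expansion the two sides differ by multiples of the Yang–Baxter equation alone, with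
coefficients involving f and its two swaps. -/
theorem demazure_braid {i j m : Fin D.n} (hij : i ≠ j) (hjm : j ≠ m) (him : i ≠ m) :
    demazure D i j * demazure D j m * demazure D i j
      = demazure D j m * demazure D i j * demazure D j m := by
  have hb := swap_braid hij hjm him
  have hY := rMat_yangBaxter hij hjm him
  have e1 := Equiv.swap_apply_of_ne_of_ne him.symm hjm.symm
  have e2 := Equiv.swap_apply_of_ne_of_ne hij him
  refine LinearMap.ext fun f => ?_
  simp only [Module.End.mul_apply]
  simp only [demazure_apply, map_add, map_mul, map_sub, ratAut_perm_perm, ratAut_perm_rMat,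
    Equiv.swap_apply_left, Equiv.swap_apply_right, e1, e2,
    Equiv.swap_mul_self, ratAut_zero_one, ← mul_assoc, hb]
  rw [rMat_symm i j, rMat_symm j m]
  linear_combination ((1 + rMat D i j) * ratAut D 0 (Equiv.swap i j) f
    - (1 + rMat D j m) * ratAut D 0 (Equiv.swap j m) f - (rMat D i j - rMat D j m) * f) * hY

theorem exists_permOp : ∃ S : Equiv.Perm (Fin D.n) →* Module.End ℂ (RatRep D),
    ∀ i j : Fin D.n, (j : ℕ) = i + 1 → S (Equiv.swap i j) = demazure D i j := by
  refine exists_monoidHom_of_coxeter _ (fun i j _ => demazure_sq i j) ?_ ?_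
  · intro i j m l hij hml hjm
    refine demazure_comm ?_ ?_ ?_ ?_ <;> · rintro rfl; omega
  · intro i j m hij hjm
    refine demazure_braid ?_ ?_ ?_ <;> · rintro rfl; omega

variable (D)

/-- The operators of the symmetric group. -/
def permOp : Equiv.Perm (Fin D.n) →* Module.End ℂ (RatRep D) := exists_permOp.choose

variable {D}

theorem permOp_swap {i j : Fin D.n} (h : (j : ℕ) = i + 1) :
    permOp D (Equiv.swap i j) = demazure D i j := exists_permOp.choose_spec i j h

theorem permA_swap (i j : Fin D.n) (a : diagonalGroup D) :
    permA D (Equiv.swap i j) a = tRatio D i j (a.1 j * (a.1 i)⁻¹) * a := by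
  apply Subtype.ext
  funext m
  show a.1 ((Equiv.swap i j)⁻¹ m) = (tRatio D i j _).1 m * a.1 m
  rw [tRatio_apply, Equiv.swap_inv]
  by_cases hij : i = j
  · subst hij; simp
  by_cases hm : m = i
  · subst hm; simp [hij]
  by_cases hm' : m = j
  · subst hm'; simp [hm]
  simp [Equiv.swap_apply_of_ne_of_ne hm hm', Pi.mulSingle_eq_of_ne hm, Pi.mulSingle_eq_of_ne hm']

/-- T^a and its swap differ by a power of T_i T_j⁻¹, which π_{ij} absorbs. So the correction term of
the Demazure operator is compatible with `A`, and its divided difference only concerns the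
U-coefficients. -/
theorem rMat_mul_permA (i j : Fin D.n) (a : diagonalGroup D) :
    rMat D i j * ratT D (permA D (Equiv.swap i j) a) = rMat D i j * ratT D a := by
  rw [permA_swap, map_mul, rMat, mul_assoc, ← mul_assoc (ratPi D i j), ratPi_mul_ratT, ← mul_assoc]

theorem ratAut_perm_ratT (w : Equiv.Perm (Fin D.n)) (a : diagonalGroup D) :
    ratAut D 0 w (ratT D a) = ratT D (permA D w a) := by
  rw [ratAut_ratT, latticeChar_zero, map_one, one_mul]

theorem permOp_mul_ratT (w : Equiv.Perm (Fin D.n)) (a : diagonalGroup D) :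
    permOp D w * mulOp D (ratT D a) = mulOp D (ratT D (permA D w a)) * permOp D w := by
  induction w using perm_adjacent_induction generalizing a with
  | one => rw [map_one, permA_one, one_mul, mul_one]
  | swap i j h =>
    rw [permOp_swap h]
    refine LinearMap.ext fun f => ?_
    have := rMat_mul_permA i j a
    simp only [Module.End.mul_apply, LinearMap.mulLeft_apply, demazure_apply, map_mul,
      ratAut_perm_ratT]
    linear_combination f * this
  | mul v w hv hw => rw [map_mul, mul_assoc, hw, ← mul_assoc, hv, mul_assoc, permA_mul]

variable (D)

/-- The diagonal part of an element of `G(ℓ,p,n)`. -/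
def diagPart (w : reflectionGroup D) : diagonalGroup D := ⟨w.1.left, w.2⟩

theorem diagPart_mul (v w : reflectionGroup D) :
    diagPart D (v * w) = diagPart D v * permA D v.1.right (diagPart D w) := rfl

/-- The operators of `G(ℓ,p,n)`. -/
def groupOp : reflectionGroup D →* Module.End ℂ (RatRep D) where
  toFun w := mulOp D (ratT D (diagPart D w)) * permOp D w.1.right
  map_one' := by
    have h : diagPart D 1 = 1 := rfl
    have h2 : (1 : reflectionGroup D).1.right = 1 := rfl
    rw [h, h2, map_one, map_one, mul_one]
    exact LinearMap.ext fun f => one_mul f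
  map_mul' v w := by
    have h2 : (v * w).1.right = v.1.right * w.1.right := rfl
    rw [diagPart_mul, h2, map_mul, map_mul, mulOp_mul, mul_assoc, mul_assoc,
      ← mul_assoc (permOp D v.1.right), permOp_mul_ratT, mul_assoc]

variable {D}

theorem groupOp_perm (w : Equiv.Perm (Fin D.n)) : groupOp D (perm D w) = permOp D w := by
  show mulOp D (ratT D 1) * permOp D w = _
  rw [map_one]
  exact LinearMap.ext fun f => one_mul _

theorem groupOp_diag (a : diagonalGroup D) : groupOp D (diag D a) = mulOp D (ratT D a) := by
  show mulOp D (ratT D a) * permOp D 1 = _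
  rw [map_one, mul_one]

theorem finRotate_succ_eq {n : ℕ} (i j : Fin n) (h : (j : ℕ) = i + 1) : finRotate n i = j := by
  cases n with
  | zero => exact i.elim0
  | succ m =>
    apply Fin.ext
    rw [finRotate_apply, Fin.val_add_one_of_lt' (by omega), h]

theorem finRotate_last_eq {n : ℕ} (o l : Fin n) (ho : (o : ℕ) = 0) (hl : (l : ℕ) + 1 = n) :
    finRotate n l = o := by
  cases n with
  | zero => exact l.elim0
  | succ m =>
    obtain rfl : l = Fin.last m := Fin.ext (by simp; omega)
    rw [finRotate_last]; exact Fin.ext ho.symm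

variable (D)

theorem first_val : (first D : ℕ) = 0 := rfl

theorem last_val : (last D : ℕ) + 1 = D.n := by
  have := Nat.pos_of_ne_zero D.n_ne.out
  simp only [last]; omega

theorem finRotate_last_first : finRotate D.n (last D) = first D :=
  finRotate_last_eq _ _ (first_val D) (last_val D)

/-- The automorphism `f(U; T) ↦ f(U_2, …, U_{n+1}; T_2, …, T_{n+1})`. -/
def rotUp : RatRep D →+* RatRep D := ratAut D (Pi.single (first D) 1) (finRotate D.n)

/-- The automorphism `f(U; T) ↦ f(U_0, …, U_{n-1}; T_0, …, T_{n-1})`. -/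
def rotDown : RatRep D →+* RatRep D := ratAut D (Pi.single (last D) (-1)) (finRotate D.n)⁻¹

/-- The factor `U_i - P(ζ⁻¹ T_i) + hbar`. -/
def sigmaFactor (i : Fin D.n) : RatRep D :=
  ratU D i - ratPoly D i (toC D D.ζ)⁻¹ + algebraMap ℂ _ D.hbar

/-- The operator of `σ`. -/
def sigmaOp : Module.End ℂ (RatRep D) :=
  mulOp D (sigmaFactor D (first D)) * latOp D (Pi.single (first D) 1) (finRotate D.n)

/-- The operator of `τ`. -/
def tauOp : Module.End ℂ (RatRep D) := latOp D (Pi.single (last D) (-1)) (finRotate D.n)⁻¹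

variable {D}

theorem sigmaOp_apply (f : RatRep D) :
    sigmaOp D f = sigmaFactor D (first D) * rotUp D f := rfl

theorem tauOp_apply (f : RatRep D) : tauOp D f = rotDown D f := rfl

theorem finRotate_eq_first_iff (i : Fin D.n) : finRotate D.n i = first D ↔ i = last D := by
  rw [← finRotate_last_first, (finRotate D.n).apply_eq_iff_eq]

theorem rotDown_rotUp (f : RatRep D) : rotDown D (rotUp D f) = f := by
  rw [rotDown, rotUp, ratAut_comp (v'' := 0) (fun i => ?_) (inv_mul_cancel _).symm,
    ratAut_zero_one]
  obtain ⟨j, rfl⟩ := (finRotate D.n).surjective i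
  rw [show (finRotate D.n)⁻¹ (finRotate D.n j) = j from (finRotate D.n).symm_apply_apply j]
  simp only [Pi.single_apply, finRotate_eq_first_iff, Pi.zero_apply]
  split_ifs <;> rfl

theorem rotUp_rotDown (f : RatRep D) : rotUp D (rotDown D f) = f := by
  rw [rotDown, rotUp, ratAut_comp (v'' := 0) (fun i => ?_) (mul_inv_cancel _).symm,
    ratAut_zero_one]
  simp only [Pi.single_apply, finRotate_eq_first_iff, Pi.zero_apply]
  split_ifs <;> rfl

theorem rotUp_swap (i j : Fin D.n) (f : RatRep D) :
    rotUp D (ratAut D 0 (Equiv.swap i j) f)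
      = ratAut D (Pi.single (first D) 1)
        (Equiv.swap (finRotate D.n i) (finRotate D.n j) * finRotate D.n) f := by
  rw [rotUp]
  exact ratAut_comp (fun m => by simp) (perm_mul_swap _ _ _).symm f

theorem swap_rotUp {i j : Fin D.n} (hi : i ≠ first D) (hj : j ≠ first D) (f : RatRep D) :
    ratAut D 0 (Equiv.swap i j) (rotUp D f)
      = ratAut D (Pi.single (first D) 1) (Equiv.swap i j * finRotate D.n) f := by
  rw [rotUp]
  refine ratAut_comp (fun m => ?_) rfl f
  simp only [Pi.zero_apply, zero_add, Pi.single_apply]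
  congr 1
  rw [Equiv.swap_apply_eq_iff, Equiv.swap_apply_of_ne_of_ne hi.symm hj.symm]

theorem ratAut_sigmaFactor {v : Fin D.n → ℤ} {w : Equiv.Perm (Fin D.n)} {i : Fin D.n}
    (h : v (w i) = 0) : ratAut D v w (sigmaFactor D i) = sigmaFactor D (w i) := by
  rw [sigmaFactor, map_add, map_sub, ratAut_ratU, ratAut_ratPoly, ratAut_algebraMap, h]
  simp [sigmaFactor]

/-- Neither index passes from the end to the beginning, so no hbar and no ζ appears. -/
theorem rotUp_rMat {i j i' j' : Fin D.n} (hi : (i' : ℕ) = i + 1) (hj : (j' : ℕ) = j + 1) :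
    rotUp D (rMat D i j) = rMat D i' j' := by
  have h : ∀ m : Fin D.n, (m : ℕ) ≠ 0 → m ≠ first D := by
    intro m hm h; rw [h] at hm; exact hm rfl
  rw [rotUp, ratAut_rMat, finRotate_succ_eq i i' hi, finRotate_succ_eq j j' hj]
  rw [finRotate_succ_eq i i' hi, finRotate_succ_eq j j' hj, Pi.single_eq_of_ne (h _ (by omega)),
    Pi.single_eq_of_ne (h _ (by omega))]

theorem rotUp_rotUp (f : RatRep D) {o' : Fin D.n} (ho : finRotate D.n (first D) = o') :
    rotUp D (rotUp D f) = ratAut D (Pi.single (first D) 1 + Pi.single o' 1)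
      (finRotate D.n * finRotate D.n) f := by
  rw [rotUp]
  refine ratAut_comp (fun m => ?_) rfl f
  rw [Pi.add_apply]
  congr 1
  simp only [Pi.single_apply, ← ho, EmbeddingLike.apply_eq_iff_eq]

end

section

variable {D : Datum}

theorem ne_first {m : Fin D.n} (h : (m : ℕ) ≠ 0) : m ≠ first D := by
  rintro rfl; exact h rfl

theorem eq_first {m : Fin D.n} (h : (m : ℕ) = 0) : m = first D := Fin.ext h

theorem eq_last {m : Fin D.n} (h : (m : ℕ) + 1 = D.n) : m = last D :=
  Fin.ext (by have := last_val D; omega)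

theorem rotUp_swap_eq {i j m : Fin D.n} (hij : (j : ℕ) = i + 1) (hjm : (m : ℕ) = j + 1)
    (f : RatRep D) :
    rotUp D (ratAut D 0 (Equiv.swap i j) f) = ratAut D 0 (Equiv.swap j m) (rotUp D f) := by
  rw [rotUp_swap, swap_rotUp (ne_first (by omega)) (ne_first (by omega)),
    finRotate_succ_eq i j hij, finRotate_succ_eq j m hjm]

theorem swap_rotDown_eq {i j m : Fin D.n} (hij : (j : ℕ) = i + 1) (hjm : (m : ℕ) = j + 1)
    (f : RatRep D) :
    rotDown D (ratAut D 0 (Equiv.swap j m) f) = ratAut D 0 (Equiv.swap i j) (rotDown D f) := by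
  rw [← rotDown_rotUp (ratAut D 0 (Equiv.swap i j) (rotDown D f)), rotUp_swap_eq hij hjm,
    rotUp_rotDown]

theorem rotDown_rMat {i j i' j' : Fin D.n} (hi : (i' : ℕ) = i + 1) (hj : (j' : ℕ) = j + 1) :
    rotDown D (rMat D i' j') = rMat D i j := by
  rw [← rotUp_rMat hi hj, rotDown_rotUp]

/-! ### The cyclic shift of the last transposition -/

section AffineReflection

variable {o o' m l : Fin D.n} (ho : (o : ℕ) = 0) (ho' : (o' : ℕ) = 1) (hlm : (l : ℕ) = m + 1)
  (hl : (l : ℕ) + 1 = D.n)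
include ho ho' hlm hl

/-- Two shifts carry the last two indices to the first two, and both variables pick up the same
translation, so their difference is unaffected. -/
theorem rotUp_rotUp_rMat : rotUp D (rotUp D (rMat D m l)) = rMat D o o' := by
  obtain rfl := eq_first ho
  have h : o' ≠ first D := ne_first (by omega)
  rw [rotUp_rotUp _ (finRotate_succ_eq _ o' (by omega)), ratAut_rMat] <;>
  simp only [Equiv.Perm.mul_apply, finRotate_succ_eq m l hlm, finRotate_last_eq _ l ho hl,
    finRotate_succ_eq (first D) o' (by omega)]
  simp [Pi.single_eq_of_ne h, Pi.single_eq_of_ne h.symm]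

theorem rotUp_rotUp_swap (f : RatRep D) :
    rotUp D (rotUp D (ratAut D 0 (Equiv.swap m l) f))
      = ratAut D 0 (Equiv.swap o o') (rotUp D (rotUp D f)) := by
  obtain rfl := eq_first ho
  have h : o' ≠ first D := ne_first (by omega)
  have e := finRotate_succ_eq (first D) o' (by omega)
  rw [rotUp_rotUp _ e, rotUp_rotUp _ e, ratAut_comp (fun i => ?_) rfl,
    ratAut_comp (v'' := Pi.single (first D) 1 + Pi.single o' 1) (fun i => ?_) ?_]
  · rw [mul_assoc, perm_mul_swap, ← mul_assoc, perm_mul_swap, mul_assoc,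
      finRotate_succ_eq m l hlm, finRotate_last_eq _ l ho hl, e]
  · simp only [Pi.zero_apply, zero_add, Pi.add_apply, Pi.single_apply]
    rw [add_comm]
    simp only [Equiv.swap_apply_eq_iff, Equiv.swap_apply_left, Equiv.swap_apply_right]
  · simp

theorem rotUp_swap_rotDown (f : RatRep D) :
    rotUp D (ratAut D 0 (Equiv.swap m l) (rotDown D f))
      = rotDown D (ratAut D 0 (Equiv.swap o o') (rotUp D f)) := by
  have h := rotUp_rotUp_swap ho ho' hlm hl (rotDown D f)
  rw [rotUp_rotDown] at h
  rw [← h, rotDown_rotUp]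

/-- A single shift of the last r-matrix and a single backward shift of the first give the same
affine r-matrix, with pole involving hbar. This is what lets σ s τ and τ s σ be compared. -/
theorem rotUp_rMat_last : rotUp D (rMat D m l) = rotDown D (rMat D o o') := by
  rw [← rotUp_rotUp_rMat ho ho' hlm hl, rotDown_rotUp]

end AffineReflection

theorem rotUp_sigmaFactor {o o' : Fin D.n} (ho : (o : ℕ) = 0) (ho' : (o' : ℕ) = 1) :
    rotUp D (sigmaFactor D o) = sigmaFactor D o' := by
  have e := finRotate_succ_eq o o' (by omega)
  rw [rotUp, ratAut_sigmaFactor, e]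
  rw [e, Pi.single_eq_of_ne (ne_first (by omega))]

theorem swap_sigmaFactor (o o' : Fin D.n) :
    ratAut D 0 (Equiv.swap o o') (sigmaFactor D o) = sigmaFactor D o' := by
  rw [ratAut_sigmaFactor rfl, Equiv.swap_apply_left]

theorem swap_sigmaFactor' (o o' : Fin D.n) :
    ratAut D 0 (Equiv.swap o o') (sigmaFactor D o') = sigmaFactor D o := by
  rw [ratAut_sigmaFactor rfl, Equiv.swap_apply_right]

/-- σ and τ are cyclic shifts up to a factor in the first variables U_1, T_1. That factor is
untouched by the transpositions away from the first index, and in σ² it appears as a product over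
the first two indices, which their swap preserves. -/
theorem cyclicRelations : CyclicRelations (permOp D) (finRotate D.n) (sigmaOp D) (tauOp D) where
  cycle i j h := finRotate_succ_eq i j h
  cycle_last o l ho hl := finRotate_last_eq o l ho hl
  sigma i j m hij hjm := by
    rw [permOp_swap hij, permOp_swap hjm]
    refine LinearMap.ext fun f => ?_
    have h : ratAut D 0 (Equiv.swap j m) (sigmaFactor D (first D)) = sigmaFactor D (first D) := by
      rw [ratAut_sigmaFactor rfl, Equiv.swap_apply_of_ne_of_ne (ne_first (by omega)).symm
        (ne_first (by omega)).symm]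
    simp only [Module.End.mul_apply, demazure_apply, sigmaOp_apply, map_add, map_sub, map_mul, h,
      rotUp_swap_eq hij hjm, rotUp_rMat hij hjm]
    ring
  tau i j m hij hjm := by
    rw [permOp_swap hij, permOp_swap hjm]
    refine LinearMap.ext fun f => ?_
    simp only [Module.End.mul_apply, demazure_apply, tauOp_apply, map_add, map_sub, map_mul,
      swap_rotDown_eq hij hjm, rotDown_rMat hij hjm]
  sigma_sq o o' m l ho ho' hlm hl := by
    rw [permOp_swap (by omega), permOp_swap hlm]
    refine LinearMap.ext fun f => ?_
    obtain rfl := eq_first ho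
    simp only [Module.End.mul_apply, demazure_apply, sigmaOp_apply, map_add, map_sub, map_mul,
      rotUp_sigmaFactor ho ho', swap_sigmaFactor,
      swap_sigmaFactor', rotUp_rotUp_swap ho ho' hlm hl,
      rotUp_rotUp_rMat ho ho' hlm hl]
    ring
  tau_sq o o' m l ho ho' hlm hl := by
    rw [permOp_swap (by omega), permOp_swap hlm]
    refine LinearMap.ext fun f => ?_
    -- The relation for two forward shifts, solved for two backward shifts.
    have h : rotDown D (rotDown D (ratAut D 0 (Equiv.swap o o') f))
        = ratAut D 0 (Equiv.swap m l) (rotDown D (rotDown D f)) := by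
      have := rotUp_rotUp_swap ho ho' hlm hl (rotDown D (rotDown D f))
      rw [rotUp_rotDown, rotUp_rotDown] at this
      rw [← this, rotDown_rotUp, rotDown_rotUp]
    have h2 : rotDown D (rotDown D (rMat D o o')) = rMat D m l := by
      rw [← rotUp_rotUp_rMat ho ho' hlm hl, rotDown_rotUp, rotDown_rotUp]
    simp only [Module.End.mul_apply, demazure_apply, tauOp_apply, map_add, map_sub, map_mul, h, h2]

theorem rotDown_sigmaFactor :
    rotDown D (sigmaFactor D (first D)) = ratU D (last D) - ratPoly D (last D) 1 := by
  have e : (finRotate D.n)⁻¹ (first D) = last D := by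
    rw [Equiv.Perm.inv_eq_iff_eq, finRotate_last_first]
  rw [sigmaFactor, map_add, map_sub, rotDown, ratAut_ratU, ratAut_ratPoly, ratAut_algebraMap, e,
    Pi.single_eq_same]
  simp only [Int.cast_neg, Int.cast_one, mul_neg, mul_one, neg_neg, zpow_one, map_neg]
  rw [inv_mul_cancel₀ (toC_ne_zero D _)]
  ring

/-! ### The commutator of x_1 and y_n -/

section Mixed

variable {o o' m l : Fin D.n} (ho : (o : ℕ) = 0) (ho' : (o' : ℕ) = 1) (hlm : (l : ℕ) = m + 1)
  (hl : (l : ℕ) + 1 = D.n)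
include ho hlm hl

/-- The shift sends T_n to ζ⁻¹ T_1, which multiplies the r-th term of the projector by a power of ζ:
this is the origin of the weights ζ^{-r} in [x_i, y_j]. -/
theorem rotUp_ratPi_last : algebraMap ℂ _ (D.ℓ : ℂ) * rotUp D (ratPi D m l)
    = ∑ z : Mu D, algebraMap ℂ _ (toC D z)⁻¹ * ratT D (tRatio D o l z) := by
  obtain rfl := eq_first ho
  have hne : l ≠ first D := ne_first (by omega)
  rw [ratPi, map_mul, map_sum, rotUp, ratAut_algebraMap, ← mul_assoc, ← map_mul,
    mul_inv_cancel₀ (ell_ne_zero D), map_one, one_mul]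
  refine Fintype.sum_equiv (Equiv.inv _) _ _ fun z => ?_
  rw [ratAut_ratT, permA_tRatio, latticeChar_single, finRotate_succ_eq m l hlm,
    finRotate_last_eq _ l ho hl, Equiv.inv_apply, tRatio_symm, tRatio_apply]
  simp [Pi.mulSingle_eq_of_ne hne.symm, toC_inv]

/-- The shift of the rule that T_{n-1} and T_n agree behind π_{n-1,n}: behind the shifted projector,
T_n and ζ⁻¹ T_1 agree. -/
theorem rotUp_ratPi_mul_ratPoly :
    rotUp D (ratPi D m l) * ratPoly D l 1 = rotUp D (ratPi D m l) * ratPoly D o (toC D D.ζ)⁻¹ := by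
  obtain rfl := eq_first ho
  have hne : l ≠ first D := ne_first (by omega)
  have h := congrArg (rotUp D) (ratPi_mul_ratPoly m l 1)
  rw [map_mul, map_mul] at h
  have e1 : rotUp D (ratPoly D m 1) = ratPoly D l 1 := by
    rw [rotUp, ratAut_ratPoly, finRotate_succ_eq m l hlm, Pi.single_eq_of_ne hne]; simp
  have e2 : rotUp D (ratPoly D l 1) = ratPoly D (first D) (toC D D.ζ)⁻¹ := by
    rw [rotUp, ratAut_ratPoly, finRotate_last_eq _ l ho hl, Pi.single_eq_same]; simp
  rwa [e1, e2] at h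

/-- The shift turns the denominator U_n - U_{n-1} into U_1 + hbar - U_n, so the linear factor
cancels the pole up to sign. -/
theorem rotUp_rMat_mul :
    rotUp D (rMat D m l) * (ratU D l - ratU D o - algebraMap ℂ _ D.hbar)
      = -(algebraMap ℂ _ (D.k * D.ℓ) * rotUp D (ratPi D m l)) := by
  obtain rfl := eq_first ho
  have hne : l ≠ first D := ne_first (by omega)
  set d : FieldU D := fieldAut D (latticeAut D (Pi.single (first D) 1) (finRotate D.n))
    (fieldDiff D m l) with hd
  have hd0 : d ≠ 0 := by
    rw [hd, Ne, map_eq_zero_iff _ (RingEquiv.injective _)]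
    exact fieldDiff_ne (by rintro rfl; omega)
  have e1 : ratU D l - ratU D (first D) - algebraMap ℂ _ D.hbar = -ofField D d := by
    rw [hd, fieldDiff, fieldAut_algebraMap, map_sub, latticeAut_X, latticeAut_X,
      finRotate_succ_eq m l hlm, finRotate_last_eq _ l ho hl, Pi.single_eq_same,
      Pi.single_eq_of_ne hne, map_sub, map_add, map_add, map_sub, map_add, map_add, Int.cast_one,
      mul_one, Int.cast_zero, mul_zero, map_zero, map_zero, map_zero, add_zero, neg_sub, ← sub_sub]
    rfl
  have e2 : rotUp D (rMat D m l)
      = ofField D (algebraMap ℂ _ (D.k * D.ℓ) * d⁻¹) * rotUp D (ratPi D m l) := by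
    rw [rMat, map_mul, rotUp, ratAut_ofField, map_mul, fieldAut_algebraMap_complex, map_inv₀]
  have e3 : ofField D (algebraMap ℂ _ (D.k * D.ℓ) * d⁻¹) * ofField D d
      = algebraMap ℂ _ (D.k * D.ℓ) := by
    rw [← map_mul, inv_mul_cancel_right₀ hd0]; rfl
  rw [e1, e2, ← e3]
  ring

include ho' in
-- The parts involving the affine reflection cancel. What remains is the affine r-matrix times the
-- difference between the σ-factor and its backward shift. The P-terms of that difference cancel
-- behind the projector, and the linear part cancels the pole.
theorem sigma_tau_commutator (f : RatRep D) :
    (sigmaOp D * demazure D m l * tauOp D - tauOp D * demazure D o o' * sigmaOp D) f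
      = -(algebraMap ℂ _ D.k *
        ∑ z : Mu D, algebraMap ℂ _ (toC D z)⁻¹ * ratT D (tRatio D o l z)) * f := by
  have e1 := rotUp_rMat_mul ho hlm hl
  have e2 := rotUp_ratPi_mul_ratPoly ho hlm hl
  have e4 : rotUp D (rMat D m l) * ratPoly D l 1
      = rotUp D (rMat D m l) * ratPoly D o (toC D D.ζ)⁻¹ := by
    rw [rMat, map_mul, mul_assoc, e2, mul_assoc]
  obtain rfl := eq_last hl
  obtain rfl := eq_first ho
  have e3 : rotDown D (ratAut D 0 (Equiv.swap (first D) o') (sigmaFactor D (first D)))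
      = sigmaFactor D (first D) := by
    rw [swap_sigmaFactor, ← rotUp_sigmaFactor ho ho', rotDown_rotUp]
  rw [← rotUp_ratPi_last ho hlm hl, ← mul_assoc, ← map_mul, ← e1]
  simp only [LinearMap.sub_apply, Module.End.mul_apply, demazure_apply, sigmaOp_apply, tauOp_apply,
    map_add, map_sub, map_mul, rotUp_rotDown, rotDown_rotUp, e3,
    rotUp_swap_rotDown ho ho' hlm hl, ← rotUp_rMat_last ho ho' hlm hl, rotDown_sigmaFactor]
  simp only [sigmaFactor]
  linear_combination (-f) * e4

end Mixed

end

section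

variable (D : Datum)

/-! ### The operators of `x_i`, `y_i` and the relations of the Cherednik algebra -/

/-- The operator of `x_i`. -/
def xOp : Fin D.n → Module.End ℂ (RatRep D) :=
  family (permOp D) (first D) (sigmaOp D * permOp D (finRotate D.n)⁻¹)

/-- The operator of `y_i`. -/
def yOp : Fin D.n → Module.End ℂ (RatRep D) :=
  family (permOp D) (first D) (permOp D (finRotate D.n) * tauOp D)

/-- The operator of `∑_r t_i^r t_j^{-r} (i,j)`. -/
def reflSum (i j : Fin D.n) : Module.End ℂ (RatRep D) := ∑ z : Mu D, groupOp D (refl D i j z)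

variable {D}

theorem permOp_mul_xOp (w : Equiv.Perm (Fin D.n)) (i : Fin D.n) :
    permOp D w * xOp D i = xOp D (w i) * permOp D w :=
  map_mul_family (fun w hw => cyclicRelations.commute_x (first_val D) w hw) w i

theorem permOp_mul_yOp (w : Equiv.Perm (Fin D.n)) (i : Fin D.n) :
    permOp D w * yOp D i = yOp D (w i) * permOp D w :=
  map_mul_family (fun w hw => cyclicRelations.commute_y (first_val D) w hw) w i

theorem xOp_comm (i j : Fin D.n) : xOp D i * xOp D j = xOp D j * xOp D i :=
  cyclicRelations.x_commute (first_val D) i j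

theorem yOp_comm (i j : Fin D.n) : yOp D i * yOp D j = yOp D j * yOp D i :=
  cyclicRelations.y_commute (first_val D) i j

theorem xOp_first : xOp D (first D) = sigmaOp D * permOp D (finRotate D.n)⁻¹ := family_self _ _

theorem yOp_first : yOp D (first D) = permOp D (finRotate D.n) * tauOp D := family_self _ _

theorem refl_symm (i j : Fin D.n) (z : Mu D) : refl D i j z⁻¹ = refl D j i z := by
  rw [refl, refl, tRatio_symm, Equiv.swap_comm]

theorem perm_mul_refl (w : Equiv.Perm (Fin D.n)) (i j : Fin D.n) (z : Mu D) :
    perm D w * refl D i j z = refl D (w i) (w j) z * perm D w := by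
  have h : perm D w * diag D (tRatio D i j z) = diag D (tRatio D (w i) (w j) z) * perm D w := by
    rw [← permA_tRatio]
    apply Subtype.ext
    ext1
    · show (1 : Fin D.n → Mu D) * mulAutArrow w (tRatio D i j z).1
        = (permA D w (tRatio D i j z)).1 * mulAutArrow 1 1
      rw [map_one, one_mul]; simp; rfl
    · show w * 1 = 1 * w
      rw [one_mul, mul_one]
  rw [refl, ← mul_assoc, h, mul_assoc, ← map_mul, perm_mul_swap, map_mul, ← mul_assoc, refl]

theorem reflSum_symm (i j : Fin D.n) : reflSum D i j = reflSum D j i :=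
  Fintype.sum_equiv (Equiv.inv _) _ _ fun z => by rw [Equiv.inv_apply, refl_symm]

theorem permOp_mul_reflSum (w : Equiv.Perm (Fin D.n)) (i j : Fin D.n) :
    permOp D w * reflSum D i j = reflSum D (w i) (w j) * permOp D w := by
  rw [reflSum, reflSum, Finset.mul_sum, Finset.sum_mul]
  refine Finset.sum_congr rfl fun z _ => ?_
  rw [← groupOp_perm, ← map_mul, perm_mul_refl, map_mul]

theorem reflSum_eq (i j : Fin D.n) : reflSum D i j
    = mulOp D (∑ z : Mu D, ratT D (tRatio D i j z)) * permOp D (Equiv.swap i j) := by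
  refine LinearMap.ext fun f => ?_
  simp only [reflSum, refl, map_mul, groupOp_perm, groupOp_diag, LinearMap.sum_apply,
    Module.End.mul_apply, LinearMap.mulLeft_apply, Finset.sum_mul]

theorem rMat_mul_diff {i j : Fin D.n} (h : i ≠ j) :
    rMat D i j * (ratU D j - ratU D i)
      = algebraMap ℂ _ D.k * ∑ z : Mu D, ratT D (tRatio D i j z) := by
  have e : ratU D j - ratU D i = ofField D (fieldDiff D i j) := by
    rw [fieldDiff, map_sub, map_sub]; rfl
  have e2 : ofField D (algebraMap ℂ _ (D.k * D.ℓ) * (fieldDiff D i j)⁻¹)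
      * ofField D (fieldDiff D i j) = algebraMap ℂ _ (D.k * D.ℓ) := by
    rw [← map_mul, inv_mul_cancel_right₀ (fieldDiff_ne h)]; rfl
  rw [e, rMat, mul_right_comm, e2, ratPi, ← mul_assoc, ← map_mul,
    mul_inv_cancel_right₀ (ell_ne_zero D)]

theorem ratAut_perm_ratU (w : Equiv.Perm (Fin D.n)) (i : Fin D.n) :
    ratAut D 0 w (ratU D i) = ratU D (w i) := by
  rw [ratAut_ratU]; simp

theorem mulOp_algebraMap (c : ℂ) : mulOp D (algebraMap ℂ _ c) = c • 1 := by
  refine LinearMap.ext fun f => ?_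
  rw [LinearMap.mulLeft_apply, ← Algebra.smul_def]; rfl

/-- The degenerate affine Hecke relation: multiplying r by the difference of variables clears its
denominator and leaves k times the sum of reflections. -/
theorem permOp_ratU {i j : Fin D.n} (h : (j : ℕ) = i + 1) :
    permOp D (Equiv.swap i j) * mulOp D (ratU D i) * permOp D (Equiv.swap i j)
      = mulOp D (ratU D j) + D.k • reflSum D i j := by
  have hne : i ≠ j := by rintro rfl; omega
  have e : permOp D (Equiv.swap i j) * mulOp D (ratU D i)
      = mulOp D (ratU D j) * permOp D (Equiv.swap i j)
        + D.k • mulOp D (∑ z : Mu D, ratT D (tRatio D i j z)) := by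
    rw [permOp_swap h]
    refine LinearMap.ext fun f => ?_
    simp only [LinearMap.add_apply, LinearMap.smul_apply, Module.End.mul_apply,
      LinearMap.mulLeft_apply, demazure_apply, map_mul, ratAut_perm_ratU, Equiv.swap_apply_left]
    rw [Algebra.smul_def]
    linear_combination f * rMat_mul_diff hne
  rw [e, add_mul, mul_assoc, map_swap_mul_self, mul_one, smul_mul_assoc, reflSum_eq]

theorem permOp_ratU' {i j : Fin D.n} (h : (j : ℕ) = i + 1) :
    permOp D (Equiv.swap i j) * mulOp D (ratU D j) * permOp D (Equiv.swap i j)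
      = mulOp D (ratU D i) - D.k • reflSum D i j := by
  have e := permOp_ratU h
  have e2 := permOp_mul_reflSum (Equiv.swap i j) i j
  rw [Equiv.swap_apply_left, Equiv.swap_apply_right, reflSum_symm j i] at e2
  have e3 : mulOp D (ratU D j) = permOp D (Equiv.swap i j) * mulOp D (ratU D i)
      * permOp D (Equiv.swap i j) - D.k • reflSum D i j := by rw [e, add_sub_cancel_right]
  rw [e3, mul_sub, sub_mul, mul_assoc, mul_assoc, mul_assoc, mul_assoc, map_swap_mul_self, mul_one,
    ← mul_assoc, map_swap_mul_self, one_mul, smul_mul_assoc, mul_smul_comm, ← mul_assoc, e2, mul_assoc,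
    map_swap_mul_self, mul_one]

theorem permOp_mul_ratPoly (w : Equiv.Perm (Fin D.n)) (i : Fin D.n) (u : ℂ) :
    permOp D w * mulOp D (ratPoly D i u) = mulOp D (ratPoly D (w i) u) * permOp D w := by
  refine LinearMap.ext fun f => ?_
  simp only [Module.End.mul_apply, LinearMap.mulLeft_apply, ratPoly, Finset.sum_mul, map_sum,
    ← Algebra.smul_def, smul_mul_assoc, map_smul]
  refine Finset.sum_congr rfl fun q _ => ?_
  have := LinearMap.congr_fun (permOp_mul_ratT w (tPow D i q)) f
  simp only [Module.End.mul_apply, LinearMap.mulLeft_apply, permA_tPow] at this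
  rw [this]

theorem permOp_conj_mul (w : Equiv.Perm (Fin D.n)) (a b : Module.End ℂ (RatRep D)) :
    permOp D w * (a * b) * permOp D w⁻¹
      = permOp D w * a * permOp D w⁻¹ * (permOp D w * b * permOp D w⁻¹) := by
  rw [mul_assoc _ (permOp D w⁻¹), ← mul_assoc (permOp D w⁻¹) (permOp D w * b), ← mul_assoc
    (permOp D w⁻¹), map_inv_mul_map, one_mul]
  simp only [mul_assoc]

theorem permOp_xOp (w : Equiv.Perm (Fin D.n)) (i : Fin D.n) :
    permOp D w * xOp D i * permOp D w⁻¹ = xOp D (w i) := by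
  rw [permOp_mul_xOp, mul_assoc, map_mul_map_inv, mul_one]

theorem permOp_yOp (w : Equiv.Perm (Fin D.n)) (i : Fin D.n) :
    permOp D w * yOp D i * permOp D w⁻¹ = yOp D (w i) := by
  rw [permOp_mul_yOp, mul_assoc, map_mul_map_inv, mul_one]

theorem permOp_reflSum (w : Equiv.Perm (Fin D.n)) (i j : Fin D.n) :
    permOp D w * reflSum D i j * permOp D w⁻¹ = reflSum D (w i) (w j) := by
  rw [permOp_mul_reflSum, mul_assoc, map_mul_map_inv, mul_one]

theorem permOp_ratPoly (w : Equiv.Perm (Fin D.n)) (i : Fin D.n) (u : ℂ) :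
    permOp D w * mulOp D (ratPoly D i u) * permOp D w⁻¹ = mulOp D (ratPoly D (w i) u) := by
  rw [permOp_mul_ratPoly, mul_assoc, map_mul_map_inv, mul_one]

theorem sigmaOp_mul_tauOp : sigmaOp D * tauOp D = mulOp D (sigmaFactor D (first D)) := by
  refine LinearMap.ext fun f => ?_
  rw [Module.End.mul_apply, sigmaOp_apply, tauOp_apply, rotUp_rotDown]; rfl

theorem tauOp_mul_sigmaOp :
    tauOp D * sigmaOp D = mulOp D (ratU D (last D) - ratPoly D (last D) 1) := by
  refine LinearMap.ext fun f => ?_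
  rw [Module.End.mul_apply, sigmaOp_apply, tauOp_apply, map_mul, rotDown_rotUp,
    rotDown_sigmaFactor]; rfl

/-- The Dunkl–Opdam operators act by multiplication. -/
theorem xOp_mul_yOp (i : Fin D.n) : xOp D i * yOp D i
    = mulOp D (ratU D i) - mulOp D (ratPoly D i (toC D D.ζ)⁻¹) + D.hbar • 1
      + D.k • ∑ j ∈ Finset.univ.filter (· < i), reflSum D i j := by
  obtain ⟨m, hm⟩ : ∃ m : ℕ, (i : ℕ) = m := ⟨_, rfl⟩
  induction m generalizing i with
  | zero =>
    obtain rfl := eq_first hm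
    have h : Finset.univ.filter (· < first D) = ∅ := by
      ext j; simp [Fin.lt_def, first_val]
    rw [xOp_first, yOp_first, h, mul_assoc, ← mul_assoc (permOp D _), map_inv_mul_map, one_mul,
      sigmaOp_mul_tauOp, Finset.sum_empty, smul_zero, add_zero, ← mulOp_algebraMap]
    refine LinearMap.ext fun f => ?_
    simp only [LinearMap.mulLeft_apply, LinearMap.add_apply, LinearMap.sub_apply, sigmaFactor]
    ring
  | succ m ih =>
    obtain ⟨i₀, hi₀⟩ : ∃ i₀ : Fin D.n, (i₀ : ℕ) = m := ⟨⟨m, by omega⟩, rfl⟩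
    have hi : (i : ℕ) = i₀ + 1 := by omega
    -- Conjugation by (i₀, i) carries the identity at i₀ to the one at i. U_{i₀} becomes U_i plus k
    -- times a sum of reflections, which is the summand j = i₀ that is new.
    have h := congrArg (fun t => permOp D (Equiv.swap i₀ i) * t * permOp D (Equiv.swap i₀ i)⁻¹)
      (ih i₀ hi₀)
    simp only [permOp_conj_mul, permOp_xOp, permOp_yOp, mul_add, add_mul, mul_sub, sub_mul,
      permOp_ratPoly, Equiv.swap_apply_left, mul_smul_comm, smul_mul_assoc, mul_one,
      map_mul_map_inv, Finset.mul_sum, Finset.sum_mul, permOp_reflSum] at h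
    rw [h, Equiv.swap_inv, permOp_ratU hi]
    have h1 : Finset.univ.filter (· < i) = insert i₀ (Finset.univ.filter (· < i₀)) := by
      ext j; simp only [Finset.mem_filter, Finset.mem_univ, true_and, Finset.mem_insert, Fin.lt_def,
        Fin.ext_iff]; omega
    have h2 : ∑ j ∈ Finset.univ.filter (· < i₀), reflSum D i (Equiv.swap i₀ i j)
        = ∑ j ∈ Finset.univ.filter (· < i₀), reflSum D i j := by
      refine Finset.sum_congr rfl fun j hj => ?_
      simp only [Finset.mem_filter, Finset.mem_univ, true_and, Fin.lt_def] at hj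
      rw [Equiv.swap_apply_of_ne_of_ne] <;> · rintro rfl; omega
    rw [h1, h2, Finset.sum_insert (by simp), reflSum_symm i i₀, smul_add]
    abel

/-- The induction runs down from the last index, where y_n x_n = τσ is a multiplication operator.
Each conjugation now subtracts the reflections of one adjacent pair. -/
theorem yOp_mul_xOp (i : Fin D.n) : yOp D i * xOp D i
    = mulOp D (ratU D i) - mulOp D (ratPoly D i 1)
      - D.k • ∑ j ∈ Finset.univ.filter (i < ·), reflSum D i j := by
  obtain ⟨m, hm⟩ : ∃ m : ℕ, (i : ℕ) + m + 1 = D.n := ⟨D.n - i - 1, by omega⟩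
  induction m generalizing i with
  | zero =>
    obtain rfl := eq_last hm
    have h : Finset.univ.filter (last D < ·) = ∅ := by
      ext j; simp only [Finset.mem_filter, Finset.mem_univ, true_and, Fin.lt_def,
        Finset.notMem_empty, iff_false]; omega
    have e : (finRotate D.n)⁻¹ (first D) = last D := by
      rw [Equiv.Perm.inv_eq_iff_eq, finRotate_last_first]
    rw [← e, ← permOp_xOp, ← permOp_yOp, e, ← permOp_conj_mul, h, xOp_first, yOp_first, inv_inv,
      Finset.sum_empty, smul_zero, sub_zero]
    have e2 : permOp D (finRotate D.n)⁻¹ * (permOp D (finRotate D.n) * tauOp D * (sigmaOp D *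
        permOp D (finRotate D.n)⁻¹)) * permOp D (finRotate D.n) = tauOp D * sigmaOp D := by
      simp only [mul_assoc, map_inv_mul_map, mul_one]
      rw [← mul_assoc, map_inv_mul_map, one_mul]
    rw [e2, tauOp_mul_sigmaOp]
    refine LinearMap.ext fun f => ?_
    simp only [LinearMap.mulLeft_apply, LinearMap.sub_apply, sub_mul]
  | succ m ih =>
    obtain ⟨i₀, hi⟩ : ∃ i₀ : Fin D.n, (i₀ : ℕ) = i + 1 := ⟨⟨i + 1, by omega⟩, rfl⟩
    have h := congrArg (fun t => permOp D (Equiv.swap i i₀) * t * permOp D (Equiv.swap i i₀)⁻¹)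
      (ih i₀ (by omega))
    simp only [permOp_conj_mul, permOp_xOp, permOp_yOp, mul_sub, sub_mul,
      permOp_ratPoly, Equiv.swap_apply_right, mul_smul_comm, smul_mul_assoc,
      Finset.mul_sum, Finset.sum_mul, permOp_reflSum] at h
    rw [h, Equiv.swap_inv, permOp_ratU' hi]
    have h1 : Finset.univ.filter (i < ·) = insert i₀ (Finset.univ.filter (i₀ < ·)) := by
      ext j; simp only [Finset.mem_filter, Finset.mem_univ, true_and, Finset.mem_insert, Fin.lt_def,
        Fin.ext_iff]; omega
    have h2 : ∑ j ∈ Finset.univ.filter (i₀ < ·), reflSum D i (Equiv.swap i i₀ j)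
        = ∑ j ∈ Finset.univ.filter (i₀ < ·), reflSum D i j := by
      refine Finset.sum_congr rfl fun j hj => ?_
      simp only [Finset.mem_filter, Finset.mem_univ, true_and, Fin.lt_def] at hj
      rw [Equiv.swap_apply_of_ne_of_ne] <;> · rintro rfl; omega
    rw [h1, h2, Finset.sum_insert (by simp), smul_add]
    abel

/-- In the difference of the two product formulas U_i drops out, and the reflections with j < i and
with j > i combine into the full sum. -/
theorem xOp_yOp_same (i : Fin D.n) : xOp D i * yOp D i - yOp D i * xOp D i
    = D.hbar • 1 + D.k • ∑ j ∈ Finset.univ.erase i, reflSum D i j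
      + mulOp D (ratPoly D i 1) - mulOp D (ratPoly D i (toC D D.ζ)⁻¹) := by
  have h : Finset.univ.erase i
      = (Finset.univ.filter (· < i)).disjUnion (Finset.univ.filter (i < ·)) (by
        rw [Finset.disjoint_left]
        intro j hj hj'
        simp only [Finset.mem_filter, Finset.mem_univ, true_and] at hj hj'
        exact lt_asymm hj hj') := by
    ext j; simp [lt_or_lt_iff_ne]
  rw [xOp_mul_yOp, yOp_mul_xOp, h, Finset.sum_disjUnion, smul_add]
  abel

theorem xOp_yOp_ne {i j : Fin D.n} (h : i ≠ j) : xOp D i * yOp D j - yOp D j * xOp D i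
    = -(D.k • ∑ z : Mu D, (toC D z)⁻¹ • groupOp D (refl D i j z)) := by
  have hn : 2 ≤ D.n := by
    by_contra! hn
    exact h (Fin.ext (by omega))
  set o' : Fin D.n := ⟨1, by omega⟩ with ho'
  set m : Fin D.n := ⟨D.n - 2, by omega⟩ with hm
  have hl := last_val D
  have hlm : (last D : ℕ) = m + 1 := by simp only [hm]; omega
  have base : xOp D (first D) * yOp D (last D) - yOp D (last D) * xOp D (first D)
      = -(D.k • ∑ z : Mu D, (toC D z)⁻¹ • groupOp D (refl D (first D) (last D) z)) := by
    rw [xOp_first, yOp, cyclicRelations.x_mul_y_last (first_val D) hlm hl,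
      cyclicRelations.y_last_mul_x (first_val D) (o' := o') rfl hl, permOp_swap hlm,
      permOp_swap (show (o' : ℕ) = first D + 1 from rfl), ← sub_mul]
    refine LinearMap.ext fun f => ?_
    rw [Module.End.mul_apply, sigma_tau_commutator (first_val D) (o' := o') rfl hlm hl]
    simp only [refl, map_mul, groupOp_perm, groupOp_diag, LinearMap.sum_apply,
      Module.End.mul_apply, LinearMap.mulLeft_apply, Finset.sum_mul, LinearMap.neg_apply,
      LinearMap.smul_apply, neg_mul, ← Algebra.smul_def, smul_mul_assoc]
  -- Double transitivity of S_n reduces all pairs of distinct indices to the first and the last.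
  obtain ⟨w, hi, hj⟩ := exists_perm_pair (o := first D) (o' := last D)
    (fun e => by rw [← e, first_val] at hl; omega) h
  have key := congrArg (fun t => permOp D w * t * permOp D w⁻¹) base
  simp only [mul_sub, sub_mul, permOp_conj_mul, permOp_xOp, permOp_yOp, hi, hj] at key
  refine key.trans (LinearMap.ext fun f => ?_)
  simp only [Module.End.mul_apply, LinearMap.neg_apply, LinearMap.smul_apply, LinearMap.sum_apply,
    map_neg, map_smul, map_sum]
  congr 3
  funext z
  rw [← groupOp_perm, ← groupOp_perm, ← Module.End.mul_apply, ← Module.End.mul_apply, ← map_mul,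
    ← map_mul, perm_mul_refl, hi, hj, mul_assoc, ← map_mul, mul_inv_cancel, map_one, mul_one]

end

/-! ### Compatibility with `A`, and the representation over the function field -/

section

variable {D : Datum}

theorem ratT_mul_permOp (w : Equiv.Perm (Fin D.n)) (a : diagonalGroup D) :
    mulOp D (ratT D a) * permOp D w = permOp D w * mulOp D (ratT D (permA D w⁻¹ a)) := by
  rw [permOp_mul_ratT, ← permA_mul, mul_inv_cancel, permA_one]

/-- Conjugation by (1, i) moves the entry of a at i to the first place, so the eigenvalue rule for
the first member of a family gives the one for all members. -/
theorem ratT_mul_family {z : Module.End ℂ (RatRep D)} {χ : Mu D → ℂ}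
    (hz : ∀ a : diagonalGroup D,
      mulOp D (ratT D a) * z = χ (a.1 (first D)) • (z * mulOp D (ratT D a)))
    (a : diagonalGroup D) (i : Fin D.n) :
    mulOp D (ratT D a) * family (permOp D) (first D) z i
      = χ (a.1 i) • (family (permOp D) (first D) z i * mulOp D (ratT D a)) := by
  have e : (permA D (Equiv.swap (first D) i)⁻¹ a).1 (first D) = a.1 i := by
    show a.1 ((Equiv.swap (first D) i)⁻¹⁻¹ (first D)) = a.1 i
    rw [inv_inv, Equiv.swap_apply_left]
  rw [family, ← mul_assoc, ← mul_assoc, ratT_mul_permOp, mul_assoc _ _ z, hz, e, mul_smul_comm,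
    smul_mul_assoc, mul_assoc _ _ (mulOp D (ratT D a)), permOp_mul_ratT]
  simp only [mul_assoc, Equiv.swap_inv]

theorem ratT_mul_xOp (a : diagonalGroup D) (i : Fin D.n) :
    mulOp D (ratT D a) * xOp D i = toC D (a.1 i) • (xOp D i * mulOp D (ratT D a)) := by
  refine ratT_mul_family (χ := toC D) (fun a => ?_) a i
  have h : sigmaOp D * mulOp D (ratT D (permA D (finRotate D.n)⁻¹ a))
      = (toC D (a.1 (first D)))⁻¹ • (mulOp D (ratT D a) * sigmaOp D) := by
    refine LinearMap.ext fun f => ?_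
    simp only [Module.End.mul_apply, LinearMap.smul_apply, LinearMap.mulLeft_apply, sigmaOp_apply,
      map_mul]
    rw [rotUp, ratAut_ratT, ← permA_mul, mul_inv_cancel, permA_one, latticeChar_single,
      toC_zpow, zpow_neg, zpow_one, Algebra.smul_def]
    ring
  rw [← mul_assoc, mul_assoc _ _ (mulOp D (ratT D a)), permOp_mul_ratT, ← mul_assoc (sigmaOp D), h,
    smul_mul_assoc, smul_smul, mul_inv_cancel₀ (toC_ne_zero D _), one_smul]

theorem ratT_mul_yOp (a : diagonalGroup D) (i : Fin D.n) :
    mulOp D (ratT D a) * yOp D i = (toC D (a.1 i))⁻¹ • (yOp D i * mulOp D (ratT D a)) := by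
  refine ratT_mul_family (χ := fun z => (toC D z)⁻¹) (fun a => ?_) a i
  have e : (permA D (finRotate D.n)⁻¹ a).1 (last D) = a.1 (first D) := by
    show a.1 ((finRotate D.n)⁻¹⁻¹ (last D)) = a.1 (first D)
    rw [inv_inv, finRotate_last_first]
  have h : tauOp D * mulOp D (ratT D a)
      = toC D (a.1 (first D)) • (mulOp D (ratT D (permA D (finRotate D.n)⁻¹ a)) * tauOp D) := by
    refine LinearMap.ext fun f => ?_
    simp only [Module.End.mul_apply, LinearMap.smul_apply, LinearMap.mulLeft_apply, tauOp_apply,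
      map_mul]
    rw [rotDown, ratAut_ratT, latticeChar_single, e, neg_neg, zpow_one, Algebra.smul_def]
    ring
  rw [mul_assoc _ (tauOp D), h, mul_smul_comm, smul_smul, inv_mul_cancel₀ (toC_ne_zero D _),
    one_smul, ← mul_assoc, ← mul_assoc, ratT_mul_permOp]

theorem groupOp_eq (w : reflectionGroup D) :
    groupOp D w = mulOp D (ratT D (diagPart D w)) * permOp D w.1.right := rfl

variable (D)

/-- The operators of the generators of `H_p`. -/
def genOp : Gen D → Module.End ℂ (RatRep D)
  | .g w => groupOp D w
  | .x i => xOp D i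
  | .y i => yOp D i

theorem lift_fPoly (i : Fin D.n) (u : ℂ) :
    FreeAlgebra.lift ℂ (genOp D) (fPoly D i u) = mulOp D (ratPoly D i u) := by
  refine LinearMap.ext fun f => ?_
  simp only [fPoly, map_sum, map_smul, FreeAlgebra.lift_ι_apply, genOp, groupOp_diag,
    LinearMap.sum_apply, LinearMap.smul_apply, LinearMap.mulLeft_apply, ratPoly, Finset.sum_mul,
    ← Algebra.smul_def, smul_mul_assoc]

theorem genOp_rel {a b : FreeAlgebra ℂ (Gen D)} (h : Rel D a b) :
    FreeAlgebra.lift ℂ (genOp D) a = FreeAlgebra.lift ℂ (genOp D) b := by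
  induction h with
  | one => simp [genOp]
  | mul v w => simp [genOp]
  | gx w i =>
    simp only [map_mul, map_smul, FreeAlgebra.lift_ι_apply, genOp]
    rw [groupOp_eq, mul_assoc, permOp_mul_xOp, ← mul_assoc, ratT_mul_xOp, smul_mul_assoc,
      mul_assoc]
    rfl
  | gy w i =>
    simp only [map_mul, map_smul, FreeAlgebra.lift_ι_apply, genOp]
    rw [groupOp_eq, mul_assoc, permOp_mul_yOp, ← mul_assoc, ratT_mul_yOp, smul_mul_assoc,
      mul_assoc]
    rfl
  | xx i j => simpa [genOp] using xOp_comm i j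
  | yy i j => simpa [genOp] using yOp_comm i j
  | xy_same i =>
    have := xOp_yOp_same i
    simp only [map_sub, map_add, map_mul, map_smul, map_sum, lift_fPoly,
      FreeAlgebra.lift_ι_apply, genOp, this, reflSum, Algebra.algebraMap_eq_smul_one, map_one]
  | xy_ne i j hij =>
    have := xOp_yOp_ne hij
    simp only [map_sub, map_neg, map_mul, map_smul, map_sum,
      FreeAlgebra.lift_ι_apply, genOp, this]

/-- The representation of `H_p` over `ℂ(U_1, …, U_n)`. -/
def ratRho : H D →ₐ[ℂ] Module.End ℂ (RatRep D) :=
  RingQuot.liftAlgHom ℂ ⟨FreeAlgebra.lift ℂ (genOp D), fun _ _ h => genOp_rel D h⟩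

variable {D}

theorem ratRho_mk (a : FreeAlgebra ℂ (Gen D)) :
    ratRho D (RingQuot.mkAlgHom ℂ (Rel D) a) = FreeAlgebra.lift ℂ (genOp D) a :=
  RingQuot.liftAlgHom_mkAlgHom_apply ..

theorem ratRho_hg (w : reflectionGroup D) : ratRho D (hg D w) = groupOp D w := by
  rw [hg, ratRho_mk, FreeAlgebra.lift_ι_apply]; rfl

theorem ratRho_hx (i : Fin D.n) : ratRho D (hx D i) = xOp D i := by
  rw [hx, ratRho_mk, FreeAlgebra.lift_ι_apply]; rfl

theorem ratRho_hy (i : Fin D.n) : ratRho D (hy D i) = yOp D i := by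
  rw [hy, ratRho_mk, FreeAlgebra.lift_ι_apply]; rfl

theorem ratRho_hu (i : Fin D.n) : ratRho D (hu D i) = mulOp D (ratU D i) := by
  simp only [hu, map_sub, map_add, map_mul, map_smul, map_sum, ratRho_hx, ratRho_hy, ratRho_hg,
    ratRho_mk, lift_fPoly, Algebra.algebraMap_eq_smul_one, map_one]
  rw [xOp_mul_yOp]
  simp only [reflSum]
  abel

theorem ratRho_hsigma : ratRho D (hsigma D) = sigmaOp D := by
  rw [hsigma, map_mul, ratRho_hx, ratRho_hg, groupOp_perm, xOp_first, mul_assoc, map_inv_mul_map,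
    mul_one]

theorem ratRho_htau : ratRho D (htau D) = tauOp D := by
  have e : (finRotate D.n)⁻¹ (first D) = last D := by
    rw [Equiv.Perm.inv_eq_iff_eq, finRotate_last_first]
  rw [htau, map_mul, ratRho_hy, ratRho_hg, groupOp_perm, ← e, ← permOp_yOp, yOp_first, inv_inv,
    mul_assoc, map_mul_map_inv, mul_one, ← mul_assoc, map_inv_mul_map, one_mul]

/-- Induction on the elements of `H_p`. -/
theorem H_induction {p : H D → Prop} (scalar : ∀ c : ℂ, p (algebraMap ℂ _ c))
    (g : ∀ w, p (hg D w)) (x : ∀ i, p (hx D i)) (y : ∀ i, p (hy D i))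
    (add : ∀ a b, p a → p b → p (a + b)) (mul : ∀ a b, p a → p b → p (a * b)) (h : H D) : p h := by
  obtain ⟨a, rfl⟩ := RingQuot.mkAlgHom_surjective ℂ (Rel D) h
  induction a using FreeAlgebra.induction with
  | grade0 c => rw [AlgHom.commutes]; exact scalar c
  | grade1 s =>
    cases s with
    | g w => exact g w
    | x i => exact x i
    | y i => exact y i
  | mul a b ha hb => rw [map_mul]; exact mul _ _ ha hb
  | add a b ha hb => rw [map_add]; exact add _ _ ha hb

/-- A property that holds for scalars, for `A`, for the adjacent transpositions, for `σ` and for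
`τ`, and is preserved by sums and products, holds for all elements of `H_p`. -/
theorem H_induction' {p : Module.End ℂ (RatRep D) → Prop}
    (scalar : ∀ c : ℂ, p (algebraMap ℂ _ c))
    (t : ∀ a, p (mulOp D (ratT D a)))
    (s : ∀ i j : Fin D.n, (j : ℕ) = i + 1 → p (demazure D i j)) (sigma : p (sigmaOp D))
    (tau : p (tauOp D))
    (add : ∀ a b, p a → p b → p (a + b)) (mul : ∀ a b, p a → p b → p (a * b)) (h : H D) :
    p (ratRho D h) := by
  have perm : ∀ w, p (permOp D w) := perm_adjacent_induction (p := fun w => p (permOp D w))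
    (by rw [map_one, ← map_one (algebraMap ℂ _)]; exact scalar 1)
    (fun i j hij => by rw [permOp_swap hij]; exact s i j hij)
    (fun v w hv hw => by rw [map_mul]; exact mul _ _ hv hw)
  induction h using H_induction with
  | scalar c => rw [AlgHom.commutes]; exact scalar c
  | g w => rw [ratRho_hg]; exact mul _ _ (t _) (perm _)
  | x i =>
    rw [ratRho_hx]
    exact mul _ _ (mul _ _ (perm _) (mul _ _ sigma (perm _))) (perm _)
  | y i =>
    rw [ratRho_hy]
    exact mul _ _ (mul _ _ (perm _) (mul _ _ (perm _) tau)) (perm _)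
  | add a b ha hb => rw [map_add]; exact add _ _ ha hb
  | mul a b ha hb => rw [map_mul]; exact mul _ _ ha hb

end

section

variable (D : Datum)

/-! ### The polynomial representation -/

/-- The inclusion of the polynomial representation into its version over `ℂ(U_1, …, U_n)`. -/
def toRat : PolyRep D →ₐ[ℂ] RatRep D :=
  (MonoidAlgebra.mapAlgHom (diagonalGroup D) (IsScalarTower.toAlgHom ℂ (PolyU D) (FieldU D)) :
    PolyRep D →ₐ[ℂ] MonoidAlgebra (FieldU D) (diagonalGroup D))

variable {D}

theorem toRat_single (a : diagonalGroup D) (q : PolyU D) :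
    toRat D (MonoidAlgebra.single a q) = ofField D (algebraMap _ _ q) * ratT D a := by
  rw [← single_eq_ofField_mul_ratT]
  exact MonoidAlgebra.map_single _ _ _

theorem toRat_injective : Function.Injective (toRat D) := by
  rw [injective_iff_map_eq_zero]
  intro f hf
  ext a
  have h : (MonoidAlgebra.coeff (show MonoidAlgebra (FieldU D) (diagonalGroup D) from toRat D f)) a
      = algebraMap (PolyU D) (FieldU D) (f.coeff a) :=
    MonoidAlgebra.coeff_mapRingHom _ _ _
  rw [hf] at h
  have h' : algebraMap (PolyU D) (FieldU D) (f.coeff a) = 0 := h.symm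
  rw [FaithfulSMul.algebraMap_eq_zero_iff] at h'
  rw [h']; rfl

theorem toRat_inU (q : PolyU D) : toRat D (inU D q) = ofField D (algebraMap _ _ q) := by
  have := toRat_single 1 q
  rwa [map_one, mul_one] at this

theorem toRat_monT (a : diagonalGroup D) : toRat D (monT D a) = ratT D a := by
  have := toRat_single a 1
  rwa [map_one, map_one, one_mul] at this

theorem toRat_inU_C (c : ℂ) : toRat D (inU D (C c)) = algebraMap ℂ _ c := toRat_inU _

theorem toRat_piT (i j : Fin D.n) : toRat D (piT D i j) = ratPi D i j := by
  simp only [piT, map_mul, map_sum, toRat_monT, ratPi]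
  rw [toRat_inU_C]

theorem toRat_polyT (i : Fin D.n) (u : ℂ) : toRat D (polyT D i u) = ratPoly D i u := by
  simp only [polyT, map_sum, map_mul (toRat D), toRat_monT, ratPoly, toRat_inU_C]

/-- The concrete substitutions of the statement are restrictions of lattice operators; it is enough
to compare variables and characters. -/
theorem toRat_subst {u : Fin D.n → PolyU D} {χ : diagonalGroup D →* ℂ} {v : Fin D.n → ℤ}
    {w : Equiv.Perm (Fin D.n)} (hu : ∀ i, u i = latticeAut D v w (X i))
    (hχ : ∀ a, χ a = latticeChar D v (permA D w a)) (f : PolyRep D) :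
    toRat D (subst D u (twistT D w χ) f) = ratAut D v w (toRat D f) := by
  induction f using MonoidAlgebra.induction_linear with
  | zero => simp only [map_zero]
  | add f g hf hg => simp only [map_add, hf, hg]
  | single a q =>
    have e : aeval u q = latticeAut D v w q := by
      have : aeval u = (latticeAut D v w : PolyU D →ₐ[ℂ] PolyU D) := by
        ext1 i; simpa using hu i
      rw [this]; rfl
    have h : subst D u (twistT D w χ) (MonoidAlgebra.single a q)
        = inU D (aeval u q) * (inU D (C (χ a)) * monT D (permA D w a)) := by
      rw [subst]
      erw [MonoidAlgebra.liftNC_single]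
      rfl
    rw [h, map_mul, map_mul, toRat_inU, toRat_inU_C, toRat_monT, toRat_single, map_mul,
      ratAut_ofField, ratAut_ratT, fieldAut_algebraMap, e, hχ]

theorem toRat_exchange (i j : Fin D.n) (f : PolyRep D) :
    toRat D (exchange D i j f) = ratAut D 0 (Equiv.swap i j) (toRat D f) :=
  toRat_subst (fun m => by simp [latticeAut_X]) (fun a => by rw [latticeChar_zero]; rfl) f

theorem toRat_shiftUp (f : PolyRep D) : toRat D (shiftUp D f) = rotUp D (toRat D f) := by
  refine toRat_subst (fun m => ?_) (fun a => ?_) f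
  · rw [latticeAut_X, Pi.single_apply]
    simp only [finRotate_eq_first_iff]
    split_ifs <;> simp
  · have e : (finRotate D.n)⁻¹ (first D) = last D := by
      rw [Equiv.Perm.inv_eq_iff_eq, finRotate_last_first]
    rw [latticeChar_single, zpow_neg, zpow_one, toC_inv]
    show _ = (toC D (a.1 ((finRotate D.n)⁻¹ (first D))))⁻¹
    rw [e]; rfl

theorem toRat_shiftDown (f : PolyRep D) : toRat D (shiftDown D f) = rotDown D (toRat D f) := by
  refine toRat_subst (fun m => ?_) (fun a => ?_) f
  · rw [latticeAut_X, Pi.single_apply]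
    simp only [Equiv.Perm.inv_eq_iff_eq, finRotate_last_first]
    split_ifs <;> simp [sub_eq_add_neg]
  · rw [latticeChar_single, neg_neg, zpow_one]
    show _ = toC D (a.1 ((finRotate D.n)⁻¹⁻¹ (last D)))
    rw [inv_inv, finRotate_last_first]; rfl

/-- The swap is the identity modulo U_j - U_i on each variable, and the twisted Leibniz rule extends
this to products. -/
theorem diff_dvd_swap_sub (i j : Fin D.n) (q : PolyU D) :
    (X j - X i) ∣ latticeAut D 0 (Equiv.swap i j) q - q := by
  induction q using MvPolynomial.induction_on with
  | C c =>
    rw [← algebraMap_eq, AlgEquiv.commutes, sub_self]; exact dvd_zero _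
  | add p q hp hq =>
    rw [map_add, add_sub_add_comm]; exact dvd_add hp hq
  | mul_X p m hp =>
    have h : (X j - X i : PolyU D) ∣ latticeAut D 0 (Equiv.swap i j) (X m) - X m := by
      rw [latticeAut_X]
      by_cases hi : m = i
      · subst hi; simp
      by_cases hj : m = j
      · subst hj
        exact ⟨-1, by simp⟩
      · simp [Equiv.swap_apply_of_ne_of_ne hi hj]
    have e : latticeAut D 0 (Equiv.swap i j) (p * X m) - p * X m
        = (latticeAut D 0 (Equiv.swap i j) p - p) * latticeAut D 0 (Equiv.swap i j) (X m)
          + p * (latticeAut D 0 (Equiv.swap i j) (X m) - X m) := by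
      rw [map_mul]; ring
    rw [e]
    exact dvd_add (hp.mul_right _) (h.mul_left _)

theorem rMat_mul_fieldDiff {i j : Fin D.n} (h : i ≠ j) :
    rMat D i j * ofField D (fieldDiff D i j) = algebraMap ℂ _ (D.k * D.ℓ) * ratPi D i j := by
  have e2 : ofField D (algebraMap ℂ _ (D.k * D.ℓ) * (fieldDiff D i j)⁻¹)
      * ofField D (fieldDiff D i j) = algebraMap ℂ _ (D.k * D.ℓ) := by
    rw [← map_mul, inv_mul_cancel_right₀ (fieldDiff_ne h)]; rfl
  rw [rMat, mul_right_comm, e2]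

theorem exists_demazure {i j : Fin D.n} (hij : i ≠ j) (f : PolyRep D) :
    ∃ g, toRat D g = demazure D i j (toRat D f) := by
  induction f using MonoidAlgebra.induction_linear with
  | zero => exact ⟨0, by simp only [map_zero]⟩
  | add f g hf hg =>
    obtain ⟨f', hf'⟩ := hf
    obtain ⟨g', hg'⟩ := hg
    exact ⟨f' + g', by simp only [map_add, hf', hg']⟩
  | single a q =>
    obtain ⟨r, hr⟩ := diff_dvd_swap_sub i j q
    -- With r the divided difference of q, the correction term is polynomial: π_{ij} absorbs the
    -- swap of T^a, so only q is divided.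
    refine ⟨exchange D i j (MonoidAlgebra.single a q)
      + inU D (C (D.k * D.ℓ)) * piT D i j * MonoidAlgebra.single a r, ?_⟩
    rw [map_add, toRat_exchange, demazure_apply, map_mul, map_mul, toRat_inU_C, toRat_piT,
      toRat_single, toRat_single, map_mul, ratAut_ofField, ratAut_perm_ratT, fieldAut_algebraMap,
      ← rMat_mul_fieldDiff hij]
    have h1 : ofField D (algebraMap _ _ (latticeAut D 0 (Equiv.swap i j) q))
        - ofField D (algebraMap _ _ q) = ofField D (fieldDiff D i j) * ofField D (algebraMap _ _ r) := by
      rw [← map_sub, ← map_sub, hr, map_mul, map_mul]; rfl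
    linear_combination -(rMat D i j * ratT D a) * h1
      - ofField D (algebraMap _ _ (latticeAut D 0 (Equiv.swap i j) q)) * rMat_mul_permA i j a

theorem exists_ratRho (h : H D) : ∀ f : PolyRep D, ∃ g, toRat D g = ratRho D h (toRat D f) := by
  refine H_induction' (p := fun Φ => ∀ f : PolyRep D, ∃ g, toRat D g = Φ (toRat D f))
    ?_ ?_ ?_ ?_ ?_ ?_ ?_ h
  · intro c f
    exact ⟨c • f, by rw [map_smul, Module.algebraMap_end_apply]⟩
  · intro a f
    exact ⟨monT D a * f, by rw [map_mul, toRat_monT]; rfl⟩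
  · intro i j hij f
    exact exists_demazure (by rintro rfl; omega) f
  · intro f
    refine ⟨(inU D (X (first D)) - polyT D (first D) (toC D D.ζ)⁻¹ + inU D (C D.hbar))
      * shiftUp D f, ?_⟩
    rw [map_mul, map_add, map_sub, toRat_inU, toRat_inU_C, toRat_polyT, toRat_shiftUp]
    rfl
  · intro f
    exact ⟨shiftDown D f, toRat_shiftDown f⟩
  · intro a b ha hb f
    obtain ⟨f', hf'⟩ := ha f
    obtain ⟨g', hg'⟩ := hb f
    exact ⟨f' + g', by rw [map_add, hf', hg']; rfl⟩
  · intro a b ha hb f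
    obtain ⟨f', hf'⟩ := hb f
    obtain ⟨g', hg'⟩ := ha f'
    exact ⟨g', by rw [hg', hf']; rfl⟩

variable (D)

/-- The polynomial representation of `H_p`. -/
def polyRho : H D →ₐ[ℂ] Module.End ℂ (PolyRep D) := by
  -- Restricting the operators to polynomials gives a representation because `toRat` is injective:
  -- each identity may be checked after inclusion.
  choose F hF using exists_ratRho (D := D)
  exact
    { toFun := fun h =>
        { toFun := F h
          map_add' := fun f g => toRat_injective (by simp only [hF, map_add])
          map_smul' := fun c f => toRat_injective (by
            simp only [hF, map_smul, RingHom.id_apply]) }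
      map_one' := LinearMap.ext fun f => toRat_injective ((hF 1 f).trans (by rw [map_one]; rfl))
      map_mul' := fun a b => LinearMap.ext fun f => toRat_injective
        ((hF _ f).trans (by
          rw [map_mul, Module.End.mul_apply, Module.End.mul_apply]
          exact ((hF a _).trans (by rw [← hF b f]; rfl)).symm))
      map_zero' := LinearMap.ext fun f => toRat_injective ((hF 0 f).trans (by
        rw [map_zero, LinearMap.zero_apply, LinearMap.zero_apply, map_zero]))
      map_add' := fun a b => LinearMap.ext fun f => toRat_injective ((hF _ f).trans (by
        rw [map_add, LinearMap.add_apply, LinearMap.add_apply, map_add]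
        exact congrArg₂ _ (hF a f).symm (hF b f).symm))
      commutes' := fun c => LinearMap.ext fun f => toRat_injective ((hF _ f).trans (by
        rw [AlgHom.commutes, Module.algebraMap_end_apply, Module.algebraMap_end_apply, map_smul])) }

variable {D}

theorem toRat_polyRho (h : H D) (f : PolyRep D) :
    toRat D (polyRho D h f) = ratRho D h (toRat D f) :=
  Classical.choose_spec (exists_ratRho h f)

theorem isPolynomialRep : IsPolynomialRep D (polyRho D) where
  u i f := toRat_injective (by
    rw [toRat_polyRho, ratRho_hu, map_mul, toRat_inU]; rfl)
  t a f := toRat_injective (by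
    rw [toRat_polyRho, ratRho_hg, groupOp_diag, map_mul, toRat_monT]; rfl)
  s i j hij f := toRat_injective (by
    have hne : i ≠ j := by rintro rfl; omega
    rw [map_mul, map_add, map_mul, map_mul, map_mul, toRat_polyRho, toRat_inU_C, toRat_piT,
      map_sub (toRat D), toRat_exchange, toRat_inU, ratRho_hg, groupOp_perm, permOp_swap hij,
      demazure_apply]
    have e := rMat_mul_fieldDiff hne
    rw [fieldDiff] at e
    linear_combination (ratAut D 0 (Equiv.swap i j) (toRat D f) - toRat D f) * e)
  sigma f := toRat_injective (by
    rw [toRat_polyRho, ratRho_hsigma, map_mul, map_add, map_sub, toRat_inU, toRat_inU_C,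
      toRat_polyT, toRat_shiftUp]
    rfl)
  tau f := toRat_injective (by
    rw [toRat_polyRho, ratRho_htau, toRat_shiftDown]; rfl)

end

section

/-! ### Principal Galois orders -/

section GaloisCriterion

variable {Γ K M : Type*} [CommRing Γ] [Field K] [Algebra Γ K] [Group M] [MulSemiringAction M K]

theorem coef_eq (a : K) : (coef a : SkewMonoidAlgebra K M) = SkewMonoidAlgebra.single 1 a := rfl

theorem coef_add (a b : K) : (coef (a + b) : SkewMonoidAlgebra K M) = coef a + coef b :=
  SkewMonoidAlgebra.single_add _ _ _

theorem coef_mul_single (a b : K) (w : M) :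
    coef a * SkewMonoidAlgebra.single w b = SkewMonoidAlgebra.single w (a * b) := by
  rw [coef_eq, SkewMonoidAlgebra.single_mul_single, one_mul, one_smul]

theorem single_mul_coef (a b : K) (w : M) :
    SkewMonoidAlgebra.single w b * coef a = SkewMonoidAlgebra.single w (b * w • a) := by
  rw [coef_eq, SkewMonoidAlgebra.single_mul_single, mul_one]

theorem coef_mul (a b : K) : (coef (a * b) : SkewMonoidAlgebra K M) = coef a * coef b :=
  (coef_mul_single a b 1).symm

theorem evalAt_single (w : M) (a f : K) :
    evalAt (SkewMonoidAlgebra.single w a) f = a * w • f :=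
  SkewMonoidAlgebra.sum_single_index (zero_mul _)

theorem evalAt_zero (f : K) : evalAt (0 : SkewMonoidAlgebra K M) f = 0 :=
  SkewMonoidAlgebra.sum_zero_index

theorem evalAt_add (X Y : SkewMonoidAlgebra K M) (f : K) :
    evalAt (X + Y) f = evalAt X f + evalAt Y f :=
  SkewMonoidAlgebra.sum_add_index' (fun _ => zero_mul _) fun _ _ _ => add_mul _ _ _

theorem evalAt_neg (X : SkewMonoidAlgebra K M) (f : K) : evalAt (-X) f = -evalAt X f := by
  have h := evalAt_add X (-X) f
  rw [add_neg_cancel, evalAt_zero] at h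
  exact (neg_eq_of_add_eq_zero_right h.symm).symm

theorem evalAt_apply_add (X : SkewMonoidAlgebra K M) (f g : K) :
    evalAt X (f + g) = evalAt X f + evalAt X g := by
  simp only [evalAt, smul_add, mul_add, SkewMonoidAlgebra.sum_add]

omit [Group M] [MulSemiringAction M K] in
theorem skew_induction {p : SkewMonoidAlgebra K M → Prop} (zero : p 0)
    (add : ∀ X Y, p X → p Y → p (X + Y)) (single : ∀ w a, p (SkewMonoidAlgebra.single w a))
    (X : SkewMonoidAlgebra K M) : p X :=
  SkewMonoidAlgebra.induction_on X zero single (fun X Y => add X Y)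

theorem evalAt_mul (X Y : SkewMonoidAlgebra K M) (f : K) :
    evalAt (X * Y) f = evalAt X (evalAt Y f) := by
  induction X using skew_induction with
  | zero => rw [zero_mul, evalAt_zero, evalAt_zero]
  | add X X' hX hX' => rw [add_mul, evalAt_add, hX, hX', evalAt_add]
  | single w a =>
    induction Y using skew_induction with
    | zero => rw [mul_zero, evalAt_zero, evalAt_single, smul_zero, mul_zero]
    | add Y Y' hY hY' => rw [mul_add, evalAt_add, hY, hY', evalAt_add, evalAt_apply_add]
    | single v b =>
      rw [SkewMonoidAlgebra.single_mul_single, evalAt_single, evalAt_single, evalAt_single,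
        smul_mul', smul_smul, mul_assoc]

theorem evalAt_eq_sum (X : SkewMonoidAlgebra K M) {S : Finset M} (hS : X.support ⊆ S) (f : K) :
    evalAt X f = ∑ w ∈ S, X.coeff w * w • f := by
  show X.sum _ = _
  rw [SkewMonoidAlgebra.sum_def]
  exact Finsupp.sum_of_support_subset _ hS _ fun _ _ => zero_mul _

variable [IsFractionRing Γ K] [FaithfulSMul M K]

/-- Distinct elements of `M` are linearly independent as functions on `Γ`. -/
theorem linearIndependent_smul_algebraMap :
    LinearIndependent K (fun (w : M) (γ : Γ) => w • algebraMap Γ K γ) := by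
  let χ : M → (Γ →* K) := fun w =>
    ((MulSemiringAction.toRingHom M K w).comp (algebraMap Γ K) : Γ →+* K)
  have hχ : Function.Injective χ := by
    -- Agreement on Γ extends to all fractions, and the action on K is faithful; Dedekind's
    -- independence of characters then applies.
    intro v w h
    refine eq_of_smul_eq_smul (α := K) fun x => ?_
    obtain ⟨a, b, _, rfl⟩ := IsFractionRing.div_surjective Γ x
    have e : ∀ γ : Γ, v • algebraMap Γ K γ = w • algebraMap Γ K γ := DFunLike.congr_fun h
    rw [smul_div₀', smul_div₀', e, e]
  exact (linearIndependent_monoidHom Γ K).comp χ hχ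

variable (Γ) in
-- A skew element is determined by its values on Γ. Identities in the skew group ring can therefore
-- be checked on values.
theorem eq_zero_of_evalAt {X : SkewMonoidAlgebra K M}
    (h : ∀ γ : Γ, evalAt X (algebraMap Γ K γ) = 0) : X = 0 := by
  have h1 := linearIndependent_iff'.1
    (linearIndependent_smul_algebraMap (Γ := Γ) (K := K) (M := M)) X.support (fun w => X.coeff w) (by
      funext γ
      rw [Finset.sum_apply]
      exact (evalAt_eq_sum X subset_rfl _).symm.trans (h γ))
  refine SkewMonoidAlgebra.ext fun w => ?_
  by_cases hw : w ∈ X.support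
  · exact h1 w hw
  · exact SkewMonoidAlgebra.notMem_support_iff.1 hw

/-- Elements that preserve `Γ` and have support in a given finite set have bounded denominators. -/
theorem exists_denominator [IsDomain Γ] (S : Finset M) (w : M) :
    ∃ d : Γ, d ≠ 0 ∧ ∀ X : SkewMonoidAlgebra K M, X.support ⊆ S →
      (∀ γ : Γ, ∃ γ', evalAt X (algebraMap Γ K γ) = algebraMap Γ K γ') →
      ∃ γ', algebraMap Γ K d * X.coeff w = algebraMap Γ K γ' := by
  by_cases hw : w ∈ S
  swap
  · refine ⟨1, one_ne_zero, fun X hX _ => ⟨0, ?_⟩⟩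
    rw [SkewMonoidAlgebra.notMem_support_iff.1 fun h => hw (hX h), mul_zero, map_zero]
  -- Coefficient vectors supported in S are points of K^S, and evaluation at γ is a linear
  -- functional on them.
  let ev : Γ → Module.Dual K (S → K) := fun γ =>
    ∑ v : S, (v.1 • algebraMap Γ K γ) • LinearMap.proj v
  have hev : ∀ γ f, ev γ f = ∑ v : S, f v * v.1 • algebraMap Γ K γ := by
    intro γ f
    simp only [ev, LinearMap.sum_apply, LinearMap.smul_apply, LinearMap.proj_apply, smul_eq_mul,
      mul_comm]
  -- By independence no nonzero vector is killed by all evaluations, so in finite dimension they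
  -- span the dual. Each coefficient is then a combination of finitely many values, with weights
  -- independent of X.
  have hspan : Submodule.span K (Set.range ev) = ⊤ := by
    have h0 : (Submodule.span K (Set.range ev)).dualCoannihilator = ⊥ := by
      rw [eq_bot_iff]
      intro f hf
      rw [Submodule.mem_dualCoannihilator] at hf
      have h1 := linearIndependent_iff'.1
        ((linearIndependent_smul_algebraMap (Γ := Γ) (K := K) (M := M)).comp
          (fun v : S => v.1) Subtype.val_injective) Finset.univ f (by
        funext γ
        rw [Finset.sum_apply]
        exact (hev γ f).symm.trans (hf _ (Submodule.subset_span ⟨γ, rfl⟩)))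
      exact funext fun v => h1 v (Finset.mem_univ v)
    rw [← Subspace.dualCoannihilator_dualAnnihilator_eq (W := Submodule.span K (Set.range ev)), h0,
      Submodule.dualAnnihilator_bot]
  have hmem : (LinearMap.proj ⟨w, hw⟩ : Module.Dual K (S → K)) ∈ Submodule.span K (Set.range ev) :=
    hspan ▸ Submodule.mem_top
  obtain ⟨c, hc⟩ := Finsupp.mem_span_range_iff_exists_finsupp.1 hmem
  -- d is a common denominator of these weights; the values themselves lie in Γ.
  obtain ⟨d, hd⟩ := IsLocalization.exist_integer_multiples (nonZeroDivisors Γ) c.support c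
  refine ⟨d, nonZeroDivisors.ne_zero d.2, fun X hX hΓ => ?_⟩
  choose g hg using hΓ
  choose e he using hd
  have h1 : ∀ γ, ev γ (fun v => X.coeff v.1) = algebraMap Γ K (g γ) := by
    intro γ
    rw [hev, ← hg, evalAt_eq_sum X hX]
    exact Finset.sum_coe_sort S fun v => X.coeff v * v • algebraMap Γ K γ
  have h2 : X.coeff w = ∑ γ ∈ c.support, c γ * algebraMap Γ K (g γ) := by
    have := LinearMap.congr_fun hc (fun v => X.coeff v.1)
    simp only [Finsupp.sum, LinearMap.sum_apply, LinearMap.smul_apply, h1, smul_eq_mul,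
      LinearMap.proj_apply] at this
    exact this.symm
  refine ⟨∑ γ ∈ c.support.attach, e γ.1 γ.2 * g γ.1, ?_⟩
  rw [h2, map_sum, Finset.mul_sum, ← Finset.sum_attach]
  refine Finset.sum_congr rfl fun γ _ => ?_
  rw [map_mul, he, Algebra.smul_def, mul_assoc]

omit [Field K] [Algebra Γ K] [Group M] [MulSemiringAction M K] [IsFractionRing Γ K]
  [FaithfulSMul M K] in
-- The Noetherian argument in a form that serves both sides: Φ is only additive, and the left or
-- right action of Γ enters through the hypothesis `smul`. N is pulled back to a submodule of a free
-- module of finite rank.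
theorem exists_generators [IsNoetherianRing Γ] {ι Z : Type*} [Finite ι] [AddCommGroup Z]
    (Φ : (ι → Γ) →+ Z) {N : Set Z} (zero : 0 ∈ N) (add : ∀ a ∈ N, ∀ b ∈ N, a + b ∈ N)
    (smul : ∀ (γ : Γ) (g : ι → Γ), Φ g ∈ N → Φ (γ • g) ∈ N) (range : ∀ z ∈ N, ∃ g, Φ g = z) :
    ∃ (m : ℕ) (v : Fin m → ι → Γ), N = {z | ∃ a : Fin m → Γ, z = ∑ j, Φ (a j • v j)} := by
  let N' : Submodule Γ (ι → Γ) :=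
    { carrier := {g | Φ g ∈ N}
      zero_mem' := by simpa using zero
      add_mem' := fun {a b} ha hb => by
        simpa using add _ ha _ hb
      smul_mem' := fun γ g hg => smul γ g hg }
  obtain ⟨m, v, hv⟩ := Submodule.fg_iff_exists_fin_generating_family.1 (IsNoetherian.noetherian N')
  refine ⟨m, v, Set.ext fun z => ⟨fun hz => ?_, ?_⟩⟩
  · obtain ⟨g, rfl⟩ := range z hz
    have hg : g ∈ Submodule.span Γ (Set.range v) := hv ▸ (show g ∈ N' from hz)
    obtain ⟨a, rfl⟩ := (Submodule.mem_span_range_iff_exists_fun Γ).1 hg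
    exact ⟨a, map_sum _ _ _⟩
  · rintro ⟨a, rfl⟩
    rw [← map_sum]
    show ∑ j, a j • v j ∈ N'
    rw [← hv]
    exact (Submodule.mem_span_range_iff_exists_fun Γ).2 ⟨a, rfl⟩

omit [IsFractionRing Γ K] [FaithfulSMul M K] [Algebra Γ K] [CommRing Γ] in
theorem support_mul_coef (X : SkewMonoidAlgebra K M) (a : K) : (X * coef a).support ⊆ X.support := by
  intro w hw
  rw [SkewMonoidAlgebra.mem_support_iff] at hw ⊢
  intro h
  apply hw
  rw [coef_eq, SkewMonoidAlgebra.coeff_mul_single_one, h, zero_mul]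

omit [IsFractionRing Γ K] [FaithfulSMul M K] [Algebra Γ K] [CommRing Γ] in
theorem support_coef_mul (X : SkewMonoidAlgebra K M) (a : K) : (coef a * X).support ⊆ X.support := by
  intro w hw
  rw [SkewMonoidAlgebra.mem_support_iff] at hw ⊢
  intro h
  apply hw
  rw [coef_eq, SkewMonoidAlgebra.coeff_single_one_mul, h, mul_zero]

omit [IsFractionRing Γ K] [FaithfulSMul M K] [Algebra Γ K] [CommRing Γ] [Group M] [MulSemiringAction M K] in
theorem support_sum_subset {r : ℕ} (z : Fin r → SkewMonoidAlgebra K M) {S : Finset M}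
    (h : ∀ j, (z j).support ⊆ S) : (∑ j, z j).support ⊆ S := by
  intro w hw
  by_contra hS
  rw [SkewMonoidAlgebra.mem_support_iff] at hw
  apply hw
  have : ∀ T : Finset (Fin r), (∑ j ∈ T, z j).coeff w = 0 := by
    intro T
    induction T using Finset.cons_induction with
    | empty => rfl
    | cons j T hj ih =>
      rw [Finset.sum_cons, SkewMonoidAlgebra.coeff_add, Finsupp.add_apply, ih, add_zero]
      exact SkewMonoidAlgebra.notMem_support_iff.1 fun h' => hS (h j h')
  exact this _

omit [IsFractionRing Γ K] [FaithfulSMul M K] [Algebra Γ K] [CommRing Γ] [Group M] [MulSemiringAction M K] in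
theorem sum_single_coeff (X : SkewMonoidAlgebra K M) {S : Finset M} (hS : X.support ⊆ S) :
    ∑ w : S, SkewMonoidAlgebra.single w.1 (X.coeff w.1) = X := by
  conv_rhs => rw [← SkewMonoidAlgebra.sum_single X, SkewMonoidAlgebra.sum_def]
  rw [Finsupp.sum_of_support_subset _ hS _ fun _ _ => SkewMonoidAlgebra.single_zero _]
  exact Finset.sum_coe_sort S fun w => SkewMonoidAlgebra.single w (X.coeff w)

/-- A subring that contains `Γ`, preserves `Γ`, and contains a nonzero multiple of each element of
`M`, is a principal Galois order. -/
theorem isPrincipalGaloisOrder_of [IsDomain Γ] [IsNoetherianRing Γ]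
    (hM : ∀ (w : M) (γ : Γ), ∃ γ', w • algebraMap Γ K γ = algebraMap Γ K γ')
    (U : Subring (SkewMonoidAlgebra K M)) (base : ∀ γ : Γ, coef (algebraMap Γ K γ) ∈ U)
    (eval : ∀ u ∈ U, ∀ γ : Γ, ∃ γ' : Γ, evalAt u (algebraMap Γ K γ) = algebraMap Γ K γ')
    (lead : ∀ w : M, ∃ a : K, a ≠ 0 ∧ SkewMonoidAlgebra.single w a ∈ U) :
    IsPrincipalGaloisOrder Γ U where
  base_mem := base
  mul_field := by
    rw [eq_top_iff]
    intro X _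
    induction X using skew_induction with
    | zero => exact zero_mem _
    | add X Y hX hY => exact add_mem (hX trivial) (hY trivial)
    | single w b =>
      obtain ⟨a, ha, hU⟩ := lead w
      -- Moving past w applies w to the scalar, so w⁻¹ is built into it beforehand.
      refine AddSubgroup.subset_closure ⟨_, hU, w⁻¹ • (a⁻¹ * b), ?_⟩
      rw [single_mul_coef, smul_inv_smul, mul_inv_cancel_left₀ ha]
  field_mul := by
    rw [eq_top_iff]
    intro X _
    induction X using skew_induction with
    | zero => exact zero_mem _
    | add X Y hX hY => exact add_mem (hX trivial) (hY trivial)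
    | single w b =>
      obtain ⟨a, ha, hU⟩ := lead w
      refine AddSubgroup.subset_closure ⟨_, hU, b * a⁻¹, ?_⟩
      rw [coef_mul_single, inv_mul_cancel_right₀ ha]
  eval_mem := eval
  left_fg r x := by
    classical
    set S : Finset M := Finset.univ.biUnion fun j => (x j).support with hS
    choose d hd0 hd using exists_denominator (Γ := Γ) (K := K) S
    -- All intersections with this support lie in a free left Γ-module, spanned by the group
    -- elements of S with bounded denominators.
    let Φ : (S → Γ) →+ SkewMonoidAlgebra K M :=
      { toFun := fun g => ∑ w : S, SkewMonoidAlgebra.single w.1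
          (algebraMap Γ K (g w) * (algebraMap Γ K (d w.1))⁻¹)
        map_zero' := by simp
        map_add' := fun g g' => by
          rw [← Finset.sum_add_distrib]
          exact Finset.sum_congr rfl fun w _ => by
            rw [← SkewMonoidAlgebra.single_add, ← add_mul, ← map_add]; rfl }
    have hΦ : ∀ (γ : Γ) g, Φ (γ • g) = coef (algebraMap Γ K γ) * Φ g := by
      intro γ g
      show ∑ w : S, _ = _ * ∑ w : S, _
      rw [Finset.mul_sum]
      exact Finset.sum_congr rfl fun w _ => by
        rw [coef_mul_single, ← mul_assoc, ← map_mul]; rfl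
    obtain ⟨m, v, hv⟩ := exists_generators Φ
      (N := leftSpan (fun a : K => coef a) x ∩ U)
      ⟨⟨0, by simp [coef_eq]⟩, U.zero_mem⟩
      (by
        rintro _ ⟨⟨a, rfl⟩, ha⟩ _ ⟨⟨b, rfl⟩, hb⟩
        exact ⟨⟨a + b, by simp only [Pi.add_apply, coef_add, add_mul, Finset.sum_add_distrib]⟩,
          U.add_mem ha hb⟩)
      (by
        rintro γ g ⟨⟨a, ha⟩, hU⟩
        rw [hΦ]
        refine ⟨⟨fun j => algebraMap Γ K γ * a j, ?_⟩, U.mul_mem (base γ) hU⟩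
        rw [ha, Finset.mul_sum]
        exact Finset.sum_congr rfl fun j _ => by
          simp only [coef_mul, mul_assoc])
      (by
        rintro z ⟨⟨a, ha⟩, hU⟩
        have hz : z.support ⊆ S := by
          rw [ha]
          exact support_sum_subset _ fun j => (support_coef_mul _ _).trans
            (Finset.subset_biUnion_of_mem (fun j => (x j).support) (Finset.mem_univ j))
        choose g hg using fun w => hd w z hz (eval z hU)
        refine ⟨fun w => g w.1, ?_⟩
        rw [← sum_single_coeff z hz]
        show ∑ w : S, _ = _
        refine Finset.sum_congr rfl fun w _ => ?_
        rw [← hg, mul_comm (algebraMap Γ K _), mul_inv_cancel_right₀]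
        exact (map_ne_zero_iff _ (IsFractionRing.injective Γ K)).2 (hd0 _))
    refine ⟨m, fun j => Φ (v j), ?_⟩
    rw [hv]
    simp only [leftSpan, hΦ]
  right_fg r x := by
    classical
    set S : Finset M := Finset.univ.biUnion fun j => (x j).support with hS
    choose d hd0 hd using exists_denominator (Γ := Γ) (K := K) S
    let Φ : (S → Γ) →+ SkewMonoidAlgebra K M :=
      { toFun := fun g => ∑ w : S, SkewMonoidAlgebra.single w.1
          ((algebraMap Γ K (d w.1))⁻¹ * w.1 • algebraMap Γ K (g w))
        map_zero' := by simp
        map_add' := fun g g' => by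
          rw [← Finset.sum_add_distrib]
          exact Finset.sum_congr rfl fun w _ => by
            rw [← SkewMonoidAlgebra.single_add, ← mul_add, ← smul_add, ← map_add]; rfl }
    have hΦ : ∀ (γ : Γ) g, Φ (γ • g) = Φ g * coef (algebraMap Γ K γ) := by
      intro γ g
      show ∑ w : S, _ = (∑ w : S, _) * _
      rw [Finset.sum_mul]
      exact Finset.sum_congr rfl fun w _ => by
        rw [single_mul_coef, mul_assoc, ← smul_mul', ← map_mul, mul_comm (g w)]; rfl
    obtain ⟨m, v, hv⟩ := exists_generators Φ
      (N := rightSpan (fun a : K => coef a) x ∩ U)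
      ⟨⟨0, by simp [coef_eq]⟩, U.zero_mem⟩
      (by
        rintro _ ⟨⟨a, rfl⟩, ha⟩ _ ⟨⟨b, rfl⟩, hb⟩
        exact ⟨⟨a + b, by simp only [Pi.add_apply, coef_add, mul_add, Finset.sum_add_distrib]⟩,
          U.add_mem ha hb⟩)
      (by
        rintro γ g ⟨⟨a, ha⟩, hU⟩
        rw [hΦ]
        refine ⟨⟨fun j => a j * algebraMap Γ K γ, ?_⟩, U.mul_mem hU (base γ)⟩
        rw [ha, Finset.sum_mul]
        exact Finset.sum_congr rfl fun j _ => by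
          simp only [coef_mul, mul_assoc])
      (by
        rintro z ⟨⟨a, ha⟩, hU⟩
        have hz : z.support ⊆ S := by
          rw [ha]
          exact support_sum_subset _ fun j => (support_mul_coef _ _).trans
            (Finset.subset_biUnion_of_mem (fun j => (x j).support) (Finset.mem_univ j))
        choose g hg using fun w => hd w z hz (eval z hU)
        -- For the right module structure the numerators must be carried back through w, which is
        -- possible because the group preserves Γ.
        choose g' hg' using fun w : M => hM w⁻¹ (g w)
        refine ⟨fun w => g' w.1, ?_⟩
        rw [← sum_single_coeff z hz]
        show ∑ w : S, _ = _
        refine Finset.sum_congr rfl fun w _ => ?_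
        rw [← hg', smul_inv_smul, ← hg, inv_mul_cancel_left₀]
        exact (map_ne_zero_iff _ (IsFractionRing.injective Γ K)).2 (hd0 _))
    refine ⟨m, fun j => Φ (v j), ?_⟩
    rw [hv]
    simp only [rightSpan, hΦ]

end GaloisCriterion

end

section

variable (D : Datum)

/-! ### The operators of `T ⋊ S_n` -/

variable {D}

theorem latticeAut_zero (w : Equiv.Perm (Fin D.n)) : latticeAut D 0 w = renameEquiv ℂ w := by
  apply AlgEquiv.coe_toAlgHom_injective
  ext1 j
  show latticeAut D 0 w (X j) = renameEquiv ℂ w (X j)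
  rw [latticeAut_X]; simp

theorem latticeAut_eq_mul (v : Fin D.n → ℤ) (w : Equiv.Perm (Fin D.n)) :
    latticeAut D v w = latticeAut D v 1 * latticeAut D 0 w := by
  rw [latticeAut_mul, one_mul]; congr 1; funext i; simp

variable (D) in
/-- The homomorphism `v ↦ latticeAut v 1`. -/
def latticeHom : Multiplicative (Fin D.n → ℤ) →* (PolyU D ≃ₐ[ℂ] PolyU D) where
  toFun v := latticeAut D v.toAdd 1
  map_one' := latticeAut_zero_one D
  map_mul' v v' := by
    rw [latticeAut_mul, one_mul]; rfl

theorem latticeHom_apply (v : Fin D.n → ℤ) :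
    latticeHom D (Multiplicative.ofAdd v) = latticeAut D v 1 := rfl

theorem latticeHom_pow (v : Fin D.n → ℤ) (m : ℕ) :
    latticeAut D v 1 ^ m = latticeAut D (m • v) 1 := by
  rw [← latticeHom_apply, ← latticeHom_apply, ofAdd_nsmul, map_pow]

theorem muAut_eq (i : Fin D.n) : muAut D i = latticeAut D (Pi.single i 1) 1 := by
  apply AlgEquiv.coe_toAlgHom_injective
  ext1 j
  show muAut D i (X j) = latticeAut D (Pi.single i 1) 1 (X j)
  rw [latticeAut_X]
  by_cases h : j = i
  · subst h; simp [muAut, translate]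
  · simp [muAut, translate, Pi.single_eq_of_ne h]

theorem muAll_eq : muAll D = latticeAut D 1 1 := by
  apply AlgEquiv.coe_toAlgHom_injective
  ext1 j
  show muAll D (X j) = latticeAut D 1 1 (X j)
  rw [latticeAut_X]
  simp [muAll, translate]

theorem latticeChar_one_comp {v : Fin D.n → ℤ} (h : latticeChar D v = 1)
    (w : Equiv.Perm (Fin D.n)) : latticeChar D (fun i => v (w⁻¹ i)) = 1 := by
  ext a
  have := latticeChar_permA D v w (permA D w⁻¹ a)
  rw [← permA_mul, mul_inv_cancel, permA_one, h] at this
  exact this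

theorem latticeChar_single_ell (i : Fin D.n) : latticeChar D (D.ℓ • Pi.single i 1) = 1 := by
  ext a
  rw [← Pi.single_smul, latticeChar_single, zpow_neg, nsmul_eq_mul, mul_one, zpow_natCast]
  have : (a.1 i) ^ D.ℓ = 1 := by
    apply Subtype.ext
    exact (a.1 i).2
  rw [this, inv_one]; rfl

theorem latticeChar_const : latticeChar D ((D.ℓ / D.p) • 1) = 1 := by
  ext a
  have h : ∀ i : Fin D.n, toC D (a.1 i ^ (-((D.ℓ / D.p) • (1 : Fin D.n → ℤ)) i))
      = ((toC D (a.1 i)) ^ (D.ℓ / D.p))⁻¹ := by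
    intro i
    simp only [Pi.smul_apply, Pi.one_apply, nsmul_eq_mul, mul_one]
    rw [zpow_neg, zpow_natCast, toC_inv, toC_pow]
  rw [latticeChar_apply, Finset.prod_congr rfl fun i _ => h i, Finset.prod_inv_distrib,
    Finset.prod_pow]
  have h2 : ∏ i, toC D (a.1 i) = toC D (∏ i, a.1 i) := by
    simp only [toC]; push_cast; rfl
  have h3 : (∏ i, a.1 i) ^ (D.ℓ / D.p) = 1 := a.2
  rw [h2, ← toC_pow, h3, toC_one, inv_one]; rfl

/-- Testing on t_j t_i⁻¹ shows that all components of v agree modulo ℓ, and testing on t_1^p shows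
that ℓ divides p v_1. These congruences describe the lattice T. -/
theorem exists_of_latticeChar_eq_one {v : Fin D.n → ℤ} (h : latticeChar D v = 1) :
    ∃ (c : ℤ) (d : Fin D.n → ℤ), ∀ i, v i = c * ((D.ℓ / D.p : ℕ) : ℤ) + d i * D.ℓ := by
  have hζ : ∀ m : ℤ, toC D (D.ζ ^ m) = 1 → (D.ℓ : ℤ) ∣ m := fun m hm =>
    (D.prim.zpow_eq_one_iff_dvd m).1 (toC_eq_one D hm)
  have h1 : ∀ i j, (D.ℓ : ℤ) ∣ v i - v j := by
    intro i j
    by_cases hij : i = j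
    · subst hij; simp
    apply hζ
    have := DFunLike.congr_fun h (tRatio D j i D.ζ)
    rw [MonoidHom.one_apply, latticeChar_apply, ← Finset.prod_subset (Finset.subset_univ {j, i}),
      Finset.prod_pair (Ne.symm hij)] at this
    · rw [← this, ← toC_mul, tRatio_apply, tRatio_apply]
      congr 1
      simp [hij, Ne.symm hij, zpow_sub, mul_comm]
    · intro m _ hm
      simp only [Finset.mem_insert, Finset.mem_singleton, not_or] at hm
      rw [tRatio_apply]
      simp [hm.1, hm.2, toC]
  have h2 : ((D.ℓ / D.p : ℕ) : ℤ) ∣ v (first D) := by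
    have := DFunLike.congr_fun h (tPow D (first D) 1)
    rw [latticeChar_tPow, MonoidHom.one_apply, ← toC_zpow, ← toC_pow, mul_one, ← zpow_natCast,
      ← zpow_mul] at this
    have := hζ _ this
    obtain ⟨q, hq⟩ := D.p_dvd
    have hp : D.p ≠ 0 := by
      intro h0; rw [h0, zero_mul] at hq; exact D.ell_ne.out hq
    rw [hq, Nat.mul_div_cancel_left _ (Nat.pos_of_ne_zero hp)]
    rw [hq] at this
    push_cast at this
    rw [mul_comm] at this
    exact (dvd_neg.1 ((mul_dvd_mul_iff_right (by exact_mod_cast hp)).1 this))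
  obtain ⟨c, hc⟩ := h2
  choose d hd using fun i => h1 i (first D)
  exact ⟨c, d, fun i => by linarith [hd i]⟩

theorem latticeAut_mem_latticeT {v : Fin D.n → ℤ} (h : latticeChar D v = 1) :
    latticeAut D v 1 ∈ latticeT D := by
  obtain ⟨c, d, hcd⟩ := exists_of_latticeChar_eq_one h
  have e : v = c • ((D.ℓ / D.p) • 1) + ∑ i, d i • (D.ℓ • (Pi.single i 1 : Fin D.n → ℤ)) := by
    funext j
    rw [hcd]
    simp [Finset.sum_apply, Pi.single_apply]
  have e2 : latticeAut D v 1 = (muAll D ^ (D.ℓ / D.p)) ^ c * latticeHom D (Multiplicative.ofAdd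
      (∑ i, d i • (D.ℓ • (Pi.single i 1 : Fin D.n → ℤ)))) := by
    rw [muAll_eq, latticeHom_pow, ← latticeHom_apply, ← latticeHom_apply, ← map_zpow, ← map_mul,
      ← ofAdd_zsmul, ← ofAdd_add, ← e]
  rw [e2]
  refine mul_mem (zpow_mem (Subgroup.subset_closure (Set.mem_insert _ _)) _) ?_
  rw [ofAdd_sum]
  refine prod_mem (S := (latticeT D).comap (latticeHom D)) fun i _ => ?_
  rw [Subgroup.mem_comap, ofAdd_zsmul, map_zpow, latticeHom_apply, ← latticeHom_pow, ← muAut_eq]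
  exact (latticeT D).zpow_mem (Subgroup.subset_closure (Set.mem_insert_of_mem _ ⟨i, rfl⟩)) _

/-- The elements of `T ⋊ S_n` are the automorphisms `latticeAut v w` with `v` in the lattice of the
vectors that act trivially on `A`. -/
theorem mem_affineGroup_iff {φ : PolyU D ≃ₐ[ℂ] PolyU D} :
    φ ∈ affineGroup D ↔ ∃ v w, latticeChar D v = 1 ∧ φ = latticeAut D v w := by
  constructor
  · let G : Subgroup (PolyU D ≃ₐ[ℂ] PolyU D) :=
      { carrier := {φ | ∃ v w, latticeChar D v = 1 ∧ φ = latticeAut D v w}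
        one_mem' := ⟨0, 1, by ext a; exact latticeChar_zero D a, (latticeAut_zero_one D).symm⟩
        mul_mem' := by
          rintro _ _ ⟨v, w, hv, rfl⟩ ⟨v', w', hv', rfl⟩
          refine ⟨_, _, ?_, latticeAut_mul D _ _ _ _⟩
          ext a
          rw [latticeChar_add, hv, latticeChar_one_comp hv', MonoidHom.one_apply, mul_one]
        inv_mem' := by
          rintro _ ⟨v, w, hv, rfl⟩
          refine ⟨-fun i => v (w i), w⁻¹, ?_, ?_⟩
          · ext a
            have h := latticeChar_add D (-fun i => v (w i)) (fun i => v (w i)) a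
            rw [neg_add_cancel, latticeChar_zero] at h
            have h2 := latticeChar_one_comp hv w⁻¹
            rw [inv_inv] at h2
            rw [h2, MonoidHom.one_apply, mul_one] at h
            exact h.symm
          · rw [inv_eq_iff_mul_eq_one, latticeAut_mul, mul_inv_cancel, ← latticeAut_zero_one]
            congr 1
            funext i
            simp }
    have h1 : latticeT D ≤ G := by
      rw [latticeT, Subgroup.closure_le, Set.insert_subset_iff]
      refine ⟨⟨_, 1, latticeChar_const, by rw [muAll_eq, latticeHom_pow]⟩, ?_⟩
      rintro _ ⟨i, rfl⟩
      exact ⟨_, 1, latticeChar_single_ell i, by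
        show muAut D i ^ D.ℓ = _
        rw [muAut_eq, latticeHom_pow]⟩
    have h2 : symmU D ≤ G := by
      rw [symmU, Subgroup.closure_le]
      rintro _ ⟨w, rfl⟩
      exact ⟨0, w, by ext a; exact latticeChar_zero D a, (latticeAut_zero w).symm⟩
    intro h
    exact (sup_le h1 h2) h
  · rintro ⟨v, w, hv, rfl⟩
    rw [latticeAut_eq_mul, latticeAut_zero]
    exact mul_mem (Subgroup.mem_sup_left (latticeAut_mem_latticeT hv))
      (Subgroup.mem_sup_right (Subgroup.subset_closure ⟨w, rfl⟩))

instance : FaithfulSMul (affineGroup D) (FieldU D) where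
  eq_of_smul_eq_smul {w w'} h := by
    apply Subtype.ext
    apply AlgEquiv.ext
    intro f
    have := h (algebraMap _ _ f)
    rw [fieldAut_smul, fieldAut_smul, fieldAut_algebraMap, fieldAut_algebraMap] at this
    exact FaithfulSMul.algebraMap_injective (PolyU D) (FieldU D) this

end

section

variable (D : Datum)

/-! ### The partially spherical subalgebra as a ring of skew elements -/

/-- The evaluation `T^a ↦ χ a` at a character of `A`. -/
def evChar (χ : diagonalGroup D →* ℂ) : RatRep D →+* FieldU D :=
  (MonoidAlgebra.liftNCRingHom (RingHom.id (FieldU D))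
    (((algebraMap ℂ (FieldU D)) : ℂ →* FieldU D).comp χ)
    (fun _ _ => Commute.all _ _) : MonoidAlgebra (FieldU D) (diagonalGroup D) →+* FieldU D)

/-- The idempotent `|A|⁻¹ ∑ T^a`. -/
def ratAvg : RatRep D :=
  algebraMap ℂ _ (Fintype.card (diagonalGroup D) : ℂ)⁻¹ * ∑ a : diagonalGroup D, ratT D a

variable {D}

theorem evChar_ofField (χ : diagonalGroup D →* ℂ) (q : FieldU D) :
    evChar D χ (ofField D q) = q := by
  show evChar D χ (MonoidAlgebra.single 1 q) = _
  rw [evChar]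
  erw [MonoidAlgebra.liftNC_single]
  rw [map_one, mul_one]
  rfl

theorem evChar_ratT (χ : diagonalGroup D →* ℂ) (a : diagonalGroup D) :
    evChar D χ (ratT D a) = algebraMap ℂ _ (χ a) := by
  show evChar D χ (MonoidAlgebra.single a 1) = _
  rw [evChar]
  erw [MonoidAlgebra.liftNC_single]
  exact one_mul _

theorem evChar_algebraMap (χ : diagonalGroup D →* ℂ) (c : ℂ) :
    evChar D χ (algebraMap ℂ _ c) = algebraMap ℂ _ c := by
  rw [algebraMap_ratRep, evChar_ofField]

/-- A lattice operator permutes the characters of `A`; on values it is a field automorphism. -/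
theorem evChar_ratAut (χ : diagonalGroup D →* ℂ) (v : Fin D.n → ℤ) (w : Equiv.Perm (Fin D.n))
    (f : RatRep D) : evChar D χ (ratAut D v w f)
      = fieldAut D (latticeAut D v w) (evChar D ((latticeChar D v * χ).comp (permA D w)) f) := by
  induction f using ratRep_induction with
  | zero => simp only [map_zero]
  | add f g hf hg => simp only [map_add, hf, hg]
  | mul q a =>
    rw [map_mul, map_mul, map_mul, map_mul, ratAut_ofField, ratAut_ratT, map_mul, evChar_ofField,
      evChar_ofField, evChar_algebraMap, evChar_ratT, evChar_ratT, fieldAut_algebraMap_complex,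
      ← map_mul]
    rfl

theorem toRat_embed (f : PolyU D) :
    toRat D (embed D f) = ofField D (algebraMap _ _ f) * ratAvg D := by
  simp only [embed, map_mul (toRat D), map_sum, toRat_monT, ratAvg, toRat_inU]
  rfl

theorem ratT_mul_ratAvg (a : diagonalGroup D) : ratT D a * ratAvg D = ratAvg D := by
  rw [ratAvg, mul_left_comm, Finset.mul_sum]
  congr 1
  simp only [← map_mul]
  exact Fintype.sum_equiv (Equiv.mulLeft a) _ _ fun _ => rfl

/-- The idempotent absorbs every T^a, so e' · `RatRep` is a copy of K, with evaluation at the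
trivial character as coordinate. -/
theorem mul_ratAvg (f : RatRep D) : f * ratAvg D = ofField D (evChar D 1 f) * ratAvg D := by
  induction f using ratRep_induction with
  | zero => simp only [map_zero]
  | add f g hf hg => simp only [map_add, add_mul, hf, hg]
  | mul q a =>
    rw [mul_assoc, ratT_mul_ratAvg, map_mul, evChar_ofField, evChar_ratT, MonoidHom.one_apply,
      map_one, mul_one]

theorem evChar_ratAvg : evChar D 1 (ratAvg D) = 1 := by
  have h : ((Fintype.card (diagonalGroup D) : ℂ)) ≠ 0 := by exact_mod_cast Fintype.card_ne_zero
  simp only [ratAvg, map_mul, map_sum, evChar_algebraMap, evChar_ratT, MonoidHom.one_apply]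
  rw [Finset.sum_const, Finset.card_univ, map_one, nsmul_one,
    ← map_natCast (algebraMap ℂ (FieldU D)), ← map_mul, inv_mul_cancel₀ h, map_one]

/-- Orthogonality of characters: absorbing some T^a with χ a ≠ 1 forces the value to vanish. -/
theorem evChar_ratAvg_of_ne {χ : diagonalGroup D →* ℂ} (h : χ ≠ 1) : evChar D χ (ratAvg D) = 0 := by
  obtain ⟨a, ha⟩ : ∃ a, χ a ≠ 1 := by
    by_contra! hc
    exact h (MonoidHom.ext hc)
  have h1 := congrArg (evChar D χ) (ratT_mul_ratAvg a)
  rw [map_mul, evChar_ratT] at h1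
  by_contra h0
  have h2 : algebraMap ℂ (FieldU D) (χ a) = 1 := mul_right_cancel₀ h0 (h1.trans (one_mul _).symm)
  rw [← map_one (algebraMap ℂ (FieldU D))] at h2
  exact ha (FaithfulSMul.algebraMap_injective ℂ (FieldU D) h2)

theorem ratRho_ePrime : ratRho D (ePrime D) = mulOp D (ratAvg D) := by
  refine LinearMap.ext fun f => ?_
  simp only [ePrime, map_smul, map_sum, ratRho_hg, groupOp_diag, LinearMap.smul_apply,
    LinearMap.sum_apply, LinearMap.mulLeft_apply, ratAvg, ← Finset.sum_mul]
  rw [Algebra.smul_def, mul_assoc]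

theorem mulOp_latOp_mul (b b' : RatRep D) (v v' : Fin D.n → ℤ) (w w' : Equiv.Perm (Fin D.n)) :
    (mulOp D b * latOp D v w) * (mulOp D b' * latOp D v' w')
      = mulOp D (b * ratAut D v w b') * latOp D (v + fun i => v' (w⁻¹ i)) (w * w') := by
  refine LinearMap.ext fun f => ?_
  simp only [Module.End.mul_apply, LinearMap.mulLeft_apply, latOp_apply, map_mul, ratAut_ratAut,
    mul_assoc]

theorem mulOp_one_mul_latOp (v : Fin D.n → ℤ) (w : Equiv.Perm (Fin D.n)) :
    mulOp D 1 * latOp D v w = latOp D v w := by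
  refine LinearMap.ext fun f => ?_
  simp only [Module.End.mul_apply, LinearMap.mulLeft_apply, one_mul]

theorem mulOp_mul_latOp_one (b : RatRep D) : mulOp D b * latOp D 0 1 = mulOp D b := by
  refine LinearMap.ext fun f => ?_
  simp only [Module.End.mul_apply, LinearMap.mulLeft_apply, latOp_apply, ratAut_zero_one]

variable (D) in
/-- The monoid of the operators `b · (v, w)`. -/
def latticeMonoid : Submonoid (Module.End ℂ (RatRep D)) where
  carrier := {Φ | ∃ b v w, Φ = mulOp D b * latOp D v w}
  one_mem' := ⟨1, 0, 1, LinearMap.ext fun f => by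
    rw [mulOp_mul_latOp_one, LinearMap.mulLeft_apply, one_mul]; rfl⟩
  mul_mem' := by
    rintro _ _ ⟨b, v, w, rfl⟩ ⟨b', v', w', rfl⟩
    exact ⟨_, _, _, mulOp_latOp_mul _ _ _ _ _ _⟩

theorem mulOp_mem (b : RatRep D) : mulOp D b ∈ (latticeMonoid D).subsemiringClosure :=
  AddSubmonoid.subset_closure ⟨b, 0, 1, (mulOp_mul_latOp_one b).symm⟩

theorem mulOp_latOp_mem (b : RatRep D) (v : Fin D.n → ℤ) (w : Equiv.Perm (Fin D.n)) :
    mulOp D b * latOp D v w ∈ (latticeMonoid D).subsemiringClosure :=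
  AddSubmonoid.subset_closure ⟨b, v, w, rfl⟩

theorem demazure_eq (i j : Fin D.n) : demazure D i j
    = mulOp D (1 + rMat D i j) * latOp D 0 (Equiv.swap i j) + mulOp D (-rMat D i j) := by
  refine LinearMap.ext fun f => ?_
  simp only [demazure_apply, LinearMap.add_apply, Module.End.mul_apply, LinearMap.mulLeft_apply,
    latOp_apply]
  ring

theorem ratRho_mem (h : H D) : ratRho D h ∈ (latticeMonoid D).subsemiringClosure := by
  refine H_induction' (p := fun Φ => Φ ∈ (latticeMonoid D).subsemiringClosure) ?_
    (fun a => mulOp_mem _) ?_ (mulOp_latOp_mem _ _ _) ?_ (fun _ _ => add_mem) (fun _ _ => mul_mem) h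
  · intro c
    have : algebraMap ℂ (Module.End ℂ (RatRep D)) c = mulOp D (algebraMap ℂ _ c) := by
      refine LinearMap.ext fun f => ?_
      rw [Module.algebraMap_end_apply, LinearMap.mulLeft_apply, Algebra.smul_def]
    rw [this]
    exact mulOp_mem _
  · intro i j _
    rw [demazure_eq]
    exact add_mem (mulOp_latOp_mem _ _ _) (mulOp_mem _)
  · rw [tauOp, ← mulOp_one_mul_latOp]
    exact mulOp_latOp_mem _ _ _

theorem evChar_latOp_of_trivial {v : Fin D.n → ℤ} (hv : latticeChar D v = 1)
    (w : Equiv.Perm (Fin D.n)) (b : RatRep D) (q : FieldU D) :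
    evChar D 1 ((mulOp D b * latOp D v w) (ofField D q * ratAvg D))
      = evChar D 1 b * fieldAut D (latticeAut D v w) q := by
  rw [Module.End.mul_apply, LinearMap.mulLeft_apply, latOp_apply, map_mul, evChar_ratAut, map_mul,
    map_mul, evChar_ofField]
  have h : (latticeChar D v * 1).comp (permA D w) = 1 := by rw [hv, one_mul]; rfl
  rw [h, evChar_ratAvg, map_one, mul_one]

/-- A translation outside T moves the trivial character to another one, where the idempotent
vanishes. This is why only T ⋊ S_n survives between the two copies of e'. -/
theorem evChar_latOp_of_ne {v : Fin D.n → ℤ} (hv : latticeChar D v ≠ 1)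
    (w : Equiv.Perm (Fin D.n)) (b : RatRep D) (q : FieldU D) :
    evChar D 1 ((mulOp D b * latOp D v w) (ofField D q * ratAvg D)) = 0 := by
  rw [Module.End.mul_apply, LinearMap.mulLeft_apply, latOp_apply, map_mul, evChar_ratAut, map_mul,
    map_mul]
  have h : (latticeChar D v * 1).comp (permA D w) ≠ 1 := by
    intro h
    apply hv
    ext a
    have := DFunLike.congr_fun h (permA D w⁻¹ a)
    rw [MonoidHom.comp_apply, ← permA_mul, mul_inv_cancel, permA_one, mul_one] at this
    exact this
  rw [evChar_ratAvg_of_ne h, map_zero, mul_zero, mul_zero]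

theorem exists_skew {Φ : Module.End ℂ (RatRep D)}
    (hΦ : Φ ∈ (latticeMonoid D).subsemiringClosure) :
    ∃ X : SkewU D, ∀ q : FieldU D, evChar D 1 (Φ (ofField D q * ratAvg D)) = evalAt X q := by
  refine AddSubmonoid.closure_induction
    (motive := fun Φ _ => ∃ X : SkewU D, ∀ q : FieldU D,
      evChar D 1 (Φ (ofField D q * ratAvg D)) = evalAt X q) ?_ ?_ ?_ hΦ
  · rintro _ ⟨b, v, w, rfl⟩
    by_cases hv : latticeChar D v = 1
    · exact ⟨SkewMonoidAlgebra.single ⟨_, mem_affineGroup_iff.2 ⟨v, w, hv, rfl⟩⟩ (evChar D 1 b),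
        fun q => by rw [evChar_latOp_of_trivial hv, evalAt_single]; rfl⟩
    · exact ⟨0, fun q => by rw [evChar_latOp_of_ne hv, evalAt_zero]⟩
  · exact ⟨0, fun q => by rw [LinearMap.zero_apply, map_zero, evalAt_zero]⟩
  · rintro _ _ _ _ ⟨X, hX⟩ ⟨Y, hY⟩
    exact ⟨X + Y, fun q => by rw [LinearMap.add_apply, map_add, hX, hY, evalAt_add]⟩

theorem skew_ext {X Y : SkewU D} (h : ∀ q, evalAt X q = evalAt Y q) : X = Y := by
  rw [← sub_eq_zero]
  refine eq_zero_of_evalAt (PolyU D) fun γ => ?_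
  rw [sub_eq_add_neg, evalAt_add, evalAt_neg, h, add_neg_cancel]

variable (D) in
/-- The element of the skew group ring given by the action on `e' · RatRep`. -/
def skewOf (h : H D) : SkewU D := (exists_skew (ratRho_mem h)).choose

theorem evalAt_skewOf (h : H D) (q : FieldU D) :
    evalAt (skewOf D h) q = evChar D 1 (ratRho D h (ofField D q * ratAvg D)) :=
  ((exists_skew (ratRho_mem h)).choose_spec q).symm

theorem ePrime_mul_coe (h : Psph D) : ePrime D * h.1 = h.1 :=
  ((Subsemigroup.mem_corner_iff (ePrime_idem D)).1 h.2).1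

theorem coe_mul_ePrime (h : Psph D) : h.1 * ePrime D = h.1 :=
  ((Subsemigroup.mem_corner_iff (ePrime_idem D)).1 h.2).2

/-- Elements with e' h = h map everything into e' · `RatRep`, so composing the actions on K loses
nothing; multiplicativity of `iota` rests on this. -/
theorem ratRho_coe_apply (h : Psph D) (f : RatRep D) :
    ratRho D h.1 f = ofField D (evChar D 1 (ratRho D h.1 f)) * ratAvg D := by
  rw [← mul_ratAvg, mul_comm]
  conv_lhs => rw [← ePrime_mul_coe, map_mul, ratRho_ePrime]
  rfl

variable (D) in
/-- The embedding of `e' H_p e'` into the skew group ring. -/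
def iota : Psph D →+* SkewU D where
  toFun h := skewOf D h.1
  map_zero' := skew_ext fun q => by
    rw [evalAt_skewOf, evalAt_zero]
    show evChar D 1 (ratRho D 0 _) = 0
    rw [map_zero, LinearMap.zero_apply, map_zero]
  map_one' := skew_ext fun q => by
    rw [evalAt_skewOf]
    show evChar D 1 (ratRho D (ePrime D) _) = evalAt (SkewMonoidAlgebra.single 1 1) q
    rw [ratRho_ePrime, LinearMap.mulLeft_apply, map_mul, map_mul, evChar_ratAvg, evChar_ofField,
      evalAt_single, one_smul, one_mul, one_mul, mul_one]
  map_add' a b := skew_ext fun q => by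
    rw [evalAt_add, evalAt_skewOf, evalAt_skewOf, evalAt_skewOf]
    show evChar D 1 (ratRho D (a.1 + b.1) _) = _
    rw [map_add, LinearMap.add_apply, map_add]
  map_mul' a b := skew_ext fun q => by
    rw [evalAt_mul, evalAt_skewOf, evalAt_skewOf, evalAt_skewOf, ← ratRho_coe_apply]
    show evChar D 1 (ratRho D (a.1 * b.1) _) = _
    rw [map_mul (ratRho D)]; rfl

theorem evalAt_iota (h : Psph D) (q : FieldU D) :
    evalAt (iota D h) q = evChar D 1 (ratRho D h.1 (ofField D q * ratAvg D)) :=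
  evalAt_skewOf _ _

theorem evChar_toRat (f : PolyRep D) : ∃ g : PolyU D, evChar D 1 (toRat D f) = algebraMap _ _ g := by
  induction f using MonoidAlgebra.induction_linear with
  | zero => exact ⟨0, by simp only [map_zero]⟩
  | add f g hf hg =>
    obtain ⟨f', hf⟩ := hf
    obtain ⟨g', hg⟩ := hg
    exact ⟨f' + g', by simp only [map_add, hf, hg]⟩
  | single a q =>
    exact ⟨q, by rw [toRat_single, map_mul, evChar_ofField, evChar_ratT, MonoidHom.one_apply,
      map_one, mul_one]⟩

theorem polyRho_embed (h : Psph D) (f : PolyU D) :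
    ∃ g : PolyU D, polyRho D h.1 (embed D f) = embed D g ∧
      evalAt (iota D h) (algebraMap _ _ f) = algebraMap _ _ g := by
  obtain ⟨g, hg⟩ := evChar_toRat (polyRho D h.1 (embed D f))
  refine ⟨g, toRat_injective ?_, ?_⟩
  · rw [toRat_embed, ← hg, toRat_polyRho]
    exact ratRho_coe_apply _ _
  · rw [← hg, toRat_polyRho, toRat_embed, evalAt_iota]

/-! ### Leading elements -/

/-- The element `e' h e'`. -/
def corner (h : H D) : Psph D :=
  ⟨ePrime D * h * ePrime D, (Subsemigroup.mem_corner_iff (ePrime_idem D)).2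
    ⟨by rw [mul_assoc, ← mul_assoc, (ePrime_idem D).eq], by rw [mul_assoc, (ePrime_idem D).eq]⟩⟩

theorem iota_corner {h : H D} {b : RatRep D} {v : Fin D.n → ℤ} {w : Equiv.Perm (Fin D.n)}
    (hh : ratRho D h = mulOp D b * latOp D v w) (hv : latticeChar D v = 1) :
    iota D (corner h) = SkewMonoidAlgebra.single
      ⟨_, mem_affineGroup_iff.2 ⟨v, w, hv, rfl⟩⟩ (evChar D 1 b) := by
  refine skew_ext fun q => ?_
  have e : ratAvg D * (ofField D q * ratAvg D) = ofField D q * ratAvg D := by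
    rw [mul_left_comm, mul_ratAvg (ratAvg D), evChar_ratAvg, map_one, one_mul]
  rw [evalAt_iota, evalAt_single]
  show evChar D 1 (ratRho D (ePrime D * h * ePrime D) _) = _
  rw [map_mul (ratRho D), map_mul (ratRho D), ratRho_ePrime, Module.End.mul_apply, Module.End.mul_apply,
    LinearMap.mulLeft_apply, LinearMap.mulLeft_apply, e, map_mul, evChar_ratAvg, one_mul, hh,
    evChar_latOp_of_trivial hv]
  rfl

theorem exists_ratRho_polynomial (f : PolyU D) :
    ∃ h : H D, ratRho D h = mulOp D (ofField D (algebraMap _ _ f)) := by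
  induction f using MvPolynomial.induction_on with
  | C c =>
    refine ⟨algebraMap ℂ _ c, LinearMap.ext fun f => ?_⟩
    rw [AlgHom.commutes, Module.algebraMap_end_apply, LinearMap.mulLeft_apply, Algebra.smul_def]
    rfl
  | add f g hf hg =>
    obtain ⟨h, hh⟩ := hf
    obtain ⟨h', hh'⟩ := hg
    exact ⟨h + h', LinearMap.ext fun f => by
      rw [map_add, hh, hh', map_add, map_add, LinearMap.add_apply, LinearMap.mulLeft_apply,
        LinearMap.mulLeft_apply, LinearMap.mulLeft_apply, add_mul]⟩
  | mul_X f i hf =>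
    obtain ⟨h, hh⟩ := hf
    exact ⟨h * hu D i, LinearMap.ext fun f => by
      rw [map_mul, hh, ratRho_hu, map_mul, map_mul, Module.End.mul_apply, LinearMap.mulLeft_apply,
        LinearMap.mulLeft_apply, LinearMap.mulLeft_apply, mul_assoc]; rfl⟩

theorem coef_mem_range (f : PolyU D) : coef (algebraMap _ _ f) ∈ RingHom.range (R := Psph D) (S := SkewU D) (iota D) := by
  obtain ⟨h, hh⟩ := exists_ratRho_polynomial f
  have hv : latticeChar D 0 = 1 := MonoidHom.ext (latticeChar_zero D)
  refine ⟨corner h, ?_⟩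
  rw [iota_corner (hh.trans (mulOp_mul_latOp_one _).symm) hv, coef_eq, evChar_ofField]
  congr 1
  exact Subtype.ext (latticeAut_zero_one D)

variable (D) in
/-- The operator `b · (v, w)` comes from `H_p` for some `b` that vanishes at no character. -/
def HasLift (v : Fin D.n → ℤ) (w : Equiv.Perm (Fin D.n)) : Prop :=
  ∃ (h : H D) (b : RatRep D), (∀ χ, evChar D χ b ≠ 0) ∧ ratRho D h = mulOp D b * latOp D v w

/-- Lattice operators move characters of `A`, so nonvanishing at all characters, and not just at the
trivial one, is what is stable under products. -/
theorem HasLift.mul {v v' : Fin D.n → ℤ} {w w' : Equiv.Perm (Fin D.n)} (h : HasLift D v w)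
    (h' : HasLift D v' w') : HasLift D (v + fun i => v' (w⁻¹ i)) (w * w') := by
  obtain ⟨h, b, hb, e⟩ := h
  obtain ⟨h', b', hb', e'⟩ := h'
  refine ⟨h * h', b * ratAut D v w b', fun χ => ?_, by rw [map_mul, e, e', mulOp_latOp_mul]⟩
  rw [map_mul, evChar_ratAut]
  exact mul_ne_zero (hb _) ((map_ne_zero_iff _ (RingEquiv.injective _)).2 (hb' _))

theorem hasLift_zero_one : HasLift D 0 1 :=
  ⟨1, 1, fun χ => by rw [map_one]; exact one_ne_zero, by
    rw [mulOp_mul_latOp_one, map_one]; exact LinearMap.ext fun f => (one_mul f).symm⟩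

theorem evChar_ratPi (χ : diagonalGroup D →* ℂ) (i j : Fin D.n) :
    ∃ c : ℂ, evChar D χ (ratPi D i j) = algebraMap ℂ _ c :=
  ⟨(D.ℓ : ℂ)⁻¹ * ∑ z : Mu D, χ (tRatio D i j z), by
    simp only [ratPi, map_mul, map_sum, evChar_algebraMap, evChar_ratT]⟩

theorem evChar_ratPoly (χ : diagonalGroup D →* ℂ) (i : Fin D.n) (u : ℂ) :
    ∃ c : ℂ, evChar D χ (ratPoly D i u) = algebraMap ℂ _ c :=
  ⟨∑ q ∈ Finset.Ico 1 (D.ℓ / D.p), (D.c (D.p * q) * u ^ (D.p * q)) * χ (tPow D i q), by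
    simp only [ratPoly, map_mul, map_sum, evChar_algebraMap, evChar_ratT]⟩

theorem exists_ratRho_ratPi (i j : Fin D.n) : ∃ h : H D, ratRho D h = mulOp D (ratPi D i j) :=
  ⟨(D.ℓ : ℂ)⁻¹ • ∑ z : Mu D, hg D (diag D (tRatio D i j z)), by
    refine LinearMap.ext fun f => ?_
    simp only [map_smul, map_sum, ratRho_hg, groupOp_diag, LinearMap.smul_apply,
      LinearMap.sum_apply, LinearMap.mulLeft_apply, ratPi, ← Finset.sum_mul]
    rw [Algebra.smul_def, mul_assoc]⟩

/-- The intertwiner kℓ π_{ij} + s (U_j - U_i): the second summand produces -kℓ π_{ij} f, the first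
cancels it, and a pure multiple of the swap is left. -/
theorem hasLift_swap {i j : Fin D.n} (hij : (j : ℕ) = i + 1) : HasLift D 0 (Equiv.swap i j) := by
  have hne : i ≠ j := by rintro rfl; omega
  obtain ⟨h1, e1⟩ := exists_ratRho_ratPi i j
  refine ⟨(D.k * D.ℓ) • h1 + hg D (perm D (Equiv.swap i j)) * (hu D j - hu D i),
    -(ratU D j - ratU D i + algebraMap ℂ _ (D.k * D.ℓ) * ratPi D i j), fun χ => ?_, ?_⟩
  · obtain ⟨c, hc⟩ := evChar_ratPi χ i j
    rw [map_neg, neg_ne_zero, map_add, map_sub, map_mul, hc, evChar_algebraMap, ratU, ratU,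
      evChar_ofField, evChar_ofField, ← map_mul, ← map_sub,
      IsScalarTower.algebraMap_apply ℂ (PolyU D) (FieldU D), ← map_add]
    rw [Ne, FaithfulSMul.algebraMap_eq_zero_iff]
    intro h
    -- At this point U_j - U_i + kℓ c takes the value 1.
    have := congrArg (eval fun m => if m = j then 1 - D.k * D.ℓ * c else 0) h
    simp [hne, algebraMap_eq] at this
  · refine LinearMap.ext fun f => ?_
    have e := rMat_mul_fieldDiff hne
    have hd : ofField D (fieldDiff D i j) = ratU D j - ratU D i := by
      rw [fieldDiff, map_sub, map_sub]; rfl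
    rw [hd] at e
    simp only [map_add, map_smul, map_mul, map_sub, e1, ratRho_hg, groupOp_perm, permOp_swap hij,
      ratRho_hu, LinearMap.add_apply, LinearMap.smul_apply, Module.End.mul_apply,
      LinearMap.mulLeft_apply, LinearMap.sub_apply, demazure_apply, latOp_apply, ratAut_ratU,
      Equiv.swap_apply_left, Equiv.swap_apply_right]
    rw [Algebra.smul_def, map_mul (algebraMap ℂ (RatRep D))]
    simp only [Pi.zero_apply, Int.cast_zero, mul_zero, map_zero, add_zero]
    rw [map_mul] at e
    linear_combination (-ratAut D 0 (Equiv.swap i j) f - f) * e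

theorem hasLift_perm (w : Equiv.Perm (Fin D.n)) : HasLift D 0 w := by
  refine perm_adjacent_induction (p := fun w => HasLift D 0 w) hasLift_zero_one
    (fun i j hij => hasLift_swap hij) (fun v w hv hw => ?_) w
  have := hv.mul hw
  rwa [zero_add] at this

theorem hasLift_sigma : HasLift D (Pi.single (first D) 1) (finRotate D.n) := by
  refine ⟨hsigma D, _, fun χ => ?_, ratRho_hsigma⟩
  obtain ⟨c, hc⟩ := evChar_ratPoly χ (first D) (toC D D.ζ)⁻¹
  rw [sigmaFactor, map_add, map_sub, hc, evChar_algebraMap, ratU, evChar_ofField,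
    IsScalarTower.algebraMap_apply ℂ (PolyU D) (FieldU D),
    IsScalarTower.algebraMap_apply ℂ (PolyU D) (FieldU D), ← map_sub, ← map_add,
    Ne, FaithfulSMul.algebraMap_eq_zero_iff]
  intro h
  -- The value of U_1 at which the factor U_1 - c + hbar equals 1.
  have := congrArg (eval fun _ => 1 + c - D.hbar) h
  simp only [algebraMap_eq, map_add, map_sub, eval_X, eval_C, map_zero] at this
  exact one_ne_zero (α := ℂ) (by linear_combination this)

theorem hasLift_tau : HasLift D (Pi.single (last D) (-1)) (finRotate D.n)⁻¹ :=
  ⟨htau D, 1, fun χ => by rw [map_one]; exact one_ne_zero, by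
    rw [mulOp_one_mul_latOp]; exact ratRho_htau⟩

/-- Permutations on both sides move the translation to any index and cancel its permutation part.
Applied to σ and τ, this yields the unit translations in both directions. -/
theorem hasLift_single_of {i : Fin D.n} {m : ℤ} {u : Equiv.Perm (Fin D.n)}
    (h : HasLift D (Pi.single i m) u) (j : Fin D.n) : HasLift D (Pi.single j m) 1 := by
  have h1 := ((hasLift_perm (Equiv.swap i j)).mul h).mul
    (hasLift_perm (Equiv.swap i j * u)⁻¹)
  rw [mul_inv_cancel] at h1
  convert h1 using 1
  funext a
  simp only [Pi.zero_apply, Pi.add_apply, zero_add, add_zero, Pi.single_apply, Equiv.swap_inv]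
  congr 1
  rw [Equiv.swap_apply_eq_iff, Equiv.swap_apply_left]

theorem hasLift (v : Fin D.n → ℤ) (w : Equiv.Perm (Fin D.n)) : HasLift D v w := by
  have add : ∀ {v v'}, HasLift D v 1 → HasLift D v' 1 → HasLift D (v + v') 1 := fun h h' => by
    simpa using h.mul h'
  have single : ∀ (i : Fin D.n) (m : ℤ), HasLift D (Pi.single i m) 1 := by
    intro i m
    induction m with
    | zero => rw [Pi.single_zero]; exact hasLift_zero_one
    | succ m hm => rw [Pi.single_add]; exact add hm (hasLift_single_of hasLift_sigma i)
    | pred m hm =>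
      rw [sub_eq_add_neg, Pi.single_add]; exact add hm (hasLift_single_of hasLift_tau i)
  have h1 : HasLift D v 1 := by
    rw [← Finset.univ_sum_single v]
    exact Finset.sum_induction _ (fun v => HasLift D v 1) (fun _ _ => add) hasLift_zero_one
      fun i _ => single i _
  have h2 := h1.mul (hasLift_perm w)
  rw [one_mul] at h2
  convert h2 using 1
  funext i
  simp

theorem exists_single_mem_range (w : affineGroup D) :
    ∃ a : FieldU D, a ≠ 0 ∧ SkewMonoidAlgebra.single w a ∈ RingHom.range (R := Psph D) (S := SkewU D) (iota D) := by
  obtain ⟨φ, hφ⟩ := w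
  obtain ⟨v, u, hv, rfl⟩ := mem_affineGroup_iff.1 hφ
  obtain ⟨h, b, hb, hh⟩ := hasLift v u
  exact ⟨_, hb 1, corner h, iota_corner hh hv⟩

theorem isPrincipalGaloisOrder_range :
    IsPrincipalGaloisOrder (K := FieldU D) (M := affineGroup D) (PolyU D)
      (RingHom.range (R := Psph D) (S := SkewU D) (iota D)) := by
  refine isPrincipalGaloisOrder_of ?_ _ coef_mem_range ?_ exists_single_mem_range
  · intro w γ
    exact ⟨w.1 γ, by rw [fieldAut_smul, fieldAut_algebraMap]⟩
  · rintro _ ⟨h, rfl⟩ γ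
    obtain ⟨g, _, hg⟩ := polyRho_embed h γ
    exact ⟨g, hg⟩

end

section

variable {D : Datum}

/-! ### Monomials span the rational Cherednik algebra -/

theorem hx_comm (i j : Fin D.n) : hx D i * hx D j = hx D j * hx D i := by
  simpa [hx] using RingQuot.mkAlgHom_rel ℂ (Rel.xx (D := D) i j)

theorem hy_comm (i j : Fin D.n) : hy D i * hy D j = hy D j * hy D i := by
  simpa [hy] using RingQuot.mkAlgHom_rel ℂ (Rel.yy (D := D) i j)

theorem hg_one : hg D 1 = 1 := by
  simpa [hg] using RingQuot.mkAlgHom_rel ℂ (Rel.one (D := D))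

theorem hg_mul_hx (w : reflectionGroup D) (i : Fin D.n) : hg D w * hx D i
    = toC D (w.1.left (w.1.right i)) • (hx D (w.1.right i) * hg D w) := by
  simpa [hg, hx] using RingQuot.mkAlgHom_rel ℂ (Rel.gx w i)

theorem hg_mul_hy (w : reflectionGroup D) (i : Fin D.n) : hg D w * hy D i
    = (toC D (w.1.left (w.1.right i)))⁻¹ • (hy D (w.1.right i) * hg D w) := by
  simpa [hg, hy] using RingQuot.mkAlgHom_rel ℂ (Rel.gy w i)

theorem hx_mul_hy (i j : Fin D.n) :
    hx D i * hy D j - hy D j * hx D i ∈ Submodule.span ℂ (Set.range (hg D)) := by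
  have hG : ∀ w, hg D w ∈ Submodule.span ℂ (Set.range (hg D)) := fun w =>
    Submodule.subset_span ⟨w, rfl⟩
  have hP : ∀ i v, RingQuot.mkAlgHom ℂ (Rel D) (fPoly D i v)
      ∈ Submodule.span ℂ (Set.range (hg D)) := fun i v => by
    rw [fPoly, map_sum]
    exact sum_mem fun q _ => by rw [map_smul]; exact Submodule.smul_mem _ _ (hG _)
  by_cases hij : i = j
  · subst hij
    have h := RingQuot.mkAlgHom_rel ℂ (Rel.xy_same i)
    rw [map_sub, map_mul, map_mul] at h
    rw [hx, hy, h, map_sub, map_add, map_add, map_smul, map_sum]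
    refine sub_mem (add_mem (add_mem ?_ (Submodule.smul_mem _ _ (sum_mem fun j _ => ?_)))
      (hP _ _)) (hP _ _)
    · rw [AlgHom.commutes, Algebra.algebraMap_eq_smul_one, ← hg_one]
      exact Submodule.smul_mem _ _ (hG _)
    · rw [map_sum]
      exact sum_mem fun z _ => hG _
  · have h := RingQuot.mkAlgHom_rel ℂ (Rel.xy_ne i j hij)
    rw [map_sub, map_mul, map_mul] at h
    rw [hx, hy, h, map_neg, map_smul, map_sum]
    refine neg_mem (Submodule.smul_mem _ _ (sum_mem fun z _ => ?_))
    rw [map_smul]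
    exact Submodule.smul_mem _ _ (hG _)

variable (D)

/-- The product of commuting variables `x_i`. -/
def hxProd (α : Multiset (Fin D.n)) : H D := (α.map (hx D)).noncommProd (by
  intro a ha b hb _
  obtain ⟨i, _, rfl⟩ := Multiset.mem_map.1 ha
  obtain ⟨j, _, rfl⟩ := Multiset.mem_map.1 hb
  exact hx_comm i j)

/-- The product of commuting variables `y_i`. -/
def hyProd (β : Multiset (Fin D.n)) : H D := (β.map (hy D)).noncommProd (by
  intro a ha b hb _
  obtain ⟨i, _, rfl⟩ := Multiset.mem_map.1 ha
  obtain ⟨j, _, rfl⟩ := Multiset.mem_map.1 hb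
  exact hy_comm i j)

/-- The monomial `x^α y^β w`. -/
def pbw (t : Multiset (Fin D.n) × Multiset (Fin D.n) × reflectionGroup D) : H D :=
  hxProd D t.1 * hyProd D t.2.1 * hg D t.2.2

variable {D}

theorem hxProd_zero : hxProd D 0 = 1 := rfl

theorem hyProd_zero : hyProd D 0 = 1 := rfl

theorem hxProd_cons (i : Fin D.n) (α : Multiset (Fin D.n)) :
    hxProd D (i ::ₘ α) = hx D i * hxProd D α := by
  simp only [hxProd, Multiset.map_cons, Multiset.noncommProd_cons]

theorem hyProd_cons (i : Fin D.n) (β : Multiset (Fin D.n)) :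
    hyProd D (i ::ₘ β) = hy D i * hyProd D β := by
  simp only [hyProd, Multiset.map_cons, Multiset.noncommProd_cons]

theorem hg_mul_hxProd (w : reflectionGroup D) (α : Multiset (Fin D.n)) :
    ∃ c : ℂ, hg D w * hxProd D α = c • (hxProd D (α.map w.1.right) * hg D w) := by
  induction α using Multiset.induction_on with
  | empty => exact ⟨1, by rw [Multiset.map_zero, hxProd_zero, one_smul, one_mul, mul_one]⟩
  | cons i α ih =>
    obtain ⟨c, hc⟩ := ih
    exact ⟨toC D (w.1.left (w.1.right i)) * c, by
      rw [hxProd_cons, ← mul_assoc, hg_mul_hx, smul_mul_assoc, mul_assoc, hc, mul_smul_comm,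
        smul_smul, Multiset.map_cons, hxProd_cons, mul_assoc]⟩

theorem hg_mul_hyProd (w : reflectionGroup D) (β : Multiset (Fin D.n)) :
    ∃ c : ℂ, hg D w * hyProd D β = c • (hyProd D (β.map w.1.right) * hg D w) := by
  induction β using Multiset.induction_on with
  | empty => exact ⟨1, by rw [Multiset.map_zero, hyProd_zero, one_smul, one_mul, mul_one]⟩
  | cons i β ih =>
    obtain ⟨c, hc⟩ := ih
    exact ⟨(toC D (w.1.left (w.1.right i)))⁻¹ * c, by
      rw [hyProd_cons, ← mul_assoc, hg_mul_hy, smul_mul_assoc, mul_assoc, hc, mul_smul_comm,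
        smul_smul, Multiset.map_cons, hyProd_cons, mul_assoc]⟩

theorem mul_mem_span_of {R : Type*} [Ring R] [Algebra ℂ R] {S : Set R} {r : R}
    (h : ∀ s ∈ S, r * s ∈ Submodule.span ℂ S) {b : R} (hb : b ∈ Submodule.span ℂ S) :
    r * b ∈ Submodule.span ℂ S := by
  have : Submodule.span ℂ S ≤ (Submodule.span ℂ S).comap (LinearMap.mulLeft ℂ r) :=
    Submodule.span_le.2 h
  exact this hb

theorem hx_mul_mem (i : Fin D.n) {b : H D} (hb : b ∈ Submodule.span ℂ (Set.range (pbw D))) :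
    hx D i * b ∈ Submodule.span ℂ (Set.range (pbw D)) := by
  refine mul_mem_span_of ?_ hb
  rintro _ ⟨⟨α, β, w⟩, rfl⟩
  refine Submodule.subset_span ⟨(i ::ₘ α, β, w), ?_⟩
  simp only [pbw, hxProd_cons, mul_assoc]

theorem hg_mul_mem (w : reflectionGroup D) {b : H D}
    (hb : b ∈ Submodule.span ℂ (Set.range (pbw D))) :
    hg D w * b ∈ Submodule.span ℂ (Set.range (pbw D)) := by
  refine mul_mem_span_of ?_ hb
  rintro _ ⟨⟨α, β, w'⟩, rfl⟩
  obtain ⟨c, hc⟩ := hg_mul_hxProd w α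
  obtain ⟨d, hd⟩ := hg_mul_hyProd w β
  have e : hg D w * pbw D (α, β, w')
      = (c * d) • pbw D (α.map w.1.right, β.map w.1.right, w * w') := by
    simp only [pbw]
    rw [← mul_assoc, ← mul_assoc, hc, smul_mul_assoc, mul_assoc _ (hg D w), hd, mul_smul_comm,
      smul_smul, smul_mul_assoc, ← mul_assoc, mul_assoc _ (hg D w), hg_mul]
  rw [e]
  exact Submodule.smul_mem _ _ (Submodule.subset_span ⟨_, rfl⟩)

theorem span_hg_mul_mem {r b : H D} (hr : r ∈ Submodule.span ℂ (Set.range (hg D)))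
    (hb : b ∈ Submodule.span ℂ (Set.range (pbw D))) :
    r * b ∈ Submodule.span ℂ (Set.range (pbw D)) := by
  have : Submodule.span ℂ (Set.range (hg D))
      ≤ (Submodule.span ℂ (Set.range (pbw D))).comap (LinearMap.mulRight ℂ b) :=
    Submodule.span_le.2 (by
      rintro _ ⟨w, rfl⟩
      exact hg_mul_mem w hb)
  exact this hr

/-- Moving y_i to the right past x_j leaves a combination of group elements, which preserves the
span, so induction on the number of x's closes. -/
theorem hy_mul_mem (i : Fin D.n) {b : H D} (hb : b ∈ Submodule.span ℂ (Set.range (pbw D))) :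
    hy D i * b ∈ Submodule.span ℂ (Set.range (pbw D)) := by
  refine mul_mem_span_of ?_ hb
  rintro _ ⟨⟨α, β, w⟩, rfl⟩
  induction α using Multiset.induction_on with
  | empty =>
    refine Submodule.subset_span ⟨(0, i ::ₘ β, w), ?_⟩
    simp only [pbw, hyProd_cons, hxProd_zero, one_mul, mul_assoc]
  | cons j α ih =>
    have e : hy D i * pbw D (j ::ₘ α, β, w) = hx D j * (hy D i * pbw D (α, β, w))
        - (hx D j * hy D i - hy D i * hx D j) * pbw D (α, β, w) := by
      simp only [pbw, hxProd_cons]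
      rw [sub_mul]
      simp only [mul_assoc]
      abel
    rw [e]
    exact sub_mem (hx_mul_mem j ih)
      (span_hg_mul_mem (hx_mul_hy j i) (Submodule.subset_span ⟨_, rfl⟩))

theorem mem_span_pbw (h : H D) : h ∈ Submodule.span ℂ (Set.range (pbw D)) := by
  have key : ∀ b ∈ Submodule.span ℂ (Set.range (pbw D)),
      h * b ∈ Submodule.span ℂ (Set.range (pbw D)) := by
    induction h using H_induction with
    | scalar c =>
      intro b hb
      rw [← Algebra.smul_def]
      exact Submodule.smul_mem _ _ hb
    | g w => exact fun b => hg_mul_mem w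
    | x i => exact fun b => hx_mul_mem i
    | y i => exact fun b => hy_mul_mem i
    | add a a' ha ha' =>
      intro b hb
      rw [add_mul]
      exact add_mem (ha b hb) (ha' b hb)
    | mul a a' ha ha' =>
      intro b hb
      rw [mul_assoc]
      exact ha _ (ha' b hb)
  have h1 := key 1 (Submodule.subset_span ⟨(0, 0, 1), by
    simp only [pbw, hxProd_zero, hyProd_zero, hg_one, mul_one]⟩)
  rwa [mul_one] at h1

end

section

open scoped WithZero

/-! ### The degree valuation -/

section Degree

variable {σ R : Type*} [CommRing R] [IsDomain R]

open Classical in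
/-- The valuation of a polynomial ring given by the total degree. -/
def totalDegreeValuation : Valuation (MvPolynomial σ R) ℤᵐ⁰ where
  -- The zero polynomial has total degree 0, so its value must be set separately.
  toFun f := if f = 0 then 0 else WithZero.exp (f.totalDegree : ℤ)
  map_zero' := if_pos rfl
  map_one' := by
    rw [if_neg one_ne_zero, totalDegree_one]; rfl
  map_mul' f g := by
    by_cases hf : f = 0
    · simp [hf]
    by_cases hg : g = 0
    · simp [hg]
    rw [if_neg hf, if_neg hg, if_neg (mul_ne_zero hf hg), totalDegree_mul_of_isDomain hf hg,
      Nat.cast_add, WithZero.exp_add]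
  map_add_le_max' f g := by
    by_cases hf : f = 0
    · simp [hf]
    by_cases hg : g = 0
    · simp [hg]
    by_cases hfg : f + g = 0
    · rw [if_pos hfg]; exact zero_le
    rw [if_neg hf, if_neg hg, if_neg hfg, le_max_iff, WithZero.exp_le_exp, WithZero.exp_le_exp,
      Nat.cast_le, Nat.cast_le, ← le_max_iff]
    exact totalDegree_add f g

theorem totalDegreeValuation_of_ne {f : MvPolynomial σ R} (hf : f ≠ 0) :
    totalDegreeValuation f = WithZero.exp (f.totalDegree : ℤ) := if_neg hf

theorem totalDegreeValuation_le (f : MvPolynomial σ R) :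
    totalDegreeValuation f ≤ WithZero.exp (f.totalDegree : ℤ) := by
  by_cases hf : f = 0
  · rw [hf, map_zero]; exact zero_le
  · exact (totalDegreeValuation_of_ne hf).le

end Degree

variable (D : Datum)

/-- Each variable goes to a polynomial of degree at most one. Equality of degrees follows by
applying the bound to the inverse as well. -/
theorem totalDegree_latticeAut_le (v : Fin D.n → ℤ) (w : Equiv.Perm (Fin D.n)) (f : PolyU D) :
    (latticeAut D v w f).totalDegree ≤ f.totalDegree := by
  have h1 : ∀ j, (latticeAut D v w (X j)).totalDegree ≤ 1 := fun j => by
    rw [latticeAut_X]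
    refine (totalDegree_add _ _).trans (max_le ?_ ?_)
    · rw [totalDegree_X]
    · rw [totalDegree_C]; exact zero_le_one
  conv_lhs => rw [f.as_sum, map_sum]
  refine totalDegree_finsetSum_le fun s hs => ?_
  have e : latticeAut D v w (monomial s (coeff s f))
      = C (coeff s f) * ∏ i ∈ s.support, latticeAut D v w (X i) ^ s i := by
    rw [monomial_eq, map_mul, Finsupp.prod, map_prod]
    simp only [map_pow]
    congr 1
    exact AlgEquiv.commutes _ _
  rw [e]
  refine (totalDegree_mul _ _).trans ?_
  rw [totalDegree_C, zero_add]
  refine (totalDegree_finsetProd _ _).trans ((Finset.sum_le_sum fun i _ => ?_).trans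
    (le_totalDegree hs))
  exact (totalDegree_pow _ _).trans ((Nat.mul_le_mul_left _ (h1 i)).trans (mul_one _).le)

theorem totalDegree_latticeAut (v : Fin D.n → ℤ) (w : Equiv.Perm (Fin D.n)) (f : PolyU D) :
    (latticeAut D v w f).totalDegree = f.totalDegree := by
  refine le_antisymm (totalDegree_latticeAut_le D v w f) ?_
  have e : latticeAut D (fun i => -v (w i)) w⁻¹ (latticeAut D v w f) = f := by
    rw [← AlgEquiv.mul_apply, latticeAut_mul, inv_mul_cancel]
    have : (fun i => -v (w i)) + (fun i => v ((w⁻¹)⁻¹ i)) = 0 := by funext i; simp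
    rw [this, latticeAut_zero_one]; rfl
  conv_lhs => rw [← e]
  exact totalDegree_latticeAut_le D _ _ _

/-- The degree valuation on `ℂ(U_1, …, U_n)`. -/
def fieldVal : Valuation (FieldU D) ℤᵐ⁰ :=
  (totalDegreeValuation (σ := Fin D.n) (R := ℂ)).extendToLocalization
    (S := nonZeroDivisors (PolyU D)) (fun f hf h => by
      rw [SetLike.mem_coe, Valuation.mem_supp_iff,
        totalDegreeValuation_of_ne (nonZeroDivisors.ne_zero hf)] at h
      exact WithZero.exp_ne_zero h) (FieldU D)

variable {D}

theorem fieldVal_algebraMap (f : PolyU D) :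
    fieldVal D (algebraMap _ _ f) = totalDegreeValuation f :=
  Valuation.extendToLocalization_apply_map_apply _ _ _ _

theorem fieldVal_fieldAut (v : Fin D.n → ℤ) (w : Equiv.Perm (Fin D.n)) (q : FieldU D) :
    fieldVal D (fieldAut D (latticeAut D v w) q) = fieldVal D q := by
  have h : ∀ f : PolyU D,
      totalDegreeValuation (latticeAut D v w f) = totalDegreeValuation f := fun f => by
    by_cases hf : f = 0
    · rw [hf, map_zero]
    · rw [totalDegreeValuation_of_ne hf, totalDegreeValuation_of_ne
        ((map_ne_zero_iff _ (AlgEquiv.injective _)).2 hf), totalDegree_latticeAut]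
  obtain ⟨f, g, _, rfl⟩ := IsFractionRing.div_surjective (PolyU D) q
  rw [map_div₀, map_div₀, map_div₀, fieldAut_algebraMap, fieldAut_algebraMap, fieldVal_algebraMap,
    fieldVal_algebraMap, fieldVal_algebraMap, fieldVal_algebraMap, h, h]

theorem fieldVal_algebraMap_le (f : PolyU D) :
    fieldVal D (algebraMap _ _ f) ≤ WithZero.exp (f.totalDegree : ℤ) := by
  rw [fieldVal_algebraMap]; exact totalDegreeValuation_le f

theorem fieldVal_complex_le (c : ℂ) : fieldVal D (algebraMap ℂ _ c) ≤ WithZero.exp 0 := by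
  have := fieldVal_algebraMap_le (D := D) (C c)
  rwa [totalDegree_C] at this

theorem fieldVal_X_le (i : Fin D.n) : fieldVal D (algebraMap (PolyU D) _ (X i)) ≤ WithZero.exp 1 := by
  have := fieldVal_algebraMap_le (D := D) (X i)
  rwa [totalDegree_X] at this

theorem fieldVal_mul_le {q q' : FieldU D} {d e : ℤ} (h : fieldVal D q ≤ WithZero.exp d)
    (h' : fieldVal D q' ≤ WithZero.exp e) : fieldVal D (q * q') ≤ WithZero.exp (d + e) := by
  rw [map_mul, WithZero.exp_add]
  exact mul_le_mul' h h'

/-- The bound on the inverse is a lower bound for the degree of U_j - U_i, read off from the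
coefficient of U_j. It makes r an operator of degree -1. -/
theorem fieldVal_fieldDiff {i j : Fin D.n} (h : i ≠ j) :
    fieldVal D (fieldDiff D i j)⁻¹ ≤ WithZero.exp (-1) := by
  have hne : (X j - X i : PolyU D) ≠ 0 := sub_ne_zero.2 fun e => h (X_injective e).symm
  rw [map_inv₀, fieldDiff, fieldVal_algebraMap, totalDegreeValuation_of_ne hne, ← WithZero.exp_neg,
    WithZero.exp_le_exp, neg_le_neg_iff]
  have hs : Finsupp.single j 1 ∈ (X j - X i : PolyU D).support := by
    have hi : (Finsupp.single i 1 : Fin D.n →₀ ℕ) ≠ Finsupp.single j 1 := fun e =>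
      h (Finsupp.single_left_injective one_ne_zero e)
    rw [mem_support_iff, coeff_sub, coeff_X, coeff_X, if_pos rfl, if_neg hi, sub_zero]
    exact one_ne_zero
  have := le_totalDegree hs
  rw [Finsupp.sum_single_index rfl] at this
  exact_mod_cast this

/-! ### The filtration of the operators -/

variable (D) in
/-- The operator `q T^a · (v, w)`. -/
def latTerm (q : FieldU D) (a : diagonalGroup D) (v : Fin D.n → ℤ) (w : Equiv.Perm (Fin D.n)) :
    Module.End ℂ (RatRep D) := mulOp D (ofField D q * ratT D a) * latOp D v w

theorem latTerm_apply (q : FieldU D) (a : diagonalGroup D) (v : Fin D.n → ℤ)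
    (w : Equiv.Perm (Fin D.n)) (f : RatRep D) :
    latTerm D q a v w f = ofField D q * ratT D a * ratAut D v w f := rfl

theorem latTerm_add (q q' : FieldU D) (a : diagonalGroup D) (v : Fin D.n → ℤ)
    (w : Equiv.Perm (Fin D.n)) :
    latTerm D (q + q') a v w = latTerm D q a v w + latTerm D q' a v w :=
  LinearMap.ext fun f => by
    rw [LinearMap.add_apply, latTerm_apply, latTerm_apply, latTerm_apply, map_add, add_mul, add_mul]

theorem latTerm_mul (q q' : FieldU D) (a a' : diagonalGroup D) (v v' : Fin D.n → ℤ)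
    (w w' : Equiv.Perm (Fin D.n)) :
    latTerm D q a v w * latTerm D q' a' v' w'
      = latTerm D (q * fieldAut D (latticeAut D v w) q'
          * algebraMap ℂ _ (latticeChar D v (permA D w a'))) (a * permA D w a')
          (v + fun i => v' (w⁻¹ i)) (w * w') := by
  rw [latTerm, latTerm, mulOp_latOp_mul, latTerm, map_mul, ratAut_ofField, ratAut_ratT, map_mul,
    map_mul, map_mul, algebraMap_ratRep]
  congr 2
  ring

theorem smul_latTerm (c : ℂ) (q : FieldU D) (a : diagonalGroup D) (v : Fin D.n → ℤ)
    (w : Equiv.Perm (Fin D.n)) : c • latTerm D q a v w = latTerm D (algebraMap ℂ _ c * q) a v w :=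
  LinearMap.ext fun f => by
    rw [LinearMap.smul_apply, latTerm_apply, latTerm_apply, Algebra.smul_def, algebraMap_ratRep,
      map_mul, mul_assoc, mul_assoc, mul_assoc]

variable (D) in
/-- The operators of degree at most `d`. -/
def filt (d : ℤ) : AddSubgroup (Module.End ℂ (RatRep D)) :=
  AddSubgroup.closure {Φ | ∃ q a v w, fieldVal D q ≤ WithZero.exp d ∧ Φ = latTerm D q a v w}

theorem latTerm_mem_filt {q : FieldU D} {d : ℤ} (h : fieldVal D q ≤ WithZero.exp d)
    (a : diagonalGroup D) (v : Fin D.n → ℤ) (w : Equiv.Perm (Fin D.n)) :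
    latTerm D q a v w ∈ filt D d := AddSubgroup.subset_closure ⟨q, a, v, w, h, rfl⟩

theorem filt_mono {d e : ℤ} (h : d ≤ e) : filt D d ≤ filt D e := by
  refine AddSubgroup.closure_mono ?_
  rintro _ ⟨q, a, v, w, hq, rfl⟩
  exact ⟨q, a, v, w, hq.trans (WithZero.exp_le_exp.2 h), rfl⟩

/-- The degree valuation is multiplicative and invariant under the lattice automorphisms, and
complex scalars have degree at most 0. -/
theorem filt_mul {d e : ℤ} {Φ Ψ : Module.End ℂ (RatRep D)} (hΦ : Φ ∈ filt D d)
    (hΨ : Ψ ∈ filt D e) : Φ * Ψ ∈ filt D (d + e) := by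
  refine AddSubgroup.closure_induction (p := fun Φ _ => Φ * Ψ ∈ filt D (d + e))
    ?_ ?_ ?_ ?_ hΦ
  · rintro _ ⟨q, a, v, w, hq, rfl⟩
    refine AddSubgroup.closure_induction
      (p := fun Ψ _ => latTerm D q a v w * Ψ ∈ filt D (d + e)) ?_ ?_ ?_ ?_ hΨ
    · rintro _ ⟨q', a', v', w', hq', rfl⟩
      rw [latTerm_mul]
      refine latTerm_mem_filt ?_ _ _ _
      rw [← add_zero (d + e)]
      exact fieldVal_mul_le (fieldVal_mul_le hq (by rwa [fieldVal_fieldAut]))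
        (fieldVal_complex_le _)
    · rw [mul_zero]; exact zero_mem _
    · intro Ψ Ψ' _ _ h h'
      rw [mul_add]; exact add_mem h h'
    · intro Ψ _ h
      have e : latTerm D q a v w * -Ψ = -(latTerm D q a v w * Ψ) :=
        LinearMap.ext fun f => map_neg (latTerm D q a v w) (Ψ f)
      rw [e]; exact neg_mem h
  · rw [zero_mul]; exact zero_mem _
  · intro Φ Φ' _ _ h h'
    rw [add_mul]; exact add_mem h h'
  · intro Φ _ h
    have e : -Φ * Ψ = -(Φ * Ψ) := LinearMap.ext fun f => rfl
    rw [e]; exact neg_mem h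

theorem smul_mem_filt (c : ℂ) {d : ℤ} {Φ : Module.End ℂ (RatRep D)} (h : Φ ∈ filt D d) :
    c • Φ ∈ filt D d := by
  have e : c • Φ = latTerm D (algebraMap ℂ _ c) 1 0 1 * Φ := LinearMap.ext fun f => by
    rw [Module.End.mul_apply, latTerm_apply, ratAut_zero_one, map_one, mul_one,
      LinearMap.smul_apply, Algebra.smul_def]
    rfl
  rw [e, ← zero_add d]
  exact filt_mul (latTerm_mem_filt (fieldVal_complex_le c) _ _ _) h

/-- `Φ` has degree at most `d`, and `Φ'` is its part of degree `d`. -/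
def Leads (d : ℤ) (Φ Φ' : Module.End ℂ (RatRep D)) : Prop :=
  Φ' ∈ filt D d ∧ Φ - Φ' ∈ filt D (d - 1)

theorem leads_latTerm {q : FieldU D} {d : ℤ} (h : fieldVal D q ≤ WithZero.exp d)
    (a : diagonalGroup D) (v : Fin D.n → ℤ) (w : Equiv.Perm (Fin D.n)) :
    Leads d (latTerm D q a v w) (latTerm D q a v w) :=
  ⟨latTerm_mem_filt h a v w, by
    have := (filt D (d - 1)).zero_mem
    rwa [← sub_self (latTerm D q a v w)] at this⟩

theorem Leads.mul {d e : ℤ} {Φ Φ' Ψ Ψ' : Module.End ℂ (RatRep D)} (h : Leads d Φ Φ')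
    (h' : Leads e Ψ Ψ') : Leads (d + e) (Φ * Ψ) (Φ' * Ψ') := by
  refine ⟨filt_mul h.1 h'.1, ?_⟩
  have e1 : Φ * Ψ - Φ' * Ψ' = (Φ - Φ') * (Ψ - Ψ') + (Φ - Φ') * Ψ' + Φ' * (Ψ - Ψ') := by
    refine LinearMap.ext fun f => ?_
    simp only [LinearMap.add_apply, LinearMap.sub_apply, Module.End.mul_apply, map_sub]
    abel
  rw [e1]
  refine add_mem (add_mem (filt_mono (by omega) (filt_mul h.2 h'.2)) ?_) ?_
  · exact filt_mono (by omega) (filt_mul h.2 h'.1)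
  · exact filt_mono (by omega) (filt_mul h.1 h'.2)

theorem ratPi_mul_mem {q : FieldU D} {d : ℤ} (h : fieldVal D q ≤ WithZero.exp d) (i j : Fin D.n)
    (v : Fin D.n → ℤ) (w : Equiv.Perm (Fin D.n)) :
    mulOp D (ofField D q * ratPi D i j) * latOp D v w ∈ filt D d := by
  have e : mulOp D (ofField D q * ratPi D i j) * latOp D v w
      = ∑ z : Mu D, latTerm D (q * algebraMap ℂ _ (D.ℓ : ℂ)⁻¹) (tRatio D i j z) v w :=
    LinearMap.ext fun f => by
      rw [LinearMap.sum_apply]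
      simp only [latTerm_apply, Module.End.mul_apply, LinearMap.mulLeft_apply, latOp_apply, ratPi,
        Finset.mul_sum, Finset.sum_mul, map_mul, ← algebraMap_ratRep, mul_assoc]
  rw [e, ← add_zero d]
  exact sum_mem fun z _ => latTerm_mem_filt (fieldVal_mul_le h (fieldVal_complex_le _)) _ _ _

/-- The r-matrix terms have degree -1, so to leading order S_n acts by plain permutations. -/
theorem leads_permOp (w : Equiv.Perm (Fin D.n)) : Leads 0 (permOp D w) (latTerm D 1 1 0 w) := by
  have one_le : fieldVal D 1 ≤ WithZero.exp 0 := by rw [map_one]; exact le_rfl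
  have hl : ∀ w, latOp D 0 w = latTerm D 1 1 0 w := fun w => by
    rw [latTerm, map_one, map_one, one_mul, mulOp_one_mul_latOp]
  refine perm_adjacent_induction (p := fun w => Leads 0 (permOp D w) (latTerm D 1 1 0 w))
    ?_ (fun i j hij => ?_) (fun v w hv hw => ?_) w
  · have : permOp D 1 = latTerm D 1 1 0 1 := by
      rw [map_one, ← hl]
      exact LinearMap.ext fun f => (ratAut_zero_one f).symm
    rw [this]
    exact leads_latTerm one_le _ _ _
  · have hne : i ≠ j := by rintro rfl; omega
    refine ⟨latTerm_mem_filt one_le _ _ _, ?_⟩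
    have e : permOp D (Equiv.swap i j) - latTerm D 1 1 0 (Equiv.swap i j)
        = mulOp D (rMat D i j) * latOp D 0 (Equiv.swap i j)
          - mulOp D (rMat D i j) * latOp D 0 1 := by
      refine LinearMap.ext fun f => ?_
      rw [permOp_swap hij, ← hl, LinearMap.sub_apply, LinearMap.sub_apply, demazure_apply,
        Module.End.mul_apply, Module.End.mul_apply, LinearMap.mulLeft_apply,
        LinearMap.mulLeft_apply, latOp_apply, latOp_apply, ratAut_zero_one]
      ring
    have hq := fieldVal_mul_le (fieldVal_complex_le (D := D) (D.k * D.ℓ)) (fieldVal_fieldDiff hne)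
    rw [e, zero_sub]
    rw [zero_add] at hq
    exact sub_mem (ratPi_mul_mem hq _ _ _ _) (ratPi_mul_mem hq _ _ _ _)
  · have h := hv.mul hw
    rw [← map_mul, latTerm_mul] at h
    simp only [map_one, mul_one, add_zero] at h
    convert h using 2
    funext i
    simp

theorem leads_sigmaOp : Leads 1 (sigmaOp D)
    (latTerm D (algebraMap (PolyU D) _ (X (first D))) 1 (Pi.single (first D) 1)
      (finRotate D.n)) := by
  refine ⟨latTerm_mem_filt (fieldVal_X_le _) _ _ _, ?_⟩
  have e : sigmaOp D - latTerm D (algebraMap (PolyU D) _ (X (first D))) 1 (Pi.single (first D) 1)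
        (finRotate D.n)
      = latTerm D (algebraMap ℂ _ D.hbar) 1 (Pi.single (first D) 1) (finRotate D.n)
        - ∑ q ∈ Finset.Ico 1 (D.ℓ / D.p),
          latTerm D (algebraMap ℂ _ (D.c (D.p * q) * (toC D D.ζ)⁻¹ ^ (D.p * q)))
            (tPow D (first D) q) (Pi.single (first D) 1) (finRotate D.n) := by
    refine LinearMap.ext fun f => ?_
    rw [LinearMap.sub_apply, LinearMap.sub_apply, LinearMap.sum_apply, sigmaOp_apply]
    simp only [latTerm_apply, ← Finset.sum_mul, map_one, mul_one, ← algebraMap_ratRep]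
    rw [← ratPoly, sigmaFactor, ratU, rotUp]
    ring
  rw [e]
  exact sub_mem (latTerm_mem_filt (fieldVal_complex_le _) _ _ _)
    (sum_mem fun q _ => latTerm_mem_filt (fieldVal_complex_le _) _ _ _)

theorem leads_tauOp : Leads 0 (tauOp D)
    (latTerm D 1 1 (Pi.single (last D) (-1)) (finRotate D.n)⁻¹) := by
  have : tauOp D = latTerm D 1 1 (Pi.single (last D) (-1)) (finRotate D.n)⁻¹ := by
    rw [latTerm, map_one, map_one, one_mul, mulOp_one_mul_latOp]; rfl
  rw [this]
  exact leads_latTerm (by rw [map_one]; exact le_rfl) _ _ _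

/-- To leading order x_i is U_i times the i-th unit translation, and y_i is the inverse translation;
the permutations cancel. -/
theorem leads_xOp (i : Fin D.n) :
    Leads 1 (xOp D i) (latTerm D (algebraMap (PolyU D) _ (X i)) 1 (Pi.single i 1) 1) := by
  have h := ((leads_permOp (Equiv.swap (first D) i)).mul
    (leads_sigmaOp.mul (leads_permOp (finRotate D.n)⁻¹))).mul (leads_permOp (Equiv.swap (first D) i))
  rw [latTerm_mul, latTerm_mul, latTerm_mul] at h
  simp only [map_one, one_mul, mul_one, fieldAut_algebraMap, latticeAut_X, Equiv.swap_apply_left,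
    Pi.zero_apply, Int.cast_zero, mul_zero, map_zero, add_zero, zero_add, mul_inv_cancel,
    Equiv.swap_mul_self] at h
  refine Eq.subst (motive := fun v => Leads _ _ (latTerm D _ 1 v 1)) ?_ h
  funext j
  simp [Pi.single_apply, Equiv.swap_apply_eq_iff]

theorem leads_yOp (i : Fin D.n) :
    Leads 0 (yOp D i) (latTerm D 1 1 (-Pi.single i 1) 1) := by
  have h := ((leads_permOp (Equiv.swap (first D) i)).mul
    ((leads_permOp (finRotate D.n)).mul leads_tauOp)).mul (leads_permOp (Equiv.swap (first D) i))
  rw [latTerm_mul, latTerm_mul, latTerm_mul] at h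
  simp only [map_one, mul_one, add_zero, mul_inv_cancel, Equiv.swap_mul_self] at h
  refine Eq.subst (motive := fun v => Leads _ _ (latTerm D _ 1 v 1)) ?_ h
  funext j
  have e : (finRotate D.n)⁻¹ (Equiv.swap (first D) i j) = last D ↔ j = i := by
    rw [Equiv.Perm.inv_eq_iff_eq, finRotate_last_first, Equiv.swap_apply_eq_iff,
      Equiv.swap_apply_left]
  simp only [Pi.add_apply, Pi.zero_apply, zero_add, add_zero, Equiv.swap_inv, Pi.neg_apply,
    Pi.single_apply, e]
  split_ifs <;> rfl

end

section

open scoped WithZero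
variable {D : Datum}

/-! ### Faithfulness -/

/-- The multiplicities of a multiset. -/
def cnt (α : Multiset (Fin D.n)) : Fin D.n → ℤ := fun i => (α.count i : ℤ)

theorem cnt_cons (i : Fin D.n) (α : Multiset (Fin D.n)) : cnt (i ::ₘ α) = cnt α + Pi.single i 1 := by
  funext j
  by_cases h : j = i
  · subst h; simp [cnt]
  · simp [cnt, h]

theorem Leads.congr {d : ℤ} {Φ Φ' Φ'' : Module.End ℂ (RatRep D)} (h : Leads d Φ Φ')
    (h' : Leads d Φ' Φ'') : Leads d Φ Φ'' := by
  refine ⟨h'.1, ?_⟩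
  rw [← sub_add_sub_cancel Φ Φ' Φ'']
  exact add_mem h.2 h'.2

variable (D) in
/-- The monomial `∏ U_i`. -/
def monoU (α : Multiset (Fin D.n)) : PolyU D := (α.map X).prod

theorem monoU_eq (α : Multiset (Fin D.n)) : monoU D α = monomial (Multiset.toFinsupp α) 1 := by
  induction α using Multiset.induction_on with
  | empty => simp [monoU]
  | cons i α ih =>
    rw [monoU] at ih
    rw [monoU, Multiset.map_cons, Multiset.prod_cons, ih, ← Multiset.singleton_add,
      Multiset.toFinsupp_add, Multiset.toFinsupp_singleton, X, monomial_mul, one_mul]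

theorem sum_toFinsupp (α : Multiset (Fin D.n)) :
    ((Multiset.toFinsupp α).sum fun _ e => e) = α.card := by
  have h := Finsupp.card_toMultiset (Multiset.toFinsupp α)
  rw [Multiset.toFinsupp_toMultiset] at h
  exact h.symm

theorem fieldVal_monoU_le (α : Multiset (Fin D.n)) :
    fieldVal D (algebraMap _ _ (monoU D α)) ≤ WithZero.exp (α.card : ℤ) := by
  have h := fieldVal_algebraMap_le (monoU D α)
  rw [monoU_eq, totalDegree_monomial _ one_ne_zero] at h
  rw [monoU_eq]
  rwa [sum_toFinsupp] at h

theorem hxProd_cons' (i : Fin D.n) (α : Multiset (Fin D.n)) :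
    hxProd D (i ::ₘ α) = hxProd D α * hx D i := by
  simp only [hxProd, Multiset.map_cons, Multiset.noncommProd_cons']

theorem leads_hxProd (α : Multiset (Fin D.n)) : Leads α.card (ratRho D (hxProd D α))
    (latTerm D (algebraMap _ _ (monoU D α)) 1 (cnt α) 1) := by
  induction α using Multiset.induction_on with
  | empty =>
    have h1 : ratRho D (hxProd D 0) = latTerm D (algebraMap _ _ (monoU D 0)) 1 (cnt 0) 1 :=
      LinearMap.ext fun f => by
        have h0 : cnt (0 : Multiset (Fin D.n)) = 0 := by funext j; simp [cnt]
        rw [hxProd_zero, map_one, latTerm_apply, h0, ratAut_zero_one]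
        simp [monoU]
    rw [h1]
    exact leads_latTerm (fieldVal_monoU_le 0) _ _ _
  | cons i α ih =>
    have h := ih.mul (leads_xOp i)
    rw [latTerm_mul, fieldAut_algebraMap, latticeAut_X, ← ratRho_hx, ← map_mul, ← hxProd_cons',
      permA_one, map_one, map_one, mul_one, mul_one, mul_one] at h
    rw [Multiset.card_cons, Nat.cast_succ]
    -- The translation changes U_i by a constant only, and the resulting extra term has lower
    -- degree.
    refine h.congr ?_
    have e1 : (cnt α + fun j => (Pi.single i 1 : Fin D.n → ℤ) ((1 : Equiv.Perm (Fin D.n))⁻¹ j))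
        = cnt (i ::ₘ α) := (cnt_cons i α).symm
    have e2 : algebraMap (PolyU D) (FieldU D) (monoU D α)
          * algebraMap _ _ (X ((1 : Equiv.Perm (Fin D.n)) i)
            + C (D.hbar * (cnt α ((1 : Equiv.Perm (Fin D.n)) i) : ℂ)))
        = algebraMap _ _ (monoU D (i ::ₘ α)) + algebraMap _ _ (monoU D α)
          * algebraMap ℂ _ (D.hbar * (cnt α i : ℂ)) := by
      rw [map_add, mul_add, ← map_mul, monoU, monoU, Multiset.map_cons, Multiset.prod_cons,
        mul_comm (X i)]
      rfl
    rw [e1, e2, latTerm_add]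
    refine ⟨latTerm_mem_filt ?_ _ _ _, ?_⟩
    · have := fieldVal_monoU_le (i ::ₘ α)
      rwa [Multiset.card_cons, Nat.cast_succ] at this
    · rw [add_sub_cancel_left, add_sub_cancel_right, ← add_zero (α.card : ℤ)]
      exact latTerm_mem_filt (fieldVal_mul_le (fieldVal_monoU_le α) (fieldVal_complex_le _)) _ _ _

theorem leads_hyProd (β : Multiset (Fin D.n)) :
    Leads 0 (ratRho D (hyProd D β)) (latTerm D 1 1 (-cnt β) 1) := by
  induction β using Multiset.induction_on with
  | empty =>
    have h1 : ratRho D (hyProd D 0) = latTerm D 1 1 (-cnt 0) 1 :=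
      LinearMap.ext fun f => by
        have h0 : -cnt (0 : Multiset (Fin D.n)) = 0 := by funext j; simp [cnt]
        rw [hyProd_zero, map_one, latTerm_apply, h0, ratAut_zero_one]
        simp
    rw [h1]
    exact leads_latTerm (by rw [map_one]; exact le_rfl) _ _ _
  | cons i β ih =>
    have h := (leads_yOp i).mul ih
    rw [latTerm_mul, ← ratRho_hy, ← map_mul, ← hyProd_cons, permA_one, map_one, map_one, map_one,
      mul_one, mul_one, mul_one, zero_add] at h
    have e1 : (-Pi.single i 1 + fun j => (-cnt β) ((1 : Equiv.Perm (Fin D.n))⁻¹ j))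
        = -cnt (i ::ₘ β) := by
      rw [cnt_cons, neg_add_rev]; rfl
    rwa [e1, mul_one] at h

theorem leads_hg (w : reflectionGroup D) :
    Leads 0 (ratRho D (hg D w)) (latTerm D 1 (diagPart D w) 0 w.1.right) := by
  have h1 : mulOp D (ratT D (diagPart D w)) = latTerm D 1 (diagPart D w) 0 1 := by
    rw [latTerm, map_one, one_mul, mulOp_mul_latOp_one]
  have h := (leads_latTerm (D := D) (q := 1) (d := 0) (by rw [map_one]; exact le_rfl)
    (diagPart D w) 0 1).mul (leads_permOp w.1.right)
  rw [latTerm_mul, ← h1, ← groupOp_eq, ← ratRho_hg] at h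
  have e : ((0 : Fin D.n → ℤ) + fun i => (0 : Fin D.n → ℤ) ((1 : Equiv.Perm (Fin D.n))⁻¹ i)) = 0 := by
    funext i; simp
  rw [e] at h
  simpa only [map_one, mul_one, one_mul, zero_add] using h

variable (D) in
/-- The index of the leading term of `x^α y^β w`. -/
def pbwKey (t : Multiset (Fin D.n) × Multiset (Fin D.n) × reflectionGroup D) :
    diagonalGroup D × (Fin D.n → ℤ) × Equiv.Perm (Fin D.n) :=
  (diagPart D t.2.2, cnt t.1 - cnt t.2.1, t.2.2.1.right)

variable (D) in
/-- The scalar in the leading term of `x^α y^β w`. -/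
def pbwScalar (t : Multiset (Fin D.n) × Multiset (Fin D.n) × reflectionGroup D) : ℂ :=
  latticeChar D (pbwKey D t).2.1 (pbwKey D t).1

theorem pbwScalar_ne_zero (t : Multiset (Fin D.n) × Multiset (Fin D.n) × reflectionGroup D) :
    pbwScalar D t ≠ 0 := by
  rw [pbwScalar, latticeChar_apply]
  exact Finset.prod_ne_zero_iff.2 fun i _ => toC_ne_zero D _

variable (D) in
/-- The operator `q T^a · (v, w)`, with the index `(a, v, w)`. -/
def termOp (t : diagonalGroup D × (Fin D.n → ℤ) × Equiv.Perm (Fin D.n)) :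
    FieldU D →+ Module.End ℂ (RatRep D) where
  toFun q := latTerm D q t.1 t.2.1 t.2.2
  map_zero' := LinearMap.ext fun f => by
    rw [latTerm_apply, map_zero, zero_mul, zero_mul]; rfl
  map_add' q q' := latTerm_add _ _ _ _ _

theorem leads_pbw (t : Multiset (Fin D.n) × Multiset (Fin D.n) × reflectionGroup D) :
    Leads t.1.card (ratRho D (pbw D t))
      (termOp D (pbwKey D t) (algebraMap _ _ (C (pbwScalar D t) * monoU D t.1))) := by
  have h := ((leads_hxProd t.1).mul (leads_hyProd t.2.1)).mul (leads_hg t.2.2)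
  rw [← map_mul, ← map_mul, latTerm_mul, latTerm_mul] at h
  simp only [map_one, mul_one, one_mul, add_zero, permA_one] at h
  have e1 : (cnt t.1 + fun i => (-cnt t.2.1) ((1 : Equiv.Perm (Fin D.n))⁻¹ i))
      = cnt t.1 - cnt t.2.1 := by
    funext i; simp [sub_eq_add_neg]
  have e2 : ((cnt t.1 - cnt t.2.1) + fun i => (0 : Fin D.n → ℤ) ((1 * 1 : Equiv.Perm (Fin D.n))⁻¹ i))
      = cnt t.1 - cnt t.2.1 := by
    funext i; simp
  rw [e1, e2] at h
  rw [map_mul, mul_comm]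
  exact h

/-! ### Independence of the operators -/

variable (D) in
/-- The coefficient of `T^a`. -/
def ratCoeff (a : diagonalGroup D) : RatRep D →+ FieldU D where
  toFun f := (show MonoidAlgebra (FieldU D) (diagonalGroup D) from f).coeff a
  map_zero' := rfl
  map_add' _ _ := rfl

open Classical in
theorem ratCoeff_apply (a b : diagonalGroup D) (q : FieldU D) :
    ratCoeff D a (ofField D q * ratT D b) = if b = a then q else 0 := by
  rw [← single_eq_ofField_mul_ratT]
  exact Finsupp.single_apply

/-- The linear part of the image of a variable gives w, and the constant term gives hbar times a
component of v; for hbar = 0 all translations would coincide. -/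
theorem latticeAut_injective (hbar_ne : D.hbar ≠ 0) :
    Function.Injective fun t : (Fin D.n → ℤ) × Equiv.Perm (Fin D.n) => latticeAut D t.1 t.2 := by
  rintro ⟨v, w⟩ ⟨v', w'⟩ h
  have h1 : ∀ j, (X (w j) + C (D.hbar * v (w j)) : PolyU D) = X (w' j) + C (D.hbar * v' (w' j)) :=
    fun j => by
      rw [← latticeAut_X, ← latticeAut_X]; exact DFunLike.congr_fun h (X j)
  have hw : w = w' := by
    ext1 j
    by_contra hne
    have h2 := congrArg (coeff (Finsupp.single (w j) 1)) (h1 j)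
    have h3 : (Finsupp.single (w' j) 1 : Fin D.n →₀ ℕ) ≠ Finsupp.single (w j) 1 := fun e =>
      hne (Finsupp.single_left_injective one_ne_zero e).symm
    have h4 : (0 : Fin D.n →₀ ℕ) ≠ Finsupp.single (w j) 1 := by
      intro e
      simpa using DFunLike.congr_fun e (w j)
    rw [coeff_add, coeff_add, coeff_X, coeff_X, coeff_C, coeff_C, if_pos rfl, if_neg h3,
      if_neg h4, if_neg h4] at h2
    simp at h2
  subst hw
  have hv : v = v' := by
    funext i
    have h2 := add_left_cancel (h1 (w⁻¹ i))
    have h3 := mul_left_cancel₀ hbar_ne (C_injective _ _ h2)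
    simpa using h3
  rw [hv]

/-- Applied to γ in Γ, the coefficient of T^a is a K-combination of distinct multiplicative maps
from Γ to K, so independence of characters applies for each a separately. -/
theorem eq_zero_of_sum_termOp (hbar_ne : D.hbar ≠ 0)
    {m : (diagonalGroup D × (Fin D.n → ℤ) × Equiv.Perm (Fin D.n)) →₀ FieldU D}
    (h : Finsupp.liftAddHom (termOp D) m = 0) : m = 0 := by
  classical
  let χ : (Fin D.n → ℤ) × Equiv.Perm (Fin D.n) → (PolyU D →* FieldU D) := fun t =>
    ((fieldAut D (latticeAut D t.1 t.2)).toRingHom.comp (algebraMap (PolyU D) (FieldU D)) :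
      PolyU D →+* FieldU D)
  have hχ : Function.Injective χ := by
    intro t t' e
    refine latticeAut_injective hbar_ne (AlgEquiv.ext fun f => ?_)
    have h1 : fieldAut D (latticeAut D t.1 t.2) (algebraMap _ _ f)
        = fieldAut D (latticeAut D t'.1 t'.2) (algebraMap _ _ f) := DFunLike.congr_fun e f
    rw [fieldAut_algebraMap, fieldAut_algebraMap] at h1
    exact FaithfulSMul.algebraMap_injective _ _ h1
  have hli := (linearIndependent_monoidHom (PolyU D) (FieldU D)).comp χ hχ
  ext ⟨a, t⟩
  by_contra hne
  let g : (Fin D.n → ℤ) × Equiv.Perm (Fin D.n) → FieldU D := fun t => m (a, t)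
  have h1 := linearIndependent_iff'.1 hli (m.support.image Prod.snd) g (by
    funext γ
    have h2 := congrArg (ratCoeff D a)
      (LinearMap.congr_fun h (ofField D (algebraMap (PolyU D) (FieldU D) γ)))
    rw [Finsupp.liftAddHom_apply, Finsupp.sum, LinearMap.sum_apply, map_sum, LinearMap.zero_apply,
      map_zero] at h2
    rw [Finset.sum_apply, Pi.zero_apply, ← h2]
    have h3 : ∀ s ∈ m.support, ratCoeff D a (termOp D s (m s) (ofField D (algebraMap _ _ γ)))
        = if s.1 = a then m s * χ s.2 γ else 0 := by
      intro s _
      show ratCoeff D a (ofField D (m s) * ratT D s.1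
        * ratAut D s.2.1 s.2.2 (ofField D (algebraMap _ _ γ))) = _
      rw [ratAut_ofField, mul_right_comm, ← map_mul, ratCoeff_apply]
      rfl
    rw [Finset.sum_congr rfl h3, ← Finset.sum_filter]
    symm
    -- Terms with first index a are indexed by their pair (v, w); the remaining pairs have
    -- coefficient zero.
    refine Finset.sum_of_injOn Prod.snd ?_ ?_ ?_ ?_
    · rintro ⟨b, s⟩ hs ⟨b', s'⟩ hs' e
      simp only [Finset.coe_filter, Set.mem_ofPred_eq] at hs hs' e
      rw [hs.2, hs'.2, e]
    · intro s hs
      rw [Finset.mem_coe, Finset.mem_filter] at hs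
      exact Finset.mem_coe.2 (Finset.mem_image_of_mem _ hs.1)
    · intro s _ hs'
      have : m (a, s) = 0 := by
        by_contra h0
        exact hs' ⟨(a, s), by
          rw [Finset.mem_coe, Finset.mem_filter]
          exact ⟨Finsupp.mem_support_iff.2 h0, rfl⟩, rfl⟩
      show m (a, s) * χ s γ = 0
      rw [this, zero_mul]
    · rintro ⟨b, s⟩ hs
      rw [Finset.mem_filter] at hs
      obtain ⟨_, rfl⟩ := hs
      rfl)
  exact hne (h1 t (Finset.mem_image.2 ⟨(a, t), Finsupp.mem_support_iff.2 hne, rfl⟩))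

theorem exists_of_mem_filt {d : ℤ} {Φ : Module.End ℂ (RatRep D)} (h : Φ ∈ filt D d) :
    ∃ m : (diagonalGroup D × (Fin D.n → ℤ) × Equiv.Perm (Fin D.n)) →₀ FieldU D,
      (∀ t, fieldVal D (m t) ≤ WithZero.exp d) ∧ Finsupp.liftAddHom (termOp D) m = Φ := by
  classical
  refine AddSubgroup.closure_induction
    (p := fun Φ _ => ∃ m : (diagonalGroup D × (Fin D.n → ℤ) × Equiv.Perm (Fin D.n)) →₀ FieldU D,
      (∀ t, fieldVal D (m t) ≤ WithZero.exp d) ∧ Finsupp.liftAddHom (termOp D) m = Φ)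
    ?_ ?_ ?_ ?_ h
  · rintro _ ⟨q, a, v, w, hq, rfl⟩
    refine ⟨Finsupp.single (a, v, w) q, fun t => ?_, Finsupp.liftAddHom_apply_single _ _ _⟩
    rw [Finsupp.single_apply]
    split_ifs
    · exact hq
    · rw [map_zero]; exact zero_le
  · exact ⟨0, fun t => by rw [Finsupp.zero_apply, map_zero]; exact zero_le, map_zero _⟩
  · rintro _ _ _ _ ⟨m, hm, rfl⟩ ⟨m', hm', rfl⟩
    exact ⟨m + m', fun t => (Valuation.map_add _ _ _).trans (max_le (hm t) (hm' t)), map_add _ _ _⟩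
  · rintro _ _ ⟨m, hm, rfl⟩
    exact ⟨-m, fun t => by rw [Finsupp.neg_apply, Valuation.map_neg]; exact hm t, map_neg _ _⟩

/-- The key retains the group element and α - β, so the monomial U^α supplies the only missing
datum. -/
theorem pbw_ext {t t' : Multiset (Fin D.n) × Multiset (Fin D.n) × reflectionGroup D}
    (h : pbwKey D t = pbwKey D t') (h' : t.1 = t'.1) : t = t' := by
  obtain ⟨α, β, w⟩ := t
  obtain ⟨α', β', w'⟩ := t'
  simp only [pbwKey, Prod.mk.injEq] at h h'
  obtain ⟨h1, h2, h3⟩ := h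
  subst h'
  have hβ : β = β' := by
    ext i
    have h : (β.count i : ℤ) = β'.count i := congrFun (sub_right_injective h2) i
    exact_mod_cast h
  have hw : w = w' := by
    apply Subtype.ext
    refine SemidirectProduct.ext ?_ h3
    exact congrArg Subtype.val h1
  rw [hβ, hw]

/-- In a vanishing combination of monomials the symbols of top x-degree d must cancel modulo degree
d - 1. For a fixed key these symbols are multiples of distinct monomials U^α, so no cancellation can
occur. -/
theorem ratRho_injective (hbar_ne : D.hbar ≠ 0) : Function.Injective (ratRho D) := by
  classical
  rw [injective_iff_map_eq_zero]
  intro h h0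
  obtain ⟨c, rfl⟩ := Finsupp.mem_span_range_iff_exists_finsupp.1 (mem_span_pbw h)
  by_contra hne
  have hc : c.support.Nonempty := by
    rw [Finset.nonempty_iff_ne_empty]
    intro e
    rw [Finsupp.support_eq_empty] at e
    exact hne (by rw [e, Finsupp.sum_zero_index])
  obtain ⟨t₀, ht₀, hmax⟩ := Finset.exists_max_image c.support (fun t => t.1.card) hc
  set d : ℤ := (t₀.1.card : ℤ) with hd
  let sym := fun t : Multiset (Fin D.n) × Multiset (Fin D.n) × reflectionGroup D =>
    algebraMap (PolyU D) (FieldU D) (C (c t * pbwScalar D t) * monoU D t.1)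
  have hsym : ∀ t, c t • termOp D (pbwKey D t)
      (algebraMap _ _ (C (pbwScalar D t) * monoU D t.1)) = termOp D (pbwKey D t) (sym t) := by
    intro t
    show c t • latTerm D _ _ _ _ = latTerm D _ _ _ _
    rw [smul_latTerm]
    congr 1
    simp only [sym]
    rw [C_mul, mul_assoc, map_mul _ (C (c t))]
    rfl
  set S := c.support.filter fun t => t.1.card = t₀.1.card with hS
  -- The whole operator is zero, so the leading terms sum to minus the lower-order remainders.
  have h1 : ∑ t ∈ c.support, termOp D (pbwKey D t) (sym t) ∈ filt D (d - 1) := by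
    have e : ∑ t ∈ c.support, termOp D (pbwKey D t) (sym t)
        = -∑ t ∈ c.support, c t • (ratRho D (pbw D t) - termOp D (pbwKey D t)
          (algebraMap _ _ (C (pbwScalar D t) * monoU D t.1))) := by
      have e0 : ∑ t ∈ c.support, c t • ratRho D (pbw D t) = 0 := by
        rw [← h0, Finsupp.sum, map_sum]
        simp only [map_smul]
      simp only [smul_sub, Finset.sum_sub_distrib, hsym]
      rw [e0, zero_sub, neg_neg]
    rw [e]
    refine neg_mem (sum_mem fun t ht => smul_mem_filt _ (filt_mono ?_ (leads_pbw t).2))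
    have := hmax t ht
    omega
  -- Monomials of smaller x-degree lie in degree d - 1 and can be discarded.
  have h2 : ∑ t ∈ S, termOp D (pbwKey D t) (sym t) ∈ filt D (d - 1) := by
    rw [← Finset.sum_filter_add_sum_filter_not c.support (fun t => t.1.card = t₀.1.card)] at h1
    refine (add_mem_cancel_right (sum_mem fun t ht => ?_)).1 h1
    rw [Finset.mem_filter] at ht
    rw [← hsym]
    refine smul_mem_filt _ (filt_mono ?_ (leads_pbw t).1)
    have := hmax t ht.1
    have := ht.2
    omega
  obtain ⟨m, hm, hmS⟩ := exists_of_mem_filt h2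
  -- Coefficients are unique, so the degree bound on the sum passes to each key separately.
  have h3 : m = ∑ t ∈ S, Finsupp.single (pbwKey D t) (sym t) := by
    rw [← sub_eq_zero]
    apply eq_zero_of_sum_termOp hbar_ne
    rw [map_sub, hmS, map_sum]
    simp only [Finsupp.liftAddHom_apply_single]
    rw [sub_self]
  let P : PolyU D := ∑ t ∈ S, if pbwKey D t = pbwKey D t₀ then
    C (c t * pbwScalar D t) * monoU D t.1 else 0
  have h4 : m (pbwKey D t₀) = algebraMap _ _ P := by
    rw [h3, Finsupp.finsetSum_apply, map_sum]
    refine Finset.sum_congr rfl fun t _ => ?_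
    rw [Finsupp.single_apply]
    split_ifs
    · rfl
    · rw [map_zero]
  have h5 : coeff (Multiset.toFinsupp t₀.1) P = c t₀ * pbwScalar D t₀ := by
    rw [coeff_sum, Finset.sum_eq_single t₀]
    · rw [if_pos rfl, coeff_C_mul, monoU_eq, coeff_monomial, if_pos rfl, mul_one]
    · intro t _ ht
      split_ifs with hk
      · rw [coeff_C_mul, monoU_eq, coeff_monomial, if_neg, mul_zero]
        exact fun e => ht (pbw_ext hk (Multiset.toFinsupp.injective e))
      · rw [coeff_zero]
    · intro ht
      exact (ht (by rw [hS, Finset.mem_filter]; exact ⟨ht₀, rfl⟩)).elim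
  have h6 : coeff (Multiset.toFinsupp t₀.1) P ≠ 0 := by
    rw [h5]
    exact mul_ne_zero (Finsupp.mem_support_iff.1 ht₀) (pbwScalar_ne_zero t₀)
  have hP : P ≠ 0 := by
    intro e; rw [e, coeff_zero] at h6; exact h6 rfl
  have h7 := hm (pbwKey D t₀)
  -- P contains a monomial of degree d with nonzero coefficient, against the bound d - 1.
  rw [h4, fieldVal_algebraMap, totalDegreeValuation_of_ne hP, WithZero.exp_le_exp] at h7
  have h8 := le_totalDegree (mem_support_iff.2 h6)
  rw [sum_toFinsupp] at h8
  omega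

/-- If h = e' h e', its action is determined by its restriction to e' · `RatRep`, which is what the
skew element records; faithfulness of the full representation does the rest. -/
theorem iota_injective (hbar_ne : D.hbar ≠ 0) : Function.Injective (iota D) := by
  rw [injective_iff_map_eq_zero]
  intro h h0
  apply Subtype.ext
  apply ratRho_injective hbar_ne
  refine LinearMap.ext fun f => ?_
  show ratRho D h.1 f = ratRho D 0 f
  rw [map_zero, LinearMap.zero_apply]
  have e1 : ratRho D h.1 f = ratRho D h.1 (ofField D (evChar D 1 f) * ratAvg D) := by
    rw [← mul_ratAvg, mul_comm]
    conv_lhs => rw [← coe_mul_ePrime, map_mul, ratRho_ePrime]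
    rfl
  rw [e1, ratRho_coe_apply, ← evalAt_iota, h0, evalAt_zero, map_zero, zero_mul]

end

end PartiallySpherical

end

theorem mainTheorem4 (D : PartiallySpherical.Datum) (hbar_ne : D.hbar ≠ 0) :
    ∃ ρ : PartiallySpherical.H D →ₐ[ℂ] Module.End ℂ (PartiallySpherical.PolyRep D),
      PartiallySpherical.IsPolynomialRep D ρ ∧
      ∃ i : PartiallySpherical.Psph D →+* PartiallySpherical.SkewU D,
        Function.Injective i ∧
        (∀ (h : PartiallySpherical.Psph D) (f : PartiallySpherical.PolyU D),
          ∃ g : PartiallySpherical.PolyU D,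
            ρ h.1 (PartiallySpherical.embed D f) = PartiallySpherical.embed D g ∧
            PartiallySpherical.evalAt (i h)
                (algebraMap (PartiallySpherical.PolyU D) (PartiallySpherical.FieldU D) f)
              = algebraMap (PartiallySpherical.PolyU D) (PartiallySpherical.FieldU D) g) ∧
        PartiallySpherical.IsPrincipalGaloisOrder (K := PartiallySpherical.FieldU D)
          (M := PartiallySpherical.affineGroup D) (PartiallySpherical.PolyU D)
          (RingHom.range (R := PartiallySpherical.Psph D) (S := PartiallySpherical.SkewU D) i) := by
  exact ⟨PartiallySpherical.polyRho D, PartiallySpherical.isPolynomialRep,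
    PartiallySpherical.iota D, PartiallySpherical.iota_injective hbar_ne,
    PartiallySpherical.polyRho_embed, PartiallySpherical.isPrincipalGaloisOrder_range⟩
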